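/- Let $d\ge 1$, $T>0$, $\lambda\in(0,2)$, $c_\lambda>0$ and $Q_T=\mathbb{R}^d\times(0,T)$. Let $f=(f_1,\dots,f_d):\mathbb{R}\to\mathbb{R}^d$ and $A:\mathbb{R}\to\mathbb{R}$ be Lipschitz continuous, $A$ non-decreasing with Lipschitz constant $L_A$ and $A(0)=0$, and let $u_0:\mathbb{R}^d\to\mathbb{R}$ be locally integrable. Consider $$\partial_t u+\nabla\cdot f(u)=-(-\Delta)^{\lambda/2}A(u)\ \text{ in } Q_T,\qquad u(\cdot,0)=u_0, \tag{1}$$ where $-(-\Delta)^{\lambda/2}\phi(x)=c_\lambda\,\mathrm{P.V.}\int_{|z|>0}\frac{\phi(x+z)-\phi(x)}{|z|^{d+\lambda}}\,dz$. *Entropy solutions.* For $r>0$ put $$g_r[\varphi](x)=c_\lambda\lim_{b\downarrow0}\int_{b<|z|<r}\frac{\varphi(x+z)-\varphi(x)}{|z|^{d+\lambda}}\,dz,\qquad g^r[\psi](x)=c_\lambda\int_{|z|>r}\frac{\psi(x+z)-\psi(x)}{|z|^{d+\lambda}}\,dz ,$$ and for $k\in\mathbb{R}$ put $\eta_k(u)=|u-k|$,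 $\eta_k'(u)=\operatorname{sgn}(u-k)$ with $\operatorname{sgn}(0)=0$, and $q_k(u)=\eta_k'(u)(f(u)-f(k))$. A function $u$ is an entropy solution of (1) if (i) $u\in L^\infty(Q_T)\cap C([0,T];L^1(\mathbb{R}^d))$; (ii) for all $k\in\mathbb{R}$, all $r>0$ and all nonnegative $\varphi\in C_c^\infty(Q_T)$, the integral below exists (its integrand is integrable) and $$\iint_{Q_T}\eta_k(u)\,\partial_t\varphi+q_k(u)\cdot\nabla\varphi+\eta_{A(k)}(A(u))\,g_r[\varphi]+\eta_k'(u)\,g^r[A(u)]\,\varphi\;dx\,dt\ge0;$$ (iii) $u(\cdot,0)=u_0$ a.e. *The scheme.* For $m\in\mathbb{N}$ let $\Delta x=\Delta x_m>0$, $\Delta t=\Delta t_m>0$ and $N=N_m\in\mathbb{N}$ with $N\Delta t=T$, and $\Delta x_m\to0$ as $m\to\infty$. For $1\le l\le d$ let $F_l=F_l^{(m)}:\mathbb{R}^2\to\mathbb{R}$ satisfy $F_l(v,v)=f_l(v)$, be non-decreasing in the first and non-increasing in the second variable, and satisfy $|F_l(a,b)-F_l(a',b')|\le L_F(|a-a'|+|b-b'|)$,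 with a constant $L_F$ independent of $l$ and $m$. With $x_\alpha=\Delta x\,\alpha$ for $\alpha\in\mathbb{Z}^d$, $R=\Delta x[0,1)^d$, $R_0=\frac{\Delta x}2[-1,1)^d$ and $G_\beta=c_\lambda\int_{x_\beta+R_0}|z|^{-d-\lambda}\,dz$ for $\beta\ne0$, let $(U^n_\alpha)_{0\le n\le N,\ \alpha\in\mathbb{Z}^d}$ solve $$U^{n+1}_\alpha=U^n_\alpha-\Delta t\sum_{l=1}^d\frac{F_l(U^n_\alpha,U^n_{\alpha+e_l})-F_l(U^n_{\alpha-e_l},U^n_\alpha)}{\Delta x}+\Delta t\sum_{\beta\neq0}G_\beta\big(A(U^n_{\alpha+\beta})-A(U^n_\alpha)\big)\quad(0\le n<N),$$ $$U^0_\alpha=\frac1{\Delta x^d}\int_{x_\alpha+R}u_0(x)\,dx,$$ and let $\bar u_m(x,t)=U^n_\alpha$ for $(x,t)\in(x_\alpha+R)\times[n\Delta t,(n+1)\Delta t)$. Assume that for every $m$ the CFL condition $$2dL_F\frac{\Delta t}{\Delta x}+\Big(c_\lambda2^\lambda L_A\int_{|z|>1}\frac{dz}{|z|^{d+\lambda}}\Big)\frac{\Delta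 t}{\Delta x^\lambda}\le1$$ holds. **Theorem.** Suppose that $(\bar u_m)$ is uniformly bounded in $L^\infty(Q_T)$ and that there is $u\in L^\infty(Q_T)\cap C([0,T];L^1(\mathbb{R}^d))$ such that $$\sup_{t\in[0,T]}\|\bar u_m(\cdot,t)-u(\cdot,t)\|_{L^1(\mathbb{R}^d)}\to0\quad\text{as } m\to\infty.$$ Then $u$ is an entropy solution of (1). -/

import Mathlib

open MeasureTheory Filter Topology Set
open scoped NNReal ENNReal ContDiff

noncomputable section

namespace FracConvDiff

/-- The Euclidean space `ℝ^d`. -/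
abbrev Space (d : ℕ) : Type := EuclideanSpace ℝ (Fin d)

/-- The space-time cylinder `Q_T = ℝ^d × (0,T)`. -/
def cylinder (d : ℕ) (T : ℝ) : Set (Space d × ℝ) := univ ×ˢ Ioo 0 T

/-! ### The nonlocal operator, split at radius `r` -/

/-- The singular kernel `|z|^{-(d+lam)}`. -/
def kernel (d : ℕ) (lam : ℝ) (z : Space d) : ℝ := 1 / ‖z‖ ^ ((d : ℝ) + lam)

/-- `g_r[φ](x) = c · P.V. ∫_{|z|<r} (φ(x+z) - φ(x)) / |z|^{d+lam} dz`, the principal value being the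
limit as `b ↓ 0` of the integral over `b < |z| < r`. It is applied to smooth functions with compact
support only, for which this limit exists. -/
def gInner {d : ℕ} (c lam r : ℝ) (φ : Space d → ℝ) (x : Space d) : ℝ :=
  c * limUnder (𝓝[>] (0 : ℝ)) fun b =>
    ∫ z in {z : Space d | b < ‖z‖ ∧ ‖z‖ < r}, (φ (x + z) - φ x) * kernel d lam z

/-- `g^r[ψ](x) = c ∫_{|z|>r} (ψ(x+z) - ψ(x)) / |z|^{d+lam} dz`. -/
def gOuter {d : ℕ} (c lam r : ℝ) (ψ : Space d → ℝ) (x : Space d) : ℝ :=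
  c * ∫ z in {z : Space d | r < ‖z‖}, (ψ (x + z) - ψ x) * kernel d lam z

/-! ### Entropy solutions -/

/-- The Kruzkov entropy `η_k(u) = |u - k|`. -/
def entropy (k u : ℝ) : ℝ := |u - k|

/-- Its derivative `η'_k(u) = sgn(u - k)`, with `sgn 0 = 0`. -/
def entropySign (k u : ℝ) : ℝ := Real.sign (u - k)

/-- The entropy flux `q_k(u) = sgn(u - k) (f(u) - f(k))`. -/
def entropyFlux {d : ℕ} (f : ℝ → Space d) (k u : ℝ) : Space d :=
  entropySign k u • (f u - f k)

/-- `u ∈ L^∞(Q_T) ∩ C([0,T]; L^1(ℝ^d))`. Only the values of `u` for times in `[0,T]` matter. -/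
structure IsBoundedContL1 {d : ℕ} (T : ℝ) (u : Space d × ℝ → ℝ) : Prop where
  memLp_top : MemLp u ∞ (volume.restrict (cylinder d T))
  integrable : ∀ t ∈ Icc 0 T, Integrable fun x : Space d => u (x, t)
  continuous : ∀ t ∈ Icc 0 T,
    Tendsto (fun s => eLpNorm (fun x : Space d => u (x, s) - u (x, t)) 1 volume)
      (𝓝[Icc 0 T] t) (𝓝 0)

/-- Nonnegative test functions in `C_c^∞(Q_T)`. -/
structure IsTestFunction {d : ℕ} (T : ℝ) (φ : Space d × ℝ → ℝ) : Prop where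
  smooth : ContDiff ℝ ∞ φ
  compact : HasCompactSupport φ
  support : tsupport φ ⊆ cylinder d T
  nonneg : ∀ p, 0 ≤ φ p

/-- The integrand
`η_k(u) ∂_tφ + q_k(u)·∇φ + η_{A(k)}(A(u)) g_r[φ] + η'_k(u) g^r[A(u)] φ`
of the entropy inequality, at the point `p = (x,t)`. -/
def entropyIntegrand {d : ℕ} (c lam : ℝ) (f : ℝ → Space d) (A : ℝ → ℝ) (k r : ℝ)
    (u φ : Space d × ℝ → ℝ) (p : Space d × ℝ) : ℝ :=
  entropy k (u p) * deriv (fun s => φ (p.1, s)) p.2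
    + inner ℝ (entropyFlux f k (u p)) (gradient (fun y => φ (y, p.2)) p.1)
    + entropy (A k) (A (u p)) * gInner c lam r (fun y => φ (y, p.2)) p.1
    + entropySign k (u p) * gOuter c lam r (fun y => A (u (y, p.2))) p.1 * φ p

/-- `u` is an entropy solution on `Q_T` of
`∂_t u + ∇·f(u) = -(-Δ)^{lam/2} A(u)`, `u(·,0) = u₀`. -/
structure IsEntropySolution {d : ℕ} (c lam T : ℝ) (f : ℝ → Space d) (A : ℝ → ℝ)
    (u₀ : Space d → ℝ) (u : Space d × ℝ → ℝ) : Prop where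
  regularity : IsBoundedContL1 T u
  entropy_ineq : ∀ k r : ℝ, 0 < r → ∀ φ : Space d × ℝ → ℝ, IsTestFunction T φ →
    IntegrableOn (entropyIntegrand c lam f A k r u φ) (cylinder d T) ∧
      0 ≤ ∫ p in cylinder d T, entropyIntegrand c lam f A k r u φ p
  initial : (fun x => u (x, 0)) =ᵐ[volume] u₀

/-! ### The difference-quadrature scheme -/

/-- Admissible numerical fluxes `F(u₁,u₂)` for a scalar flux `f`: Lipschitz with constant `LF` (in
each variable), consistent with `f`, non-decreasing in `u₁` and non-increasing in `u₂`. -/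
structure IsNumericalFlux (LF : ℝ≥0) (f : ℝ → ℝ) (F : ℝ → ℝ → ℝ) : Prop where
  lipschitz : ∀ a b a' b', |F a b - F a' b'| ≤ LF * (|a - a'| + |b - b'|)
  consistent : ∀ a, F a a = f a
  monotone_fst : ∀ b, Monotone fun a => F a b
  antitone_snd : ∀ a, Antitone fun b => F a b

/-- The cell `x_α + Δx [0,1)^d`, where `x_α = Δx α`. -/
def cell {d : ℕ} (Δx : ℝ) (α : Fin d → ℤ) : Set (Space d) :=
  {x | ∀ l, Δx * α l ≤ x l ∧ x l < Δx * α l + Δx}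

/-- The centred cell `x_α + (Δx/2) [-1,1)^d`. -/
def centredCell {d : ℕ} (Δx : ℝ) (α : Fin d → ℤ) : Set (Space d) :=
  {z | ∀ l, Δx * α l - Δx / 2 ≤ z l ∧ z l < Δx * α l + Δx / 2}

/-- The quadrature weight `G_α = c ∫_{x_α + (Δx/2)[-1,1)^d} |z|^{-(d+lam)} dz`, used for `α ≠ 0`. -/
def weight {d : ℕ} (c lam Δx : ℝ) (α : Fin d → ℤ) : ℝ :=
  c * ∫ z in centredCell Δx α, kernel d lam z

/-- `U^n_α`, `n = 0,…,N`, solves the explicit scheme with mesh sizes `Δx`, `Δt`. Here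
`Pi.single l 1` is the `l`-th unit vector `e_l` of `ℤ^d`, and the summand of the first sum is
`D_l^- F_l(U^n_α, U^n_{α+e_l})`. The sum over `β ≠ 0` converges absolutely whenever `U^n` is
bounded. -/
structure IsSchemeSolution {d : ℕ} (c lam : ℝ) (A : ℝ → ℝ) (F : Fin d → ℝ → ℝ → ℝ)
    (u₀ : Space d → ℝ) (Δx Δt : ℝ) (N : ℕ) (U : ℕ → (Fin d → ℤ) → ℝ) : Prop where
  init : ∀ α, U 0 α = 1 / Δx ^ d * ∫ x in cell Δx α, u₀ x
  step : ∀ n < N, ∀ α, U (n + 1) α = U n α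
    - Δt * ∑ l, (F l (U n α) (U n (α + Pi.single l 1))
        - F l (U n (α - Pi.single l 1)) (U n α)) / Δx
    + Δt * ∑' β : {β : Fin d → ℤ // β ≠ 0}, weight c lam Δx β.1 * (A (U n (α + β.1)) - A (U n α))

/-- The CFL condition. -/
def CFL (d : ℕ) (c lam : ℝ) (LF LA : ℝ≥0) (Δx Δt : ℝ) : Prop :=
  2 * d * LF * (Δt / Δx)
    + (c * 2 ^ lam * LA * ∫ z in {z : Space d | 1 < ‖z‖}, kernel d lam z) * (Δt / Δx ^ lam) ≤ 1

/-- The piecewise constant interpolation `ū(x,t) = U^n_α` for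
`(x,t) ∈ (x_α + Δx [0,1)^d) × [nΔt, (n+1)Δt)`; see `interp_eq`. -/
def interp {d : ℕ} (Δx Δt : ℝ) (U : ℕ → (Fin d → ℤ) → ℝ) (p : Space d × ℝ) : ℝ :=
  U ⌊p.2 / Δt⌋₊ fun l => ⌊p.1 l / Δx⌋

theorem interp_eq {d : ℕ} {Δx Δt : ℝ} (hx : 0 < Δx) (ht : 0 < Δt) (U : ℕ → (Fin d → ℤ) → ℝ)
    {n : ℕ} {α : Fin d → ℤ} {x : Space d} {t : ℝ} (hxα : x ∈ cell Δx α)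
    (htn : t ∈ Ico (n * Δt) ((n + 1) * Δt)) : interp Δx Δt U (x, t) = U n α := by
  have h1 : ⌊t / Δt⌋₊ = n := by
    rw [Nat.floor_eq_iff (div_nonneg (le_trans (by positivity) htn.1) ht.le)]
    exact ⟨(le_div_iff₀ ht).2 htn.1, (div_lt_iff₀ ht).2 htn.2⟩
  have h2 : (fun l => ⌊x l / Δx⌋) = α := by
    funext l
    rw [Int.floor_eq_iff]
    obtain ⟨h, h'⟩ := hxα l
    exact ⟨(le_div_iff₀ hx).2 (by linarith), (div_lt_iff₀ hx).2 (by linarith)⟩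
  simp only [interp, h1, h2]

end FracConvDiff

end

/-!
The quadrature is a discretised singular integral: rounding `z` to the nearest grid point turns
`∑ G_β (g(x_β) - g(0))` into an integral of `g(rounded z) - g(0)` against the kernel. Read this way,
the scheme is satisfied pointwise by the interpolation `v`, at every point of space. By the
CFL condition one step of the scheme is monotone in all the values it uses, so comparing the steps
from `v`, from `max v k` and from `min v k` gives a discrete entropy inequality; the quadrature over
`|z| ≤ r` only enters through `|A(v) - A(k)|`, by convexity. Multiplying by a test function `φ` and
moving all the differences onto `φ` leaves an integrand which converges to that of the entropy
inequality, provided `sgn (v - k)` converges to `sgn (u - k)`. Along an a.e. convergent subsequence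
this holds off the level set `{u = k}`, which is null for all but countably many `k`. An arbitrary
`k` is approximated by such levels from both sides; since `sgn 0 = 0` is the average of `sgn (0±)`,
the mean of the two inequalities tends to the one for `k`.
-/

noncomputable section

namespace FracConvDiff

/-! ### The kernel -/

section Kernel

variable {d : ℕ} {lam r s : ℝ}

lemma kernel_nonneg (z : Space d) : 0 ≤ kernel d lam z := by
  unfold kernel; positivity

lemma kernel_neg (z : Space d) : kernel d lam (-z) = kernel d lam z := by
  simp only [kernel, norm_neg]

@[fun_prop]
lemma measurable_kernel : Measurable (kernel d lam) := by
  unfold kernel; fun_prop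

lemma norm_mul_kernel (a : ℝ) (z : Space d) : ‖a * kernel d lam z‖ = |a| * kernel d lam z := by
  rw [norm_mul, Real.norm_of_nonneg (kernel_nonneg z), Real.norm_eq_abs]

lemma compl_closedBall_zero (r : ℝ) : (Metric.closedBall (0 : Space d) r)ᶜ = {z | r < ‖z‖} := by
  ext z; simp only [mem_compl_iff, mem_closedBall_zero_iff, not_le, mem_ofPred_eq]

lemma measurableSet_lt_norm (r : ℝ) : MeasurableSet {z : Space d | r < ‖z‖} :=
  measurableSet_lt measurable_const measurable_norm

lemma integrableOn_kernel_of_le_norm (hlam : 0 < lam) (hr : 0 < r) :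
    IntegrableOn (kernel d lam) {z | r ≤ ‖z‖} := by
  have hdecay : Integrable (fun z : Space d => (1 + ‖z‖) ^ (-((d : ℝ) + lam))) :=
    integrable_one_add_norm (by simp [hlam])
  refine ((hdecay.const_mul (((1 + r) / r) ^ ((d : ℝ) + lam))).integrableOn).mono'
    (by fun_prop) ?_
  filter_upwards [ae_restrict_mem (measurableSet_le measurable_const measurable_norm)]
    with z (hz : r ≤ ‖z‖)
  have hz0 : 0 < ‖z‖ := hr.trans_le hz
  rw [Real.norm_of_nonneg (kernel_nonneg z), Real.rpow_neg (by positivity), ← Real.inv_rpow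
    (by positivity), ← Real.mul_rpow (by positivity) (by positivity), kernel, one_div,
    ← Real.inv_rpow (by positivity)]
  refine Real.rpow_le_rpow (by positivity) ?_ (by positivity)
  rw [inv_eq_one_div, ← div_eq_mul_inv, div_div, div_le_div_iff₀ (by positivity) (by positivity)]
  nlinarith

lemma integrableOn_kernel_of_lt_norm (hlam : 0 < lam) (hr : 0 < r) :
    IntegrableOn (kernel d lam) {z | r < ‖z‖} :=
  (integrableOn_kernel_of_le_norm hlam hr).mono_set fun _ hz => le_of_lt (mem_ofPred.1 hz)

lemma integrableOn_sq_mul_kernel (hlam : lam < 2) (r : ℝ) :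
    IntegrableOn (fun z => ‖z‖ ^ 2 * kernel d lam z) (Metric.closedBall 0 r) := by
  obtain rfl | hd := Nat.eq_zero_or_pos d
  · simp [Subsingleton.elim _ (0 : Space 0)]
  have : NeZero d := ⟨hd.ne'⟩
  suffices IntegrableOn (fun z : Space d => (fun y : ℝ => y ^ 2 * (1 / y ^ ((d : ℝ) + lam))) ‖z‖)
      (Metric.ball 0 (|r| + 1)) from
    this.mono_set (Metric.closedBall_subset_ball (by linarith [le_abs_self r]))
  refine (integrableOn_fun_norm_addHaar volume
    (f := fun y : ℝ => y ^ 2 * (1 / y ^ ((d : ℝ) + lam)))).2 ?_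
  have hrpow : IntegrableOn (fun y : ℝ => y ^ (1 - lam)) (Ioo 0 (|r| + 1)) := by
    rw [← intervalIntegrable_iff_integrableOn_Ioo_of_le (by positivity)]
    exact intervalIntegral.intervalIntegrable_rpow' (by linarith)
  refine hrpow.congr_fun (fun y hy => ?_) measurableSet_Ioo
  have hy0 : 0 < y := hy.1
  simp only [finrank_euclideanSpace, Fintype.card_fin, smul_eq_mul]
  rw [← Real.rpow_natCast, ← Real.rpow_natCast, one_div, ← Real.rpow_neg hy0.le,
    ← Real.rpow_add hy0, ← Real.rpow_add hy0]
  congr 1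
  push_cast [Nat.cast_sub hd]
  ring

lemma kernel_smul (hs : 0 < s) (z : Space d) :
    kernel d lam (s • z) = s ^ (-((d : ℝ) + lam)) * kernel d lam z := by
  rw [kernel, kernel, norm_smul, Real.norm_of_nonneg hs.le, Real.mul_rpow hs.le (norm_nonneg _),
    Real.rpow_neg hs.le]
  field_simp

open scoped Pointwise in
lemma setIntegral_kernel_lt_norm (hs : 0 < s) :
    ∫ z in {z : Space d | s < ‖z‖}, kernel d lam z
      = s ^ (-lam) * ∫ z in {z : Space d | 1 < ‖z‖}, kernel d lam z := by
  have hset : s • {z : Space d | 1 < ‖z‖} = {z : Space d | s < ‖z‖} := by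
    ext z
    rw [mem_smul_set_iff_inv_smul_mem₀ hs.ne', mem_ofPred_eq, mem_ofPred_eq, norm_smul, norm_inv,
      Real.norm_of_nonneg hs.le, ← div_eq_inv_mul, one_lt_div hs]
  have hscale :=
    Measure.setIntegral_comp_smul_of_pos volume (kernel d lam) {z : Space d | 1 < ‖z‖} hs
  simp_rw [hset, kernel_smul hs, integral_const_mul, finrank_euclideanSpace, Fintype.card_fin,
    smul_eq_mul] at hscale
  have hsd : s ^ d ≠ 0 := by positivity
  calc ∫ z in {z : Space d | s < ‖z‖}, kernel d lam z
      = s ^ d * (s ^ (-((d : ℝ) + lam)) * ∫ z in {z : Space d | 1 < ‖z‖}, kernel d lam z) := by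
        rw [hscale]; field_simp
    _ = s ^ (-lam) * ∫ z in {z : Space d | 1 < ‖z‖}, kernel d lam z := by
        rw [← mul_assoc, ← Real.rpow_natCast, ← Real.rpow_add hs]
        congr 2
        ring

lemma setIntegral_kernel_pos [NeZero d] (hlam : 0 < lam) :
    0 < ∫ z in {z : Space d | 1 < ‖z‖}, kernel d lam z := by
  have hopen : IsOpen {z : Space d | 1 < ‖z‖} := isOpen_lt continuous_const continuous_norm
  have hsub : {z : Space d | 1 < ‖z‖} ⊆ Function.support (kernel d lam) ∩ {z | 1 < ‖z‖} := by
    intro z hz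
    have hz' : 0 < ‖z‖ := one_pos.trans hz
    exact ⟨by rw [Function.mem_support, kernel]; positivity, hz⟩
  rw [setIntegral_pos_iff_support_of_nonneg_ae (ae_of_all _ kernel_nonneg)
    (integrableOn_kernel_of_lt_norm hlam one_pos)]
  exact (hopen.measure_pos volume (NormedSpace.exists_lt_norm ℝ (Space d) 1)).trans_le
    (measure_mono hsub)

end Kernel

/-! ### Rounding to the grid -/

section Grid

variable {d : ℕ} {h : ℝ}

/-- The index of the centred cell `x_β + (h/2) [-1,1)^d` containing `z`. -/
def gridIndex (h : ℝ) (z : Space d) : Fin d → ℤ := fun l => ⌊z l / h + 1 / 2⌋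

/-- The grid point `x_β = h β`. -/
def gridPoint (h : ℝ) (β : Fin d → ℤ) : Space d := WithLp.toLp 2 fun l => h * β l

/-- The centre of the centred cell containing `z`. Rounding the translation vector turns the
quadrature sum of the scheme into an integral against the kernel. -/
def gridRound (h : ℝ) (z : Space d) : Space d := gridPoint h (gridIndex h z)

@[simp]
lemma gridPoint_apply (h : ℝ) (β : Fin d → ℤ) (l : Fin d) : gridPoint h β l = h * β l := rfl

@[simp]
lemma gridRound_apply (h : ℝ) (z : Space d) (l : Fin d) :
    gridRound h z l = h * ⌊z l / h + 1 / 2⌋ := rfl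

lemma mem_centredCell_iff (hh : 0 < h) (z : Space d) (β : Fin d → ℤ) :
    z ∈ centredCell h β ↔ gridIndex h z = β := by
  simp only [centredCell, mem_ofPred_eq, gridIndex, funext_iff, Int.floor_eq_iff]
  refine forall_congr' fun l => ?_
  rw [← sub_le_iff_le_add, le_div_iff₀ hh, ← lt_sub_iff_add_lt, div_lt_iff₀ hh]
  constructor <;> rintro ⟨hlo, hhi⟩ <;> constructor <;> linarith

@[fun_prop]
lemma measurable_gridIndex (h : ℝ) : Measurable (gridIndex h : Space d → Fin d → ℤ) :=
  measurable_pi_lambda _ fun l => Int.measurable_floor.comp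
    (by fun_prop : Measurable fun z : Space d => z l / h + 1 / 2)

@[fun_prop]
lemma measurable_gridRound (h : ℝ) : Measurable (gridRound h : Space d → Space d) :=
  (measurable_of_countable (gridPoint h)).comp (measurable_gridIndex h)

lemma abs_gridRound_sub_le (hh : 0 < h) (z : Space d) (l : Fin d) :
    |gridRound h z l - z l| ≤ h / 2 := by
  have hle := Int.floor_le (z l / h + 1 / 2)
  have hlt := Int.lt_floor_add_one (z l / h + 1 / 2)
  have hcancel : z l / h * h = z l := div_mul_cancel₀ _ hh.ne'
  rw [gridRound_apply, abs_le]
  constructor <;> nlinarith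

lemma gridRound_apply_eq_zero (hh : 0 < h) {z : Space d} {l : Fin d} (hz : |z l| < h / 2) :
    gridRound h z l = 0 := by
  rw [abs_lt] at hz
  have hfloor : ⌊z l / h + 1 / 2⌋ = 0 := by
    rw [Int.floor_eq_zero_iff]
    constructor
    · rw [← sub_le_iff_le_add, le_div_iff₀ hh]; linarith
    · rw [← lt_sub_iff_add_lt, div_lt_iff₀ hh]; linarith
  rw [gridRound_apply, hfloor, Int.cast_zero, mul_zero]

lemma abs_gridRound_apply_le (hh : 0 < h) (z : Space d) (l : Fin d) :
    |gridRound h z l| ≤ 2 * |z l| := by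
  by_cases hz : |z l| < h / 2
  · rw [gridRound_apply_eq_zero hh hz, abs_zero]; positivity
  · linarith [abs_gridRound_sub_le hh z l, abs_sub_abs_le_abs_sub (gridRound h z l) (z l)]

lemma norm_gridRound_le (hh : 0 < h) (z : Space d) : ‖gridRound h z‖ ≤ 2 * ‖z‖ := by
  rw [← Real.norm_of_nonneg (zero_le_two (α := ℝ)), ← norm_smul, EuclideanSpace.norm_eq,
    EuclideanSpace.norm_eq]
  refine Real.sqrt_le_sqrt (Finset.sum_le_sum fun l _ => ?_)
  have hl := abs_gridRound_apply_le hh z l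
  simp only [PiLp.smul_apply, smul_eq_mul, Real.norm_eq_abs, abs_mul, abs_two]
  gcongr

lemma half_le_norm_of_gridRound_ne_zero (hh : 0 < h) {z : Space d} (hz : gridRound h z ≠ 0) :
    h / 2 ≤ ‖z‖ := by
  contrapose! hz
  ext l
  exact gridRound_apply_eq_zero hh ((Real.norm_eq_abs _ ▸ PiLp.norm_apply_le z l).trans_lt hz)

lemma tendsto_gridRound (z : Space d) :
    Tendsto (fun h => gridRound h z) (𝓝[>] 0) (𝓝 z) := by
  rw [(PiLp.homeomorph 2 _).isInducing.tendsto_nhds_iff, tendsto_pi_nhds]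
  intro l
  rw [tendsto_iff_norm_sub_tendsto_zero]
  have hhalf : Tendsto (fun h : ℝ => h / 2) (𝓝[>] 0) (𝓝 0) := by
    simpa using (tendsto_nhdsWithin_of_tendsto_nhds (a := (0 : ℝ)) tendsto_id).div_const (2 : ℝ)
  refine squeeze_zero' (Eventually.of_forall fun _ => norm_nonneg _) ?_ hhalf
  filter_upwards [self_mem_nhdsWithin] with h hh using abs_gridRound_sub_le hh z l

lemma volume_apply_eq_const (l : Fin d) (a : ℝ) : volume {z : Space d | z l = a} = 0 := by
  have hmeas : MeasurableSet {z : Space d | z l = a} :=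
    measurableSet_eq_fun (by fun_prop) (by fun_prop)
  rw [← (EuclideanSpace.volume_preserving_symm_measurableEquiv_toLp (Fin d)).symm.measure_preimage
    hmeas.nullMeasurableSet]
  exact Measure.pi_hyperplane (fun _ => (volume : Measure ℝ)) l a

lemma floor_neg_add_half {a : ℝ} (ha : ∀ n : ℤ, a ≠ n - 1 / 2) :
    ⌊-a + 1 / 2⌋ = -⌊a + 1 / 2⌋ := by
  have hlt : (⌊a + 1 / 2⌋ : ℝ) < a + 1 / 2 :=
    (Int.floor_le _).lt_of_ne fun heq => ha ⌊a + 1 / 2⌋ (by linarith)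
  have hlt' := Int.lt_floor_add_one (a + 1 / 2)
  rw [Int.floor_eq_iff]
  push_cast
  constructor <;> linarith

lemma gridRound_neg_ae (hh : 0 < h) : ∀ᵐ z : Space d, gridRound h (-z) = -gridRound h z := by
  have hfaces : ∀ᵐ z : Space d, ∀ l, ∀ n : ℤ, z l ≠ h * (n - 1 / 2) :=
    ae_all_iff.2 fun l => ae_all_iff.2 fun n =>
      measure_eq_zero_iff_ae_notMem.1 (volume_apply_eq_const l (h * (n - 1 / 2)))
  filter_upwards [hfaces] with z hz
  ext l
  have hfloor := floor_neg_add_half (a := z l / h) fun n hn =>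
    hz l n (by rw [← hn]; field_simp)
  rw [gridRound_apply, PiLp.neg_apply, PiLp.neg_apply, neg_div, hfloor, gridRound_apply]
  push_cast
  ring

end Grid

/-! ### Translations in `L¹` -/

section Translation

variable {ι E F : Type*} [NormedAddCommGroup E] [NormedSpace ℝ E] [FiniteDimensional ℝ E]
  [MeasurableSpace E] [BorelSpace E] {μ : Measure E} [μ.IsAddHaarMeasure] [NormedAddCommGroup F]
  {L : Filter ι} {g : E → F} {y : ι → E} {y₀ : E}

lemma tendsto_lintegral_enorm_translate_sub (hg : Integrable g μ) (hy : Tendsto y L (𝓝 y₀)) :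
    Tendsto (fun m => ∫⁻ x, ‖g (x + y m) - g (x + y₀)‖ₑ ∂μ) L (𝓝 0) := by
  have hg1 : MemLp g 1 μ := memLp_one_iff_integrable.2 hg
  let T : C(E, C(E, E)) :=
    (ContinuousMap.mk (fun a : E × E => a.2 + a.1) (by fun_prop)).curry
  have hT : ∀ y, MeasurePreserving (T y) μ μ := fun y => measurePreserving_add_right μ y
  have htends : Tendsto (fun m => Lp.compMeasurePreserving (T (y m)) (hT _) (hg1.toLp g)) L
      (𝓝 (Lp.compMeasurePreserving (T y₀) (hT _) (hg1.toLp g))) :=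
    tendsto_const_nhds.compMeasurePreservingLp ((T.continuous.tendsto y₀).comp hy) _ _
      ENNReal.one_ne_top
  rw [tendsto_iff_edist_tendsto_0] at htends
  refine htends.congr fun m => ?_
  rw [Lp.toLp_compMeasurePreserving, Lp.toLp_compMeasurePreserving, Lp.edist_toLp_toLp,
    eLpNorm_one_eq_lintegral_enorm]
  rfl

lemma tendsto_lintegral_enorm_translate_sub_of_tendsto {v : ι → E → F}
    (hv : ∀ m, AEStronglyMeasurable (v m) μ) (hg : Integrable g μ)
    (hvg : Tendsto (fun m => ∫⁻ x, ‖v m x - g x‖ₑ ∂μ) L (𝓝 0)) (hy : Tendsto y L (𝓝 y₀)) :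
    Tendsto (fun m => ∫⁻ x, ‖v m (x + y m) - g (x + y₀)‖ₑ ∂μ) L (𝓝 0) := by
  have hsum := hvg.add (tendsto_lintegral_enorm_translate_sub hg hy)
  rw [add_zero] at hsum
  refine tendsto_of_tendsto_of_tendsto_of_le_of_le tendsto_const_nhds hsum (fun _ => zero_le) ?_
  intro m
  have hmeas : AEMeasurable (fun x => ‖v m (x + y m) - g (x + y m)‖ₑ) μ :=
    (((hv m).sub hg.1).comp_quasiMeasurePreserving
      (measurePreserving_add_right μ (y m)).quasiMeasurePreserving).enorm
  calc ∫⁻ x, ‖v m (x + y m) - g (x + y₀)‖ₑ ∂μ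
      ≤ ∫⁻ x, (‖v m (x + y m) - g (x + y m)‖ₑ + ‖g (x + y m) - g (x + y₀)‖ₑ) ∂μ := by
        gcongr with x
        rw [← sub_add_sub_cancel (v m (x + y m)) (g (x + y m))]
        exact enorm_add_le _ _
    _ = ∫⁻ x, ‖v m x - g x‖ₑ ∂μ + ∫⁻ x, ‖g (x + y m) - g (x + y₀)‖ₑ ∂μ := by
        rw [lintegral_add_left' hmeas, lintegral_add_right_eq_self fun x => ‖v m x - g x‖ₑ]

end Translation

/-! ### Second differences -/

section SecondDiff

variable {E : Type*}

/-- The symmetric second difference of `φ` at `p` in the direction `w`. Principal values of even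
kernels are absolutely convergent integrals of second differences. -/
def secondDiff [AddCommGroup E] (φ : E → ℝ) (p w : E) : ℝ :=
  φ (p + w) + φ (p - w) - 2 * φ p

lemma secondDiff_zero [AddCommGroup E] (φ : E → ℝ) (p : E) : secondDiff φ p 0 = 0 := by
  rw [secondDiff, add_zero, sub_zero]; ring

lemma secondDiff_neg [AddCommGroup E] (φ : E → ℝ) (p w : E) :
    secondDiff φ p (-w) = secondDiff φ p w := by
  rw [secondDiff, secondDiff, ← sub_eq_add_neg, sub_neg_eq_add]; ring

lemma secondDiff_eq_zero [NormedAddCommGroup E] {φ : E → ℝ} {p w : E} {R : ℝ} (hw : ‖w‖ ≤ R)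
    (hp : p ∉ Metric.cthickening R (tsupport φ)) : secondDiff φ p w = 0 := by
  have hφ : ∀ q, dist p q ≤ R → φ q = 0 := fun q hq =>
    image_eq_zero_of_notMem_tsupport fun h => hp (Metric.mem_cthickening_of_dist_le p q R _ h hq)
  rw [secondDiff, hφ (p + w) (by simpa using hw), hφ (p - w) (by simpa using hw),
    hφ p (by simpa using (norm_nonneg w).trans hw)]
  ring

variable [NormedAddCommGroup E] [NormedSpace ℝ E]

lemma hasFDerivAt_add_comp_sub {φ : E → ℝ} (hφ : Differentiable ℝ φ) (p x : E) :
    HasFDerivAt (fun y => φ (p + y) + φ (p - y)) (fderiv ℝ φ (p + x) - fderiv ℝ φ (p - x)) x := by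
  have hadd : HasFDerivAt (fun y => φ (p + y)) (fderiv ℝ φ (p + x)) x := by
    simpa using! (hφ (p + x)).hasFDerivAt.comp x ((hasFDerivAt_id x).const_add p)
  have hsub : HasFDerivAt (fun y => φ (p - y)) (-fderiv ℝ φ (p - x)) x := by
    simpa using! (hφ (p - x)).hasFDerivAt.comp x ((hasFDerivAt_id x).const_sub p)
  simpa [sub_eq_add_neg] using! hadd.add hsub

theorem exists_abs_secondDiff_le {φ : E → ℝ} (hφ : ContDiff ℝ 2 φ) (hc : HasCompactSupport φ) :
    ∃ C, 0 ≤ C ∧ ∀ p w, |secondDiff φ p w| ≤ C * ‖w‖ ^ 2 := by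
  obtain ⟨C, hC⟩ := ContDiff.lipschitzWith_of_hasCompactSupport (hc.fderiv ℝ)
    (hφ.fderiv_right (m := 1) (by norm_num)) (by simp)
  refine ⟨2 * C, by positivity, fun p w => ?_⟩
  have hbound : ∀ x ∈ Metric.closedBall (0 : E) ‖w‖,
      ‖fderiv ℝ φ (p + x) - fderiv ℝ φ (p - x)‖ ≤ 2 * C * ‖w‖ := by
    intro x hx
    rw [mem_closedBall_zero_iff] at hx
    calc ‖fderiv ℝ φ (p + x) - fderiv ℝ φ (p - x)‖
        ≤ C * ‖x + x‖ := by
          simpa only [dist_eq_norm, show p + x - (p - x) = x + x by abel]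
            using hC.dist_le_mul (p + x) (p - x)
      _ ≤ C * (‖w‖ + ‖w‖) := by gcongr; exact (norm_add_le x x).trans (by gcongr)
      _ = 2 * C * ‖w‖ := by ring
  have hmvt := (convex_closedBall (0 : E) ‖w‖).norm_image_sub_le_of_norm_hasFDerivWithin_le
    (fun x _ =>
      (hasFDerivAt_add_comp_sub (hφ.differentiable (by simp)) p x).hasFDerivWithinAt) hbound
    (Metric.mem_closedBall_self (norm_nonneg w)) (mem_closedBall_zero_iff.2 le_rfl)
  rw [add_zero, sub_zero, sub_zero, Real.norm_eq_abs] at hmvt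
  rw [secondDiff, two_mul]
  linarith

end SecondDiff

/-! ### The inner operator -/

section InnerOp

/-- Space-time `ℝ^d × ℝ`, on which the approximate solutions and the test functions live. -/
abbrev SpaceTime (d : ℕ) : Type := Space d × ℝ

variable {d : ℕ} {c lam r h : ℝ} {φ : SpaceTime d → ℝ}

lemma norm_mk_zero (z : Space d) : ‖((z, 0) : SpaceTime d)‖ = ‖z‖ := by
  rw [Prod.norm_def, norm_zero, max_eq_left (norm_nonneg z)]

lemma mk_neg_zero (z : Space d) : ((-z, 0) : SpaceTime d) = -(z, 0) := by
  rw [Prod.neg_mk, neg_zero]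

lemma add_mk_zero (p : SpaceTime d) (z : Space d) : p + (z, 0) = (p.1 + z, p.2) := by
  ext <;> simp

lemma sub_mk_zero (p : SpaceTime d) (z : Space d) : p - (z, 0) = (p.1 - z, p.2) := by
  ext <;> simp

/-- The operator `g_r` in terms of second differences; it agrees with `gInner` by
`gInner_eq_innerOp`. -/
def innerOp (c lam r : ℝ) (φ : SpaceTime d → ℝ) (p : SpaceTime d) : ℝ :=
  c / 2 * ∫ z in Metric.closedBall (0 : Space d) r, secondDiff φ p (z, 0) * kernel d lam z

/-- The quadrature approximation of `g_r`. The minus sign is the one that appears when the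
translation is moved from the approximate solution to the test function. -/
def discInner (c lam r h : ℝ) (φ : SpaceTime d → ℝ) (p : SpaceTime d) : ℝ :=
  c * ∫ z in Metric.closedBall (0 : Space d) r,
    kernel d lam z * (φ (p - (gridRound h z, 0)) - φ p)

/-- The kernel with the central cell removed. The central cell does not contribute to the
quadrature, whose sum is over `β ≠ 0`, so the singularity at the origin is never seen. -/
def cutKernel (d : ℕ) (lam h : ℝ) : Space d → ℝ :=
  {z | gridRound h z ≠ 0}.indicator (kernel d lam)

lemma cutKernel_nonneg (z : Space d) : 0 ≤ cutKernel d lam h z :=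
  indicator_nonneg (fun z _ => kernel_nonneg z) z

lemma kernel_mul_eq_cutKernel_mul {g : Space d → ℝ} (hg0 : ∀ z, gridRound h z = 0 → g z = 0)
    (z : Space d) : kernel d lam z * g z = cutKernel d lam h z * g z := by
  by_cases hz : gridRound h z = 0
  · rw [hg0 z hz, mul_zero, mul_zero]
  · rw [cutKernel, indicator_of_mem (s := {z | gridRound h z ≠ 0}) hz]

lemma measurableSet_gridRound_ne_zero (h : ℝ) :
    MeasurableSet {z : Space d | gridRound h z ≠ 0} :=
  (measurableSet_eq_fun (measurable_gridRound h) measurable_const).compl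

lemma integrable_cutKernel (hlam : 0 < lam) (hh : 0 < h) : Integrable (cutKernel d lam h) :=
  (integrable_indicator_iff (measurableSet_gridRound_ne_zero h)).2
    ((integrableOn_kernel_of_le_norm hlam (half_pos hh)).mono_set
      fun _ hz => half_le_norm_of_gridRound_ne_zero hh hz)

lemma integral_cutKernel_le (hlam : 0 < lam) (hh : 0 < h) :
    ∫ z, cutKernel d lam h z
      ≤ (h / 2) ^ (-lam) * ∫ z in {z : Space d | 1 < ‖z‖}, kernel d lam z := by
  have hsphere : ∀ᵐ z : Space d, z ∉ Metric.sphere (0 : Space d) (h / 2) :=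
    measure_eq_zero_iff_ae_notMem.1 (Measure.addHaar_sphere_of_ne_zero _ _ (half_pos hh).ne')
  rw [← setIntegral_kernel_lt_norm (half_pos hh), cutKernel,
    integral_indicator (measurableSet_gridRound_ne_zero h)]
  refine setIntegral_mono_set (integrableOn_kernel_of_lt_norm hlam (half_pos hh))
    (ae_of_all _ kernel_nonneg) ?_
  filter_upwards [hsphere] with z hz hround
  rw [mem_sphere_zero_iff_norm] at hz
  exact lt_of_le_of_ne (half_le_norm_of_gridRound_ne_zero hh hround) (Ne.symm hz)

lemma integrable_kernel_mul {g : Space d → ℝ} {B : ℝ} (hlam : 0 < lam) (hh : 0 < h)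
    (hg : AEStronglyMeasurable g) (hB : ∀ z, |g z| ≤ B) (hg0 : ∀ z, gridRound h z = 0 → g z = 0) :
    Integrable fun z => kernel d lam z * g z := by
  simp_rw [kernel_mul_eq_cutKernel_mul hg0]
  exact (integrable_cutKernel hlam hh).mul_bdd hg (ae_of_all _ hB)

theorem setIntegral_sub_mul_kernel_eq_half_secondDiff {G : Type*} [AddCommGroup G] {ψ : G → ℝ}
    {p : G} {S : Set (Space d)} {ρ : Space d → G} (hS : -S = S) (hρ : ∀ᵐ z, ρ (-z) = -ρ z)
    (hint : IntegrableOn (fun z => (ψ (p + ρ z) - ψ p) * kernel d lam z) S) :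
    ∫ z in S, (ψ (p + ρ z) - ψ p) * kernel d lam z
      = 1 / 2 * ∫ z in S, secondDiff ψ p (ρ z) * kernel d lam z := by
  have hneg := Measure.measurePreserving_neg (volume : Measure (Space d))
  have hemb := (MeasurableEquiv.neg (Space d)).measurableEmbedding
  have hodd : ∀ᵐ z ∂volume.restrict S, (ψ (p + ρ (-z)) - ψ p) * kernel d lam (-z)
      = (ψ (p - ρ z) - ψ p) * kernel d lam z := by
    filter_upwards [ae_restrict_of_ae hρ] with z hz
    rw [hz, kernel_neg, sub_eq_add_neg p]
  have hrefl : ∫ z in S, (ψ (p - ρ z) - ψ p) * kernel d lam z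
      = ∫ z in S, (ψ (p + ρ z) - ψ p) * kernel d lam z := by
    rw [← integral_congr_ae hodd]
    nth_rw 1 [← hS]
    exact hneg.setIntegral_preimage_emb hemb (fun z => (ψ (p + ρ z) - ψ p) * kernel d lam z) S
  have hint' : IntegrableOn (fun z => (ψ (p - ρ z) - ψ p) * kernel d lam z) S := by
    refine IntegrableOn.congr_fun_ae ?_ hodd
    rw [← hS]
    exact (hneg.integrableOn_comp_preimage hemb).2 hint
  have hsplit : ∀ z, secondDiff ψ p (ρ z) * kernel d lam z
      = (ψ (p + ρ z) - ψ p) * kernel d lam z + (ψ (p - ρ z) - ψ p) * kernel d lam z :=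
    fun z => by rw [secondDiff]; ring
  simp_rw [hsplit]
  rw [integral_add hint hint', hrefl]
  ring

lemma discInner_eq_secondDiff (hlam : 0 < lam) (hh : 0 < h) (hφ : Continuous φ)
    (hc : HasCompactSupport φ) (p : SpaceTime d) :
    discInner c lam r h φ p = c / 2 * ∫ z in Metric.closedBall (0 : Space d) r,
      secondDiff φ p (gridRound h z, 0) * kernel d lam z := by
  obtain ⟨B, hB⟩ := hc.exists_bound_of_continuous hφ
  have hφm := hφ.measurable
  have hint : Integrable fun z : Space d =>
      kernel d lam z * (φ (p + -(gridRound h z, 0)) - φ p) :=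
    integrable_kernel_mul (B := B + B) hlam hh (Measurable.aestronglyMeasurable (by fun_prop))
      (fun _ => (abs_sub _ _).trans (add_le_add (hB _) (hB _)))
      fun z hz => by rw [hz, Prod.mk_zero_zero, neg_zero, add_zero, sub_self]
  have hodd : ∀ᵐ z : Space d, -((gridRound h (-z), 0) : SpaceTime d) = - -(gridRound h z, 0) := by
    filter_upwards [gridRound_neg_ae hh] with z hz
    rw [hz, mk_neg_zero]
  have hsymm := setIntegral_sub_mul_kernel_eq_half_secondDiff (ψ := φ) (p := p) (lam := lam)
    (S := Metric.closedBall (0 : Space d) r) (by rw [neg_closedBall, neg_zero]) hodd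
    (by simpa only [mul_comm] using hint.integrableOn)
  simp_rw [secondDiff_neg, ← sub_eq_add_neg, mul_comm _ (kernel d lam _)] at hsymm
  simp_rw [discInner, hsymm, mul_comm _ (kernel d lam _)]
  ring

lemma tendsto_setIntegral_annulus {G : Space d → ℝ} (hr : 0 < r) (hG0 : G 0 = 0)
    (hG : IntegrableOn G (Metric.closedBall 0 r)) :
    Tendsto (fun b => ∫ z in {z : Space d | b < ‖z‖ ∧ ‖z‖ < r}, G z) (𝓝[>] 0)
      (𝓝 (∫ z in Metric.closedBall 0 r, G z)) := by
  set B := Metric.closedBall (0 : Space d) r \ {0}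
  have hB : MeasurableSet B :=
    Metric.isClosed_closedBall.measurableSet.diff (measurableSet_singleton 0)
  have hannulus : ∀ b, MeasurableSet {z : Space d | b < ‖z‖ ∧ ‖z‖ < r} := fun b =>
    (measurableSet_lt_norm b).inter (measurableSet_lt measurable_norm measurable_const)
  have hsphere : ∀ᵐ z : Space d, z ∉ Metric.sphere (0 : Space d) r :=
    measure_eq_zero_iff_ae_notMem.1 (Measure.addHaar_sphere_of_ne_zero _ _ hr.ne')
  have hcover : AECover (volume.restrict B) (𝓝[>] (0 : ℝ))
      fun b => {z : Space d | b < ‖z‖ ∧ ‖z‖ < r} := by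
    refine ⟨?_, hannulus⟩
    filter_upwards [ae_restrict_of_ae hsphere, ae_restrict_mem hB] with z hz hzB
    rw [mem_sphere_zero_iff_norm] at hz
    filter_upwards [Ioo_mem_nhdsGT (norm_pos_iff.2 hzB.2)] with b hb
    exact ⟨hb.2, lt_of_le_of_ne (mem_closedBall_zero_iff.1 hzB.1) hz⟩
  have hlim := hcover.integral_tendsto_of_countably_generated (hG.mono_set sdiff_subset)
  rw [setIntegral_eq_of_subset_of_forall_sdiff_eq_zero Metric.isClosed_closedBall.measurableSet
    (sdiff_subset : B ⊆ _) fun z hz => by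
      obtain rfl : z = 0 := by by_contra h0; exact hz.2 ⟨hz.1, h0⟩
      exact hG0]
  refine hlim.congr' ?_
  filter_upwards [self_mem_nhdsWithin] with b (hb : 0 < b)
  rw [Measure.restrict_restrict (hannulus b), inter_eq_left.2]
  exact fun z hz => ⟨mem_closedBall_zero_iff.2 hz.2.le, norm_pos_iff.1 (hb.trans hz.1)⟩

lemma integrableOn_secondDiff_mul_kernel (hlam2 : lam < 2) (hφ : ContDiff ℝ 2 φ)
    (hc : HasCompactSupport φ) (p : SpaceTime d) :
    IntegrableOn (fun z => secondDiff φ p (z, 0) * kernel d lam z) (Metric.closedBall 0 r) := by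
  obtain ⟨C, -, hC⟩ := exists_abs_secondDiff_le hφ hc
  have hφm := hφ.continuous.measurable
  refine ((integrableOn_sq_mul_kernel hlam2 r).const_mul C).mono'
    (Measurable.aestronglyMeasurable (by unfold secondDiff; fun_prop)) (ae_of_all _ fun z => ?_)
  rw [norm_mul_kernel, ← mul_assoc, ← norm_mk_zero]
  exact mul_le_mul_of_nonneg_right (hC p _) (kernel_nonneg z)

theorem gInner_eq_innerOp (hlam : 0 < lam) (hlam2 : lam < 2) (hr : 0 < r) (hφ : ContDiff ℝ 2 φ)
    (hc : HasCompactSupport φ) (p : SpaceTime d) :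
    gInner c lam r (fun y => φ (y, p.2)) p.1 = innerOp c lam r φ p := by
  obtain ⟨B, hB⟩ := hc.exists_bound_of_continuous hφ.continuous
  have hannulus : ∀ b > 0, 1 / 2 * ∫ z in {z : Space d | b < ‖z‖ ∧ ‖z‖ < r},
        secondDiff φ p (z, 0) * kernel d lam z
      = ∫ z in {z : Space d | b < ‖z‖ ∧ ‖z‖ < r},
        (φ (p.1 + z, p.2) - φ (p.1, p.2)) * kernel d lam z := by
    intro b hb
    simp_rw [← add_mk_zero]
    refine (setIntegral_sub_mul_kernel_eq_half_secondDiff (by ext z; simp)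
      (ae_of_all _ mk_neg_zero) ?_).symm
    refine (((integrableOn_kernel_of_lt_norm hlam hb).mono_set fun z hz => hz.1).const_mul
      (B + B)).mono' (by fun_prop) (ae_of_all _ fun z => ?_)
    rw [norm_mul_kernel]
    exact mul_le_mul_of_nonneg_right ((abs_sub _ _).trans (add_le_add (hB _) (hB p)))
      (kernel_nonneg z)
  have hlim := (tendsto_setIntegral_annulus hr
    (by rw [Prod.mk_zero_zero, secondDiff_zero, zero_mul])
    (integrableOn_secondDiff_mul_kernel hlam2 hφ hc p)).const_mul (1 / 2)
  have hpv := hlim.congr' (by filter_upwards [self_mem_nhdsWithin] with b hb using hannulus b hb)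
  rw [gInner, hpv.limUnder_eq, innerOp]
  ring

lemma abs_secondDiff_gridRound_mul_kernel_le {C : ℝ} (hC0 : 0 ≤ C)
    (hC : ∀ p w, |secondDiff φ p w| ≤ C * ‖w‖ ^ 2) (hh : 0 < h) (p : SpaceTime d) (z : Space d) :
    ‖secondDiff φ p (gridRound h z, 0) * kernel d lam z‖
      ≤ 4 * C * (‖z‖ ^ 2 * kernel d lam z) := by
  rw [norm_mul_kernel, ← mul_assoc]
  refine mul_le_mul_of_nonneg_right ?_ (kernel_nonneg z)
  calc |secondDiff φ p (gridRound h z, 0)|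
      ≤ C * ‖gridRound h z‖ ^ 2 := by rw [← norm_mk_zero]; exact hC p _
    _ ≤ C * (2 * ‖z‖) ^ 2 := by gcongr; exact norm_gridRound_le hh z
    _ = 4 * C * ‖z‖ ^ 2 := by ring

theorem tendsto_discInner (hlam : 0 < lam) (hlam2 : lam < 2) (hφ : ContDiff ℝ 2 φ)
    (hc : HasCompactSupport φ) (p : SpaceTime d) :
    Tendsto (fun h => discInner c lam r h φ p) (𝓝[>] 0) (𝓝 (innerOp c lam r φ p)) := by
  obtain ⟨C, hC0, hC⟩ := exists_abs_secondDiff_le hφ hc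
  have hφm := hφ.continuous.measurable
  have hlim : Tendsto (fun h => ∫ z in Metric.closedBall (0 : Space d) r,
      secondDiff φ p (gridRound h z, 0) * kernel d lam z) (𝓝[>] 0)
      (𝓝 (∫ z in Metric.closedBall (0 : Space d) r, secondDiff φ p (z, 0) * kernel d lam z)) := by
    refine tendsto_integral_filter_of_dominated_convergence
      (fun z => 4 * C * (‖z‖ ^ 2 * kernel d lam z)) (Eventually.of_forall fun h => ?_) ?_
      ((integrableOn_sq_mul_kernel hlam2 r).const_mul _) (ae_of_all _ fun z => ?_)
    · exact Measurable.aestronglyMeasurable (by unfold secondDiff; fun_prop)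
    · filter_upwards [self_mem_nhdsWithin] with h hh
      exact ae_of_all _ (abs_secondDiff_gridRound_mul_kernel_le hC0 hC hh p)
    · have hcont : Continuous fun w : Space d => secondDiff φ p (w, 0) := by
        have := hφ.continuous
        unfold secondDiff
        fun_prop
      exact ((hcont.tendsto z).comp (tendsto_gridRound z)).mul_const _
  refine (hlim.const_mul (c / 2)).congr' ?_
  filter_upwards [self_mem_nhdsWithin] with h hh
  exact (discInner_eq_secondDiff hlam hh hφ.continuous hc p).symm

lemma exists_abs_discInner_le (c : ℝ) (r : ℝ) (hlam : 0 < lam) (hlam2 : lam < 2)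
    (hφ : ContDiff ℝ 2 φ) (hc : HasCompactSupport φ) :
    ∃ C, ∀ h, 0 < h → ∀ p, |discInner c lam r h φ p| ≤
      (Metric.cthickening (2 * r) (tsupport φ)).indicator (fun _ => C) p := by
  obtain ⟨C, hC0, hC⟩ := exists_abs_secondDiff_le hφ hc
  have hint := (integrableOn_sq_mul_kernel (d := d) hlam2 r).const_mul (4 * C)
  refine ⟨|c / 2| * ∫ z in Metric.closedBall 0 r, 4 * C * (‖z‖ ^ 2 * kernel d lam z),
    fun h hh p => ?_⟩
  rw [discInner_eq_secondDiff hlam hh hφ.continuous hc]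
  by_cases hp : p ∈ Metric.cthickening (2 * r) (tsupport φ)
  · rw [indicator_of_mem hp, abs_mul, ← Real.norm_eq_abs (integral _ _)]
    exact mul_le_mul_of_nonneg_left (norm_integral_le_of_norm_le hint (ae_of_all _
      (abs_secondDiff_gridRound_mul_kernel_le hC0 hC hh p))) (abs_nonneg _)
  · rw [indicator_of_notMem hp, setIntegral_eq_zero_of_forall_eq_zero, mul_zero, abs_zero]
    intro z hz
    have hround : ‖((gridRound h z, 0) : SpaceTime d)‖ ≤ 2 * r := by
      rw [norm_mk_zero]
      linarith [norm_gridRound_le hh z, mem_closedBall_zero_iff.1 hz]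
    rw [secondDiff_eq_zero hround hp, zero_mul]

lemma exists_abs_innerOp_le (c : ℝ) (r : ℝ) (hlam : 0 < lam) (hlam2 : lam < 2)
    (hφ : ContDiff ℝ 2 φ) (hc : HasCompactSupport φ) :
    ∃ C, ∀ p, |innerOp c lam r φ p| ≤
      (Metric.cthickening (2 * r) (tsupport φ)).indicator (fun _ => C) p := by
  obtain ⟨C, hC⟩ := exists_abs_discInner_le c r hlam hlam2 hφ hc
  refine ⟨C, fun p => le_of_tendsto (tendsto_discInner hlam hlam2 hφ hc p).abs ?_⟩
  filter_upwards [self_mem_nhdsWithin] with h hh using hC h hh p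

lemma measurable_innerOp (hφ : Continuous φ) : Measurable (innerOp c lam r φ) := by
  have hφm := hφ.measurable
  have hint : StronglyMeasurable fun q : SpaceTime d × Space d =>
      secondDiff φ q.1 (q.2, 0) * kernel d lam q.2 :=
    Measurable.stronglyMeasurable (by unfold secondDiff; fun_prop)
  exact hint.integral_prod_right.measurable.const_mul _

lemma measurable_discInner (hφ : Continuous φ) : Measurable (discInner c lam r h φ) := by
  have hφm := hφ.measurable
  have hint : StronglyMeasurable fun q : SpaceTime d × Space d =>
      kernel d lam q.2 * (φ (q.1 - (gridRound h q.2, 0)) - φ q.1) :=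
    Measurable.stronglyMeasurable (by fun_prop)
  exact hint.integral_prod_right.measurable.const_mul _

end InnerOp

/-! ### The cell entropy inequality -/

section CellEntropy

/-- The numerical entropy flux `F(a ∨ k, b ∨ k) - F(a ∧ k, b ∧ k)` of Crandall and Majda, which is
consistent with the Kruzkov entropy flux. -/
def numEntropyFlux (F : ℝ → ℝ → ℝ) (k a b : ℝ) : ℝ :=
  F (max a k) (max b k) - F (min a k) (min b k)

variable {d : ℕ} {c lam h τ M : ℝ} {S : Set (Space d)} {f : ℝ → Space d} {A : ℝ → ℝ}
  {F : Fin d → ℝ → ℝ → ℝ} {LF LA : ℝ≥0} {w w₁ w₂ : Space d → ℝ}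

/-- The discrete divergence `∑ₗ Dₗ⁻ Fₗ` of the numerical flux of the grid values of `w`. -/
def fluxDiff (F : Fin d → ℝ → ℝ → ℝ) (h : ℝ) (w : Space d → ℝ) (x : Space d) : ℝ :=
  ∑ l, (F l (w x) (w (x + EuclideanSpace.single l h))
    - F l (w (x - EuclideanSpace.single l h)) (w x)) / h

/-- The part over `S` of the quadrature of the nonlocal operator. -/
def quadOn (c lam h : ℝ) (S : Set (Space d)) (g : Space d → ℝ) (x : Space d) : ℝ :=
  c * ∫ z in S, kernel d lam z * (g (x + gridRound h z) - g x)

/-- One time step of the scheme at the point `x`, with the quadrature restricted to `S`. -/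
def schemeStep (c lam : ℝ) (A : ℝ → ℝ) (F : Fin d → ℝ → ℝ → ℝ) (h τ : ℝ) (S : Set (Space d))
    (w : Space d → ℝ) (x : Space d) : ℝ :=
  w x - τ * fluxDiff F h w x + τ * quadOn c lam h S (fun y => A (w y)) x

lemma integrable_kernel_mul_sub {g : Space d → ℝ} (hlam : 0 < lam) (hh : 0 < h)
    (hg : Measurable g) (hM : ∀ x, |g x| ≤ M) (x : Space d) :
    Integrable fun z => kernel d lam z * (g (x + gridRound h z) - g x) :=
  integrable_kernel_mul (B := M + M) hlam hh (Measurable.aestronglyMeasurable (by fun_prop))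
    (fun _ => (abs_sub _ _).trans (add_le_add (hM _) (hM _)))
    fun z hz => by rw [hz, add_zero, sub_self]

lemma abs_le_of_lipschitzWith (hA : LipschitzWith LA A) {a : ℝ} (ha : |a| ≤ M) :
    |A a| ≤ |A 0| + LA * M := by
  have hdist := hA.norm_sub_le a 0
  rw [sub_zero, Real.norm_eq_abs, Real.norm_eq_abs] at hdist
  have hmono := mul_le_mul_of_nonneg_left ha LA.coe_nonneg
  linarith [abs_sub_abs_le_abs_sub (A a) (A 0)]

lemma integrable_kernel_mul_comp_sub (hlam : 0 < lam) (hh : 0 < h) (hA : LipschitzWith LA A)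
    (hw : Measurable w) (hM : ∀ x, |w x| ≤ M) (x : Space d) :
    Integrable fun z => kernel d lam z * (A (w (x + gridRound h z)) - A (w x)) :=
  integrable_kernel_mul_sub hlam hh (hA.continuous.measurable.comp hw)
    (fun y => abs_le_of_lipschitzWith hA (hM y)) x

/-- The left-hand side is the total weight that a grid value gives away in one time step. -/
lemma CFL.mass_le (hc : 0 ≤ c) (hlam : 0 < lam) (hh : 0 < h) (hτ : 0 ≤ τ)
    (hcfl : CFL d c lam LF LA h τ) (S : Set (Space d)) :
    2 * d * LF * (τ / h) + τ * (c * (LA * ∫ z in S, cutKernel d lam h z)) ≤ 1 := by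
  have hmass := (setIntegral_le_integral (s := S) (integrable_cutKernel hlam hh)
    (ae_of_all _ cutKernel_nonneg)).trans (integral_cutKernel_le hlam hh)
  have hscale : (h / 2) ^ (-lam) = 2 ^ lam / h ^ lam := by
    rw [Real.rpow_neg (by positivity), Real.div_rpow hh.le (by norm_num), inv_div]
  have hquad := mul_le_mul_of_nonneg_left hmass (by positivity : 0 ≤ τ * (c * LA))
  rw [hscale] at hquad
  refine le_trans (le_of_eq_of_le ?_ (add_le_add_right hquad (2 * d * LF * (τ / h))))
    (le_of_eq_of_le ?_ hcfl) <;> ring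

lemma IsNumericalFlux.sub_le {f : ℝ → ℝ} {F : ℝ → ℝ → ℝ} (hF : IsNumericalFlux LF f F)
    {a b c a' b' c' : ℝ} (ha : a ≤ a') (hb : b ≤ b') (hc : c ≤ c') :
    (F b' c' - F a' b') - (F b c - F a b) ≤ 2 * LF * (b' - b) := by
  have hsnd : F b' c' ≤ F b' c := hF.antitone_snd b' hc
  have hfst : F a b' ≤ F a' b' := hF.monotone_fst b' ha
  have hlip_fst := (abs_le.1 (hF.lipschitz b' c b c)).2
  have hlip_snd := (abs_le.1 (hF.lipschitz a b a b')).2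
  rw [sub_self, abs_zero, add_zero, abs_of_nonneg (by linarith)] at hlip_fst
  rw [sub_self, abs_zero, zero_add, abs_of_nonpos (by linarith)] at hlip_snd
  linarith

lemma fluxDiff_sub_le (hF : ∀ l, IsNumericalFlux LF (fun v => f v l) (F l)) (hh : 0 ≤ h)
    (hle : ∀ x, w₁ x ≤ w₂ x) (x : Space d) :
    fluxDiff F h w₂ x - fluxDiff F h w₁ x ≤ 2 * d * LF * (w₂ x - w₁ x) / h := by
  rw [fluxDiff, fluxDiff, ← Finset.sum_sub_distrib]
  calc _ ≤ ∑ _ : Fin d, 2 * LF * (w₂ x - w₁ x) / h := Finset.sum_le_sum fun l _ => by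
        rw [← sub_div]
        exact div_le_div_of_nonneg_right ((hF l).sub_le (hle _) (hle _) (hle _)) hh
    _ = 2 * d * LF * (w₂ x - w₁ x) / h := by
        rw [Finset.sum_const, Finset.card_univ, Fintype.card_fin, nsmul_eq_mul]
        ring

lemma quadOn_sub_le (hc : 0 ≤ c) (hlam : 0 < lam) (hh : 0 < h) (hA : LipschitzWith LA A)
    (hAmono : Monotone A) (hw₁ : Measurable w₁) (hw₂ : Measurable w₂) (hM₁ : ∀ x, |w₁ x| ≤ M)
    (hM₂ : ∀ x, |w₂ x| ≤ M) (hle : ∀ x, w₁ x ≤ w₂ x) (x : Space d) :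
    quadOn c lam h S (fun y => A (w₁ y)) x - quadOn c lam h S (fun y => A (w₂ y)) x
      ≤ c * (LA * ∫ z in S, cutKernel d lam h z) * (w₂ x - w₁ x) := by
  have hint₁ := (integrable_kernel_mul_comp_sub hlam hh hA hw₁ hM₁ x).integrableOn (s := S)
  have hint₂ := (integrable_kernel_mul_comp_sub hlam hh hA hw₂ hM₂ x).integrableOn (s := S)
  have hcut := ((integrable_cutKernel (d := d) hlam hh).const_mul
    (LA * (w₂ x - w₁ x))).integrableOn (s := S)
  have hAx : A (w₂ x) - A (w₁ x) ≤ LA * (w₂ x - w₁ x) := by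
    have hdist := hA.norm_sub_le (w₂ x) (w₁ x)
    rw [Real.norm_eq_abs, Real.norm_of_nonneg (sub_nonneg.2 (hle x))] at hdist
    exact (le_abs_self _).trans hdist
  have hpoint : ∀ z, kernel d lam z * (A (w₁ (x + gridRound h z)) - A (w₁ x))
      - kernel d lam z * (A (w₂ (x + gridRound h z)) - A (w₂ x))
      ≤ LA * (w₂ x - w₁ x) * cutKernel d lam h z := by
    intro z
    rw [← mul_sub, mul_comm _ (cutKernel d lam h z), kernel_mul_eq_cutKernel_mul
      (g := fun z =>
        A (w₁ (x + gridRound h z)) - A (w₁ x) - (A (w₂ (x + gridRound h z)) - A (w₂ x)))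
      fun z hz => by rw [hz, add_zero, sub_self, sub_self, sub_self]]
    refine mul_le_mul_of_nonneg_left ?_ (cutKernel_nonneg z)
    linarith [hAmono (hle (x + gridRound h z))]
  calc _ = c * ∫ z in S, (kernel d lam z * (A (w₁ (x + gridRound h z)) - A (w₁ x))
        - kernel d lam z * (A (w₂ (x + gridRound h z)) - A (w₂ x))) := by
        rw [quadOn, quadOn, ← mul_sub, ← integral_sub hint₁ hint₂]
    _ ≤ c * ∫ z in S, LA * (w₂ x - w₁ x) * cutKernel d lam h z :=
        mul_le_mul_of_nonneg_left (integral_mono (hint₁.sub hint₂) hcut hpoint) hc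
    _ = c * (LA * ∫ z in S, cutKernel d lam h z) * (w₂ x - w₁ x) := by
        rw [integral_const_mul]; ring

theorem schemeStep_mono (hc : 0 ≤ c) (hlam : 0 < lam) (hA : LipschitzWith LA A)
    (hAmono : Monotone A) (hF : ∀ l, IsNumericalFlux LF (fun v => f v l) (F l)) (hh : 0 < h)
    (hτ : 0 ≤ τ) (hcfl : CFL d c lam LF LA h τ) (hw₁ : Measurable w₁) (hw₂ : Measurable w₂)
    (hM₁ : ∀ x, |w₁ x| ≤ M) (hM₂ : ∀ x, |w₂ x| ≤ M) (hle : ∀ x, w₁ x ≤ w₂ x) (x : Space d) :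
    schemeStep c lam A F h τ S w₁ x ≤ schemeStep c lam A F h τ S w₂ x := by
  have hflux := mul_le_mul_of_nonneg_left (fluxDiff_sub_le hF hh.le hle x) hτ
  have hquad := mul_le_mul_of_nonneg_left
    (quadOn_sub_le (S := S) hc hlam hh hA hAmono hw₁ hw₂ hM₁ hM₂ hle x) hτ
  have hmass := mul_le_mul_of_nonneg_right (hcfl.mass_le hc hlam hh hτ S) (sub_nonneg.2 (hle x))
  have hrw : τ * (2 * d * LF * (w₂ x - w₁ x) / h) = 2 * d * LF * (τ / h) * (w₂ x - w₁ x) := by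
    ring
  rw [hrw] at hflux
  rw [schemeStep, schemeStep]
  linarith

lemma schemeStep_const (k : ℝ) (x : Space d) : schemeStep c lam A F h τ S (fun _ => k) x = k := by
  simp [schemeStep, fluxDiff, quadOn]

lemma abs_comp_sub_eq_max_sub_min (hA : Monotone A) (a k : ℝ) :
    |A a - A k| = A (max a k) - A (min a k) := by
  rw [hA.map_max, hA.map_min, max_sub_min_eq_abs, abs_sub_comm]

lemma schemeStep_max_sub_schemeStep_min (hlam : 0 < lam) (hA : LipschitzWith LA A)
    (hAmono : Monotone A) (hh : 0 < h) (hw : Measurable w) (hM : ∀ x, |w x| ≤ M) (k : ℝ)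
    (x : Space d) :
    schemeStep c lam A F h τ S (fun y => max (w y) k) x
        - schemeStep c lam A F h τ S (fun y => min (w y) k) x
      = |w x - k| - τ * fluxDiff (fun l => numEntropyFlux (F l) k) h w x
        + τ * quadOn c lam h S (fun y => |A (w y) - A k|) x := by
  have habs : |w x - k| = max (w x) k - min (w x) k := by
    rw [max_sub_min_eq_abs, abs_sub_comm]
  have hflux : fluxDiff (fun l => numEntropyFlux (F l) k) h w x
      = fluxDiff F h (fun y => max (w y) k) x - fluxDiff F h (fun y => min (w y) k) x := by
    simp only [fluxDiff, numEntropyFlux, ← Finset.sum_sub_distrib]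
    exact Finset.sum_congr rfl fun l _ => by ring
  have hmax := integrable_kernel_mul_comp_sub hlam hh hA (w := fun y => max (w y) k) (by fun_prop)
    (fun y => abs_max_le_max_abs_abs.trans (max_le_max_right |k| (hM y))) x
  have hmin := integrable_kernel_mul_comp_sub hlam hh hA (w := fun y => min (w y) k) (by fun_prop)
    (fun y => abs_min_le_max_abs_abs.trans (max_le_max_right |k| (hM y))) x
  have hquad : quadOn c lam h S (fun y => |A (w y) - A k|) x
      = quadOn c lam h S (fun y => A (max (w y) k)) x
        - quadOn c lam h S (fun y => A (min (w y) k)) x := by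
    simp only [quadOn]
    rw [← mul_sub, ← integral_sub hmax.integrableOn hmin.integrableOn]
    simp_rw [abs_comp_sub_eq_max_sub_min hAmono]
    congr! 3
    ring
  rw [habs, hflux, hquad, schemeStep, schemeStep]
  ring

lemma abs_schemeStep_sub_le (hc : 0 ≤ c) (hlam : 0 < lam) (hA : LipschitzWith LA A)
    (hAmono : Monotone A) (hF : ∀ l, IsNumericalFlux LF (fun v => f v l) (F l)) (hh : 0 < h)
    (hτ : 0 ≤ τ) (hcfl : CFL d c lam LF LA h τ) (hw : Measurable w) (hM : ∀ x, |w x| ≤ M) (k : ℝ)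
    (x : Space d) :
    |schemeStep c lam A F h τ S w x - k|
      ≤ |w x - k| - τ * fluxDiff (fun l => numEntropyFlux (F l) k) h w x
        + τ * quadOn c lam h S (fun y => |A (w y) - A k|) x := by
  have hmono : ∀ {w₁ w₂ : Space d → ℝ}, Measurable w₁ → Measurable w₂ →
      (∀ y, |w₁ y| ≤ max M |k|) → (∀ y, |w₂ y| ≤ max M |k|) → (∀ y, w₁ y ≤ w₂ y) →
      schemeStep c lam A F h τ S w₁ x ≤ schemeStep c lam A F h τ S w₂ x :=
    fun h₁ h₂ hM₁ hM₂ hle => schemeStep_mono hc hlam hA hAmono hF hh hτ hcfl h₁ h₂ hM₁ hM₂ hle x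
  have hMw : ∀ y, |w y| ≤ max M |k| := fun y => (hM y).trans (le_max_left _ _)
  have hMk : ∀ _ : Space d, |k| ≤ max M |k| := fun _ => le_max_right _ _
  have hMmax : ∀ y, |max (w y) k| ≤ max M |k| := fun y =>
    abs_max_le_max_abs_abs.trans (max_le_max_right |k| (hM y))
  have hMmin : ∀ y, |min (w y) k| ≤ max M |k| := fun y =>
    abs_min_le_max_abs_abs.trans (max_le_max_right |k| (hM y))
  have hw_le := hmono hw (by fun_prop) hMw hMmax fun y => le_max_left _ _
  have hk_le := hmono measurable_const (by fun_prop) hMk hMmax fun y => le_max_right (w y) _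
  have hle_w := hmono (by fun_prop) hw hMmin hMw fun y => min_le_left _ _
  have hle_k := hmono (by fun_prop) measurable_const hMmin hMk fun y => min_le_right (w y) _
  rw [schemeStep_const] at hk_le hle_k
  rw [← schemeStep_max_sub_schemeStep_min hlam hA hAmono hh hw hM, abs_le]
  constructor <;> linarith

lemma quadOn_univ_eq_add {g : Space d → ℝ} (hlam : 0 < lam) (hh : 0 < h) (hg : Measurable g)
    (hM : ∀ x, |g x| ≤ M) (r : ℝ) (x : Space d) :
    quadOn c lam h univ g x
      = quadOn c lam h (Metric.closedBall 0 r) g x + quadOn c lam h {z | r < ‖z‖} g x := by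
  rw [quadOn, quadOn, quadOn, setIntegral_univ, ← mul_add, ← compl_closedBall_zero,
    integral_add_compl Metric.isClosed_closedBall.measurableSet
      (integrable_kernel_mul_sub hlam hh hg hM x)]

lemma sign_mul_self (a : ℝ) : Real.sign a * a = |a| := by
  rcases lt_trichotomy a 0 with ha | rfl | ha
  · rw [Real.sign_of_neg ha, abs_of_neg ha, neg_one_mul]
  · rw [mul_zero, abs_zero]
  · rw [Real.sign_of_pos ha, abs_of_pos ha, one_mul]

lemma abs_sign_le_one (a : ℝ) : |Real.sign a| ≤ 1 := by
  rcases Real.sign_apply_eq a with h | h | h <;> rw [h] <;> simp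

lemma sign_mul_le_abs (a b : ℝ) : Real.sign a * b ≤ |b| :=
  calc Real.sign a * b ≤ |Real.sign a| * |b| := by rw [← abs_mul]; exact le_abs_self _
    _ ≤ |b| := mul_le_of_le_one_left (abs_nonneg b) (abs_sign_le_one a)

/-- Only the quadrature near the origin goes through the comparison with `w ∨ k` and `w ∧ k`; the
far part keeps the sign of the new value, as in the entropy inequality split at radius `r`. -/
theorem cell_entropy_inequality (hc : 0 ≤ c) (hlam : 0 < lam) (hA : LipschitzWith LA A)
    (hAmono : Monotone A) (hF : ∀ l, IsNumericalFlux LF (fun v => f v l) (F l)) (hh : 0 < h)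
    (hτ : 0 ≤ τ) (hcfl : CFL d c lam LF LA h τ) (hw : Measurable w) (hM : ∀ x, |w x| ≤ M)
    (k r : ℝ) {x : Space d} {w' : ℝ} (hw' : w' = schemeStep c lam A F h τ univ w x) :
    |w' - k| ≤ |w x - k| - τ * fluxDiff (fun l => numEntropyFlux (F l) k) h w x
      + τ * quadOn c lam h (Metric.closedBall 0 r) (fun y => |A (w y) - A k|) x
      + τ * (Real.sign (w' - k) * quadOn c lam h {z | r < ‖z‖} (fun y => A (w y)) x) := by
  set near := schemeStep c lam A F h τ (Metric.closedBall 0 r) w x with hnear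
  set far := quadOn c lam h {z | r < ‖z‖} (fun y => A (w y)) x
  have hsplit : w' - k = (near - k) + τ * far := by
    rw [hw', schemeStep, quadOn_univ_eq_add (g := fun y => A (w y)) hlam hh
      (hA.continuous.measurable.comp hw) (fun y => abs_le_of_lipschitzWith hA (hM y)) r, hnear,
      schemeStep]
    ring
  calc |w' - k| = Real.sign (w' - k) * (near - k) + τ * (Real.sign (w' - k) * far) := by
        rw [← sign_mul_self, hsplit]; ring
    _ ≤ |near - k| + τ * (Real.sign (w' - k) * far) := by gcongr; exact sign_mul_le_abs _ _
    _ ≤ _ := by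
        gcongr
        exact abs_schemeStep_sub_le hc hlam hA hAmono hF hh hτ hcfl hw hM k x

end CellEntropy

/-! ### Summation by parts -/

section SummationByParts

/-- Bounded measurable functions. Multiplication by such a function preserves integrability. -/
def BddMeasurable {E : Type*} [MeasurableSpace E] (g : E → ℝ) : Prop :=
  Measurable g ∧ ∃ B, ∀ p, |g p| ≤ B

variable {E Z : Type*} [MeasurableSpace E] [MeasurableSpace Z] {μ : Measure E} {ν : Measure Z}
  {g g₁ g₂ ψ : E → ℝ} {κ : Z → ℝ} {ρ : Z → E}

lemma BddMeasurable.comp (hg : BddMeasurable g) {a : Z → E} (ha : Measurable a) :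
    BddMeasurable fun z => g (a z) :=
  ⟨hg.1.comp ha, hg.2.imp fun _ hB z => hB (a z)⟩

lemma BddMeasurable.mul (h₁ : BddMeasurable g₁) (h₂ : BddMeasurable g₂) :
    BddMeasurable fun p => g₁ p * g₂ p := by
  obtain ⟨hm₁, B₁, hB₁⟩ := h₁
  obtain ⟨hm₂, B₂, hB₂⟩ := h₂
  refine ⟨hm₁.mul hm₂, B₁ * B₂, fun p => ?_⟩
  rw [abs_mul]
  exact mul_le_mul (hB₁ p) (hB₂ p) (abs_nonneg _) ((abs_nonneg _).trans (hB₁ p))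

lemma BddMeasurable.sub (h₁ : BddMeasurable g₁) (h₂ : BddMeasurable g₂) :
    BddMeasurable fun p => g₁ p - g₂ p := by
  obtain ⟨hm₁, B₁, hB₁⟩ := h₁
  obtain ⟨hm₂, B₂, hB₂⟩ := h₂
  exact ⟨hm₁.sub hm₂, B₁ + B₂, fun p => (abs_sub _ _).trans (add_le_add (hB₁ p) (hB₂ p))⟩

lemma BddMeasurable.integrable_mul (hg : BddMeasurable g) (hψ : Integrable ψ μ) :
    Integrable (fun p => g p * ψ p) μ := by
  obtain ⟨hm, B, hB⟩ := hg
  exact hψ.bdd_mul hm.aestronglyMeasurable (ae_of_all _ hB)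

variable [AddGroup E] [MeasurableAdd₂ E]

lemma BddMeasurable.integrable_diffQuot_mul (hg : BddMeasurable g) (hψ : Integrable ψ μ) (w : E)
    (s : ℝ) : Integrable (fun p => ψ p * ((g p - g (p + w)) / s)) μ := by
  refine (((hg.sub (hg.comp (measurable_add_const w))).integrable_mul hψ).div_const s).congr
    (ae_of_all _ fun p => ?_)
  ring

variable [μ.IsAddRightInvariant]

lemma integral_mul_translate_sub (hg : BddMeasurable g) (hψ : Integrable ψ μ) (w : E) :
    ∫ p, g p * (ψ (p - w) - ψ p) ∂μ = ∫ p, (g (p + w) - g p) * ψ p ∂μ := by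
  have hshift : ∫ p, g p * ψ (p - w) ∂μ = ∫ p, g (p + w) * ψ p ∂μ := by
    rw [← integral_add_right_eq_self (fun p => g p * ψ (p - w)) w]
    simp only [add_sub_cancel_right]
  simp_rw [mul_sub, sub_mul]
  rw [integral_sub (hg.integrable_mul (hψ.comp_sub_right w)) (hg.integrable_mul hψ),
    integral_sub ((hg.comp (measurable_add_const w)).integrable_mul hψ) (hg.integrable_mul hψ),
    hshift]

lemma integral_mul_diffQuot (hg : BddMeasurable g) (hψ : Integrable ψ μ) (w : E) (s : ℝ) :
    ∫ p, g p * ((ψ p - ψ (p - w)) / s) ∂μ = ∫ p, ψ p * ((g p - g (p + w)) / s) ∂μ := by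
  calc _ = ∫ p, (-1 / s) * (g p * (ψ (p - w) - ψ p)) ∂μ := by congr! 2; ring
    _ = ∫ p, (-1 / s) * ((g (p + w) - g p) * ψ p) ∂μ := by
        rw [integral_const_mul, integral_const_mul, integral_mul_translate_sub hg hψ]
    _ = _ := by congr! 2; ring

lemma BddMeasurable.integrable_mul_diffQuot (hg : BddMeasurable g) (hψ : Integrable ψ μ) (w : E)
    (s : ℝ) : Integrable (fun p => g p * ((ψ p - ψ (p - w)) / s)) μ :=
  hg.integrable_mul ((hψ.sub (hψ.comp_sub_right w)).div_const s)

variable [MeasurableNeg E] [SFinite μ] [SFinite ν]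

lemma integrable_prod_mul_translate_sub (hκ : Integrable κ ν) (hρ : Measurable ρ)
    (hψ : Measurable ψ) (hψi : Integrable ψ μ) :
    Integrable (fun q : E × Z => κ q.2 * (ψ (q.1 - ρ q.2) - ψ q.1)) (μ.prod ν) := by
  have htranslate : Integrable (fun q : E × Z => κ q.2 * ψ (q.1 - ρ q.2)) (μ.prod ν) := by
    have hmeas : AEStronglyMeasurable (fun q : E × Z => κ q.2 * ψ (q.1 - ρ q.2)) (μ.prod ν) :=
      hκ.aestronglyMeasurable.comp_snd.mul (Measurable.aestronglyMeasurable (by fun_prop))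
    refine (integrable_prod_iff' hmeas).2
      ⟨ae_of_all _ fun z => (hψi.comp_sub_right (ρ z)).const_mul (κ z), ?_⟩
    simp_rw [norm_mul, integral_const_mul, integral_sub_right_eq_self fun p => ‖ψ p‖]
    exact hκ.norm.mul_const _
  simp_rw [mul_sub]
  exact htranslate.sub (by simpa only [mul_comm] using hψi.mul_prod hκ)

theorem integral_mul_integral_translate_sub (hκ : Integrable κ ν) (hρ : Measurable ρ)
    (hg : BddMeasurable g) (hψ : Measurable ψ) (hψi : Integrable ψ μ) :
    ∫ p, ψ p * ∫ z, κ z * (g (p + ρ z) - g p) ∂ν ∂μ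
      = ∫ p, g p * ∫ z, κ z * (ψ (p - ρ z) - ψ p) ∂ν ∂μ := by
  have hleft : Integrable (fun q : E × Z => (g (q.1 + ρ q.2) - g q.1) * (ψ q.1 * κ q.2))
      (μ.prod ν) :=
    ((hg.comp (by fun_prop)).sub (hg.comp measurable_fst)).integrable_mul (hψi.mul_prod hκ)
  have hright := (hg.comp measurable_fst).integrable_mul
    (integrable_prod_mul_translate_sub hκ hρ hψ hψi)
  calc _ = ∫ p, ∫ z, (g (p + ρ z) - g p) * (ψ p * κ z) ∂ν ∂μ := by
        simp_rw [← integral_const_mul]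
        congr! 4
        ring
    _ = ∫ z, κ z * ∫ p, (g (p + ρ z) - g p) * ψ p ∂μ ∂ν := by
        rw [integral_integral_swap hleft]
        simp_rw [← integral_const_mul]
        congr! 4
        ring
    _ = ∫ z, ∫ p, g p * (κ z * (ψ (p - ρ z) - ψ p)) ∂μ ∂ν := by
        simp_rw [← integral_mul_translate_sub hg hψi, ← integral_const_mul]
        congr! 4
        ring
    _ = _ := by
        rw [← integral_integral_swap hright]
        simp_rw [integral_const_mul]

end SummationByParts

/-! ### The integrated discrete entropy inequality -/

section DiscreteInequality

variable {d : ℕ} {c lam h τ T M k r : ℝ} {S : Set (Space d)} {f : ℝ → Space d} {A : ℝ → ℝ}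
  {F : Fin d → ℝ → ℝ → ℝ} {LF LA : ℝ≥0} {v a φ : SpaceTime d → ℝ}

instance isAddHaarMeasure_spaceTime : (volume : Measure (SpaceTime d)).IsAddHaarMeasure :=
  Measure.prod.instIsAddHaarMeasure _ _

/-- Bounded functions on space-time that satisfy the scheme pointwise up to the time `T`, the
quadrature being written as an integral. -/
structure IsSchemeFun (c lam : ℝ) (A : ℝ → ℝ) (F : Fin d → ℝ → ℝ → ℝ) (h τ T M : ℝ)
    (v : SpaceTime d → ℝ) : Prop where
  measurable : Measurable v
  bound : ∀ p, |v p| ≤ M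
  step : ∀ x t, 0 ≤ t → t + τ < T →
    v (x, t + τ) = schemeStep c lam A F h τ univ (fun y => v (y, t)) x

/-- The integrand of the discrete entropy inequality, with all differences but those of the outer
quadrature on the test function. -/
def discIntegrand (c lam : ℝ) (A : ℝ → ℝ) (F : Fin d → ℝ → ℝ → ℝ) (h τ k r : ℝ)
    (v φ : SpaceTime d → ℝ) (p : SpaceTime d) : ℝ :=
  |v p - k| * ((φ p - φ (p - (0, τ))) / τ)
    + ∑ l, numEntropyFlux (F l) k (v p) (v (p + (EuclideanSpace.single l h, 0)))
        * ((φ (p + (EuclideanSpace.single l h, 0)) - φ p) / h)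
    + |A (v p) - A k| * discInner c lam r h φ p
    + Real.sign (v (p + (0, τ)) - k)
        * quadOn c lam h {z | r < ‖z‖} (fun y => A (v (y, p.2))) p.1 * φ p

/-- The rate of entropy production of one time step, which the cell entropy inequality shows to be
nonnegative. -/
def entropyProduction (c lam : ℝ) (A : ℝ → ℝ) (F : Fin d → ℝ → ℝ → ℝ) (h τ k r : ℝ)
    (v : SpaceTime d → ℝ) (p : SpaceTime d) : ℝ :=
  (|v p - k| - |v (p + (0, τ)) - k|) / τ
    - fluxDiff (fun l => numEntropyFlux (F l) k) h (fun y => v (y, p.2)) p.1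
    + quadOn c lam h (Metric.closedBall 0 r) (fun y => |A (v (y, p.2)) - A k|) p.1
    + Real.sign (v (p + (0, τ)) - k) * quadOn c lam h {z | r < ‖z‖} (fun y => A (v (y, p.2))) p.1

lemma quadOn_eq_integral_cutKernel (a : SpaceTime d → ℝ) (p : SpaceTime d) :
    quadOn c lam h S (fun y => a (y, p.2)) p.1
      = c * ∫ z in S, cutKernel d lam h z * (a (p + (gridRound h z, 0)) - a p) := by
  simp_rw [add_mk_zero]
  rw [quadOn]
  congr! 3 with z
  exact kernel_mul_eq_cutKernel_mul
    (g := fun z => a (p.1 + gridRound h z, p.2) - a (p.1, p.2))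
    (fun z hz => by rw [hz, add_zero, sub_self]) z

lemma discInner_eq_integral_cutKernel (φ : SpaceTime d → ℝ) (p : SpaceTime d) :
    discInner c lam r h φ p = c * ∫ z in Metric.closedBall (0 : Space d) r,
      cutKernel d lam h z * (φ (p - (gridRound h z, 0)) - φ p) := by
  rw [discInner]
  congr! 3 with z
  exact kernel_mul_eq_cutKernel_mul (g := fun z => φ (p - (gridRound h z, 0)) - φ p)
    (fun z hz => by rw [hz, Prod.mk_zero_zero, sub_zero, sub_self]) z

lemma integral_mul_quadOn (hlam : 0 < lam) (hh : 0 < h) (ha : BddMeasurable a)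
    (hφ : Measurable φ) (hφi : Integrable φ) :
    ∫ p, φ p * quadOn c lam h (Metric.closedBall 0 r) (fun y => a (y, p.2)) p.1
      = ∫ p, a p * discInner c lam r h φ p := by
  simp_rw [quadOn_eq_integral_cutKernel, discInner_eq_integral_cutKernel, mul_left_comm _ c]
  rw [integral_const_mul, integral_const_mul, integral_mul_integral_translate_sub
    (integrable_cutKernel hlam hh).integrableOn (by fun_prop) ha hφ hφi]

lemma integrable_discInner (hlam : 0 < lam) (hh : 0 < h) (hφ : Measurable φ)
    (hφi : Integrable φ) : Integrable (discInner c lam r h φ) := by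
  have hprod := integrable_prod_mul_translate_sub (E := SpaceTime d)
    (ν := volume.restrict (Metric.closedBall (0 : Space d) r))
    (integrable_cutKernel hlam hh).integrableOn
    (by fun_prop : Measurable fun z => (gridRound h z, (0 : ℝ))) hφ hφi
  exact (hprod.integral_prod_left.const_mul c).congr
    (ae_of_all _ fun p => (discInner_eq_integral_cutKernel φ p).symm)

lemma measurable_quadOn (ha : Measurable a) :
    Measurable fun p : SpaceTime d => quadOn c lam h S (fun y => a (y, p.2)) p.1 := by
  have hint : StronglyMeasurable fun q : SpaceTime d × Space d =>
      kernel d lam q.2 * (a (q.1.1 + gridRound h q.2, q.1.2) - a (q.1.1, q.1.2)) :=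
    Measurable.stronglyMeasurable (by fun_prop)
  exact (hint.integral_prod_right (ν := volume.restrict S)).measurable.const_mul _

lemma abs_mul_integral_le {E : Type*} [MeasurableSpace E] {μ : Measure E} {κ g : E → ℝ} {B : ℝ}
    (hκ : Integrable κ μ) (hκ0 : ∀ z, 0 ≤ κ z) (hg : ∀ z, |g z| ≤ B) (c : ℝ) :
    |c * ∫ z, κ z * g z ∂μ| ≤ |c| * ∫ z, κ z * B ∂μ := by
  have hpoint : ∀ z, ‖κ z * g z‖ ≤ κ z * B := fun z => by
    rw [norm_mul, Real.norm_of_nonneg (hκ0 z)]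
    exact mul_le_mul_of_nonneg_left (hg z) (hκ0 z)
  rw [abs_mul]
  exact mul_le_mul_of_nonneg_left
    (norm_integral_le_of_norm_le (hκ.mul_const B) (ae_of_all _ hpoint)) (abs_nonneg c)

lemma bddMeasurable_quadOn (hlam : 0 < lam) (hh : 0 < h) (ha : BddMeasurable a) :
    BddMeasurable fun p : SpaceTime d => quadOn c lam h S (fun y => a (y, p.2)) p.1 := by
  obtain ⟨hm, B, hB⟩ := ha
  refine ⟨measurable_quadOn hm, |c| * ∫ z in S, cutKernel d lam h z * (B + B), fun p => ?_⟩
  beta_reduce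
  rw [quadOn_eq_integral_cutKernel]
  exact abs_mul_integral_le (integrable_cutKernel hlam hh).integrableOn cutKernel_nonneg
    (fun z => (abs_sub _ _).trans (add_le_add (hB _) (hB _))) c

@[fun_prop]
lemma measurable_sign : Measurable Real.sign := by
  unfold Real.sign
  exact Measurable.ite measurableSet_Iio measurable_const
    (Measurable.ite measurableSet_Ioi measurable_const measurable_const)

lemma IsNumericalFlux.continuous {f : ℝ → ℝ} {F : ℝ → ℝ → ℝ} (hF : IsNumericalFlux LF f F) :
    Continuous fun q : ℝ × ℝ => F q.1 q.2 := by
  refine (LipschitzWith.of_dist_le_mul (K := LF * 2) fun q q' => ?_).continuous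
  rw [Real.dist_eq, Prod.dist_eq, Real.dist_eq, Real.dist_eq, NNReal.coe_mul, mul_assoc]
  refine (hF.lipschitz _ _ _ _).trans (mul_le_mul_of_nonneg_left ?_ LF.coe_nonneg)
  rw [NNReal.coe_ofNat, two_mul]
  exact add_le_add (le_max_left _ _) (le_max_right _ _)

lemma IsNumericalFlux.sign_mul_sub_eq {f : ℝ → ℝ} {F : ℝ → ℝ → ℝ} (hF : IsNumericalFlux LF f F)
    (k u : ℝ) : Real.sign (u - k) * (f u - f k) = numEntropyFlux F k u u := by
  rw [numEntropyFlux, hF.consistent, hF.consistent]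
  rcases lt_trichotomy u k with h | rfl | h
  · rw [max_eq_right h.le, min_eq_left h.le, Real.sign_of_neg (sub_neg.2 h)]; ring
  · rw [sub_self, sub_self, mul_zero, max_self, min_self, sub_self]
  · rw [max_eq_left h.le, min_eq_right h.le, Real.sign_of_pos (sub_pos.2 h)]; ring

lemma IsNumericalFlux.abs_numEntropyFlux_sub_le {f : ℝ → ℝ} {F : ℝ → ℝ → ℝ}
    (hF : IsNumericalFlux LF f F) (k a b u : ℝ) :
    |numEntropyFlux F k a b - Real.sign (u - k) * (f u - f k)| ≤ 2 * LF * (|a - u| + |b - u|) := by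
  have hmax : ∀ a, |max a k - max u k| ≤ |a - u| := fun a => abs_max_sub_max_le_abs _ _ _
  have hmin : ∀ a, |min a k - min u k| ≤ |a - u| := fun a => by
    simpa using abs_min_sub_min_le_max a k u k
  rw [hF.sign_mul_sub_eq]
  calc |numEntropyFlux F k a b - numEntropyFlux F k u u|
      = |(F (max a k) (max b k) - F (max u k) (max u k))
          - (F (min a k) (min b k) - F (min u k) (min u k))| := by
        rw [numEntropyFlux, numEntropyFlux, sub_sub_sub_comm]
    _ ≤ LF * (|max a k - max u k| + |max b k - max u k|)
          + LF * (|min a k - min u k| + |min b k - min u k|) :=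
        (abs_sub _ _).trans (add_le_add (hF.lipschitz _ _ _ _) (hF.lipschitz _ _ _ _))
    _ ≤ LF * (|a - u| + |b - u|) + LF * (|a - u| + |b - u|) :=
        add_le_add (mul_le_mul_of_nonneg_left (add_le_add (hmax a) (hmax b)) LF.coe_nonneg)
          (mul_le_mul_of_nonneg_left (add_le_add (hmin a) (hmin b)) LF.coe_nonneg)
    _ = 2 * LF * (|a - u| + |b - u|) := by ring

lemma IsNumericalFlux.abs_numEntropyFlux_le {f : ℝ → ℝ} {F : ℝ → ℝ → ℝ}
    (hF : IsNumericalFlux LF f F) (k : ℝ) {a b : ℝ} (ha : |a| ≤ M) (hb : |b| ≤ M) :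
    |numEntropyFlux F k a b| ≤ 2 * LF * (2 * (M + |k|)) := by
  have hconst := hF.abs_numEntropyFlux_sub_le k a b k
  rw [sub_self (f k), mul_zero, sub_zero] at hconst
  refine hconst.trans (mul_le_mul_of_nonneg_left ?_ (by positivity))
  linarith [abs_sub a k, abs_sub b k]

lemma IsNumericalFlux.measurable_numEntropyFlux {E : Type*} [MeasurableSpace E] {f : ℝ → ℝ}
    {F : ℝ → ℝ → ℝ} (hF : IsNumericalFlux LF f F) (k : ℝ) {a b : E → ℝ} (ha : Measurable a)
    (hb : Measurable b) : Measurable fun p => numEntropyFlux F k (a p) (b p) :=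
  (hF.continuous.measurable.comp ((ha.max measurable_const).prodMk (hb.max measurable_const))).sub
    (hF.continuous.measurable.comp ((ha.min measurable_const).prodMk (hb.min measurable_const)))

namespace IsSchemeFun

variable (hv : IsSchemeFun c lam A F h τ T M v)

include hv

lemma abs_sub_le (k : ℝ) (p : SpaceTime d) : |(|v p - k|)| ≤ M + |k| := by
  rw [abs_abs]
  exact (abs_sub _ _).trans (add_le_add_left (hv.bound p) _)

lemma abs_comp_sub_le (hA : LipschitzWith LA A) (k : ℝ) (p : SpaceTime d) :
    |(|A (v p) - A k|)| ≤ |A 0| + LA * M + |A k| := by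
  rw [abs_abs]
  exact (abs_sub _ _).trans (add_le_add_left (abs_le_of_lipschitzWith hA (hv.bound p)) _)

lemma bddMeasurable_abs_sub (k : ℝ) : BddMeasurable fun p => |v p - k| :=
  ⟨(hv.measurable.sub_const k).abs, _, hv.abs_sub_le k⟩

lemma bddMeasurable_comp (hA : LipschitzWith LA A) : BddMeasurable fun p => A (v p) :=
  ⟨hA.continuous.measurable.comp hv.measurable, _,
    fun p => abs_le_of_lipschitzWith hA (hv.bound p)⟩

lemma bddMeasurable_abs_comp_sub (hA : LipschitzWith LA A) (k : ℝ) :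
    BddMeasurable fun p => |A (v p) - A k| :=
  ⟨((hA.continuous.measurable.comp hv.measurable).sub_const _).abs, _, hv.abs_comp_sub_le hA k⟩

lemma bddMeasurable_sign (k : ℝ) (w : SpaceTime d) :
    BddMeasurable fun p => Real.sign (v (p + w) - k) := by
  have hm := hv.measurable
  exact ⟨by fun_prop, 1, fun p => abs_sign_le_one _⟩

lemma bddMeasurable_numEntropyFlux {f : ℝ → ℝ} {F₁ : ℝ → ℝ → ℝ} (hF : IsNumericalFlux LF f F₁)
    (k : ℝ) (w : SpaceTime d) : BddMeasurable fun p => numEntropyFlux F₁ k (v p) (v (p + w)) :=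
  ⟨hF.measurable_numEntropyFlux k hv.measurable (hv.measurable.comp (measurable_add_const w)), _,
    fun _ => hF.abs_numEntropyFlux_le k (hv.bound _) (hv.bound _)⟩

end IsSchemeFun

lemma fluxDiff_eq (F : Fin d → ℝ → ℝ → ℝ) (p : SpaceTime d) :
    fluxDiff F h (fun y => v (y, p.2)) p.1
      = ∑ l, (F l (v p) (v (p + (EuclideanSpace.single l h, 0)))
          - F l (v (p - (EuclideanSpace.single l h, 0))) (v p)) / h := by
  simp only [fluxDiff, add_mk_zero, sub_mk_zero]

lemma integral_add_four {E : Type*} [MeasurableSpace E] {μ : Measure E} {g₁ g₂ g₃ g₄ : E → ℝ}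
    (h₁ : Integrable g₁ μ) (h₂ : Integrable g₂ μ) (h₃ : Integrable g₃ μ) (h₄ : Integrable g₄ μ) :
    ∫ p, (g₁ p + g₂ p + g₃ p + g₄ p) ∂μ
      = ∫ p, g₁ p ∂μ + ∫ p, g₂ p ∂μ + ∫ p, g₃ p ∂μ + ∫ p, g₄ p ∂μ := by
  rw [← integral_add h₁ h₂]
  exact (integral_add ((h₁.add h₂).add h₃) h₄).trans
    (congrArg (· + ∫ p, g₄ p ∂μ) (integral_add (h₁.add h₂) h₃))

lemma mul_entropyProduction_eq (p : SpaceTime d) :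
    φ p * entropyProduction c lam A F h τ k r v p
      = φ p * ((|v p - k| - |v (p + (0, τ)) - k|) / τ)
        + ∑ l, φ p * ((numEntropyFlux (F l) k (v p) (v (p + (EuclideanSpace.single l h, 0)))
          - numEntropyFlux (F l) k (v (p + -(EuclideanSpace.single l h, 0)))
            (v (p + -(EuclideanSpace.single l h, 0) + (EuclideanSpace.single l h, 0)))) / -h)
        + φ p * quadOn c lam h (Metric.closedBall 0 r) (fun y => |A (v (y, p.2)) - A k|) p.1
        + Real.sign (v (p + (0, τ)) - k)
          * quadOn c lam h {z | r < ‖z‖} (fun y => A (v (y, p.2))) p.1 * φ p := by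
  simp_rw [entropyProduction, fluxDiff_eq, neg_add_cancel_right, ← sub_eq_add_neg, div_neg,
    mul_neg, Finset.sum_neg_distrib, ← Finset.mul_sum]
  ring

theorem integral_discIntegrand_eq (hlam : 0 < lam) (hA : LipschitzWith LA A)
    (hF : ∀ l, IsNumericalFlux LF (fun v => f v l) (F l)) (hh : 0 < h)
    (hv : IsSchemeFun c lam A F h τ T M v) (hφ : Measurable φ) (hφi : Integrable φ) :
    ∫ p, discIntegrand c lam A F h τ k r v φ p
      = ∫ p, φ p * entropyProduction c lam A F h τ k r v p := by
  have hη := hv.bddMeasurable_abs_sub k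
  have hq := fun l => hv.bddMeasurable_numEntropyFlux (hF l) k (EuclideanSpace.single l h, 0)
  have hAk := hv.bddMeasurable_abs_comp_sub hA k
  have hinner := (bddMeasurable_quadOn (c := c) (S := Metric.closedBall 0 r) hlam hh hAk)
  have houter := ((hv.bddMeasurable_sign k (0, τ)).mul (bddMeasurable_quadOn (c := c)
    (S := {z | r < ‖z‖}) hlam hh (hv.bddMeasurable_comp hA))).integrable_mul hφi
  have hfwd : ∀ (w : SpaceTime d) p,
      (φ (p + w) - φ p) / h = (φ p - φ (p - -w)) / -h := fun w p => by
    rw [sub_neg_eq_add, div_neg, ← neg_div, neg_sub]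
  simp_rw [mul_entropyProduction_eq, discIntegrand, hfwd]
  rw [integral_add_four (hη.integrable_mul_diffQuot hφi _ _)
      (integrable_finsetSum _ fun l _ => (hq l).integrable_mul_diffQuot hφi _ _)
      (hAk.integrable_mul (integrable_discInner hlam hh hφ hφi)) houter,
    integral_add_four (hη.integrable_diffQuot_mul hφi _ _)
      (integrable_finsetSum _ fun l _ => (hq l).integrable_diffQuot_mul hφi _ _)
      (by simpa only [mul_comm] using hinner.integrable_mul hφi) houter,
    integral_finsetSum _ fun l _ => (hq l).integrable_mul_diffQuot hφi _ _,
    integral_finsetSum _ fun l _ => (hq l).integrable_diffQuot_mul hφi _ _,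
    integral_mul_diffQuot hη hφi, integral_mul_quadOn hlam hh hAk hφ hφi]
  simp_rw [fun l => integral_mul_diffQuot (hq l) hφi]

lemma entropyProduction_nonneg (hc : 0 ≤ c) (hlam : 0 < lam) (hA : LipschitzWith LA A)
    (hAmono : Monotone A) (hF : ∀ l, IsNumericalFlux LF (fun v => f v l) (F l)) (hh : 0 < h)
    (hτ : 0 < τ) (hcfl : CFL d c lam LF LA h τ) (hv : IsSchemeFun c lam A F h τ T M v) (k r : ℝ)
    {p : SpaceTime d} (hp : 0 ≤ p.2) (hpT : p.2 + τ < T) :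
    0 ≤ entropyProduction c lam A F h τ k r v p := by
  have hcell := cell_entropy_inequality hc hlam hA hAmono hF hh hτ.le hcfl
    (w := fun y => v (y, p.2)) (hv.measurable.comp measurable_prodMk_right)
    (fun y => hv.bound _) k r
    (hv.step p.1 p.2 hp hpT)
  have hpτ : p + (0, τ) = (p.1, p.2 + τ) := by ext <;> simp
  refine nonneg_of_mul_nonneg_right ?_ hτ
  rw [entropyProduction, hpτ, mul_add, mul_add, mul_sub, mul_div_cancel₀ _ hτ.ne']
  linarith

theorem integral_discIntegrand_nonneg (hc : 0 ≤ c) (hlam : 0 < lam) (hA : LipschitzWith LA A)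
    (hAmono : Monotone A) (hF : ∀ l, IsNumericalFlux LF (fun v => f v l) (F l)) (hh : 0 < h)
    (hτ : 0 < τ) (hcfl : CFL d c lam LF LA h τ) (hv : IsSchemeFun c lam A F h τ T M v)
    (hφ : Measurable φ) (hφi : Integrable φ) (hφ0 : ∀ p, 0 ≤ φ p)
    (hφT : ∀ p, φ p ≠ 0 → 0 ≤ p.2 ∧ p.2 + τ < T) (k r : ℝ) :
    0 ≤ ∫ p, discIntegrand c lam A F h τ k r v φ p := by
  rw [integral_discIntegrand_eq hlam hA hF hh hv hφ hφi]
  refine integral_nonneg fun p => ?_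
  rcases eq_or_ne (φ p) 0 with hp | hp
  · simp only [hp, zero_mul, Pi.zero_apply, le_refl]
  · exact mul_nonneg (hφ0 p) (entropyProduction_nonneg hc hlam hA hAmono hF hh hτ hcfl hv k r
      (hφT p hp).1 (hφT p hp).2)

end DiscreteInequality

/-! ### Convergence of the approximations, their shifts and the outer quadrature -/

section Convergence

lemma tendsto_lintegral_prod_of_slices {X Y : Type*} [MeasurableSpace X] [MeasurableSpace Y]
    {μ : Measure X} {ν : Measure Y} [IsFiniteMeasure μ] [IsFiniteMeasure ν]
    {g : ℕ → X × Y → ℝ} {C : ℝ} (hg : ∀ m, Measurable (g m)) (hC : ∀ m p, |g m p| ≤ C)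
    (hlim : ∀ᵐ t ∂ν, Tendsto (fun m => ∫⁻ x, ‖g m (x, t)‖ₑ ∂μ) atTop (𝓝 0)) :
    Tendsto (fun m => ∫⁻ p, ‖g m p‖ₑ ∂(μ.prod ν)) atTop (𝓝 0) := by
  simp_rw [fun m => lintegral_prod_symm' (μ := μ) (ν := ν) _ (hg m).enorm]
  rw [← lintegral_zero (μ := ν)]
  refine tendsto_lintegral_of_dominated_convergence (fun _ => ENNReal.ofReal C * μ univ)
    (fun m => (hg m).enorm.lintegral_prod_left') (fun m => ae_of_all _ fun t => ?_) ?_ hlim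
  · rw [← lintegral_const]
    exact lintegral_mono fun x => (Real.enorm_eq_ofReal_abs _).trans_le
      (ENNReal.ofReal_le_ofReal (hC m _))
  · rw [lintegral_const]
    finiteness

lemma exists_subseq_forall_tendsto_ae {X ι : Type*} [MeasurableSpace X] [Finite ι]
    {μ : Measure X} {g : ℕ → ι → X → ℝ} (hg : ∀ m i, Measurable (g m i))
    (hlim : ∀ i, Tendsto (fun m => ∫⁻ p, ‖g m i p‖ₑ ∂μ) atTop (𝓝 0)) :
    ∃ ns : ℕ → ℕ, StrictMono ns ∧
      ∀ᵐ p ∂μ, ∀ i, Tendsto (fun n => g (ns n) i p) atTop (𝓝 0) := by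
  classical
  have := Fintype.ofFinite ι
  have henorm : ∀ y : ι → ℝ, ‖y‖ₑ ≤ ∑ i, ‖y i‖ₑ := fun y => by
    calc ‖y‖ₑ = ‖∑ i, Pi.single i (y i)‖ₑ := by rw [Finset.univ_sum_single]
      _ ≤ ∑ i, ‖(Pi.single i (y i) : ι → ℝ)‖ₑ := enorm_sum_le _ _
      _ = ∑ i, ‖y i‖ₑ := by simp_rw [Pi.enorm_single]
  have hsum := tendsto_finsetSum Finset.univ fun i _ => hlim i
  rw [Finset.sum_const_zero] at hsum
  have hnorm : Tendsto (fun m => eLpNorm ((fun p i => g m i p) - fun _ => 0) 1 μ) atTop (𝓝 0) := by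
    refine tendsto_of_tendsto_of_tendsto_of_le_of_le tendsto_const_nhds hsum (fun _ => zero_le)
      fun m => ?_
    rw [eLpNorm_one_eq_lintegral_enorm, ← lintegral_finsetSum _ fun i _ => (hg m i).enorm]
    refine lintegral_mono fun p => (henorm _).trans_eq ?_
    simp only [Pi.sub_apply, Pi.zero_apply, sub_zero]
  obtain ⟨ns, hns, hae⟩ := (tendstoInMeasure_of_tendsto_eLpNorm one_ne_zero
    (fun m => (measurable_pi_lambda _ fun i => hg m i).aestronglyMeasurable)
    aestronglyMeasurable_const hnorm).exists_seq_tendsto_ae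
  refine ⟨ns, hns, hae.mono fun p hp i => ?_⟩
  exact tendsto_pi_nhds.1 hp i

lemma enorm_comp_sub_le {A : ℝ → ℝ} {LA : ℝ≥0} (hA : LipschitzWith LA A) (a b : ℝ) :
    ‖A a - A b‖ₑ ≤ LA * ‖a - b‖ₑ := by
  simpa only [edist_eq_enorm_sub] using hA a b

variable {d : ℕ} {c lam r T M : ℝ} {h τ : ℕ → ℝ} {A : ℝ → ℝ} {LA : ℝ≥0}

section OuterQuadrature

variable {v : ℕ → Space d → ℝ} {g g₁ g₂ u : Space d → ℝ}

lemma integrableOn_kernel_mul (hlam : 0 < lam) (hr : 0 < r) (hg : Measurable g)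
    (hM : ∀ z, |g z| ≤ M) : IntegrableOn (fun z => kernel d lam z * g z) {z | r < ‖z‖} := by
  simp_rw [mul_comm (kernel d lam _)]
  exact (integrableOn_kernel_of_lt_norm hlam hr).integrable.bdd_mul hg.aestronglyMeasurable
    (ae_of_all _ hM)

lemma quadOn_sub_gOuter_eq {h : ℝ} (hlam : 0 < lam) (hr : 0 < r) (hg₁ : Measurable g₁)
    (hg₂ : Measurable g₂) (hM₁ : ∀ x, |g₁ x| ≤ M) (hM₂ : ∀ x, |g₂ x| ≤ M) (x : Space d) :
    quadOn c lam h {z | r < ‖z‖} g₁ x - gOuter c lam r g₂ x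
      = c * ∫ z in {z | r < ‖z‖}, kernel d lam z
          * ((g₁ (x + gridRound h z) - g₂ (x + z)) - (g₁ x - g₂ x)) := by
  have hint₁ := integrableOn_kernel_mul (g := fun z => g₁ (x + gridRound h z) - g₁ x) hlam hr
    (by fun_prop) fun z => (abs_sub _ _).trans (add_le_add (hM₁ _) (hM₁ _))
  have hint₂ := integrableOn_kernel_mul (g := fun z => g₂ (x + z) - g₂ x) hlam hr
    (by fun_prop) fun z => (abs_sub _ _).trans (add_le_add (hM₂ _) (hM₂ _))
  simp_rw [quadOn, gOuter, mul_comm _ (kernel d lam _)]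
  rw [← mul_sub, ← integral_sub hint₁ hint₂]
  congr! 3
  ring

lemma lintegral_enorm_quadOn_sub_gOuter_le {h : ℝ} (hlam : 0 < lam) (hr : 0 < r)
    (hg₁ : Measurable g₁) (hg₂ : Measurable g₂) (hM₁ : ∀ x, |g₁ x| ≤ M) (hM₂ : ∀ x, |g₂ x| ≤ M) :
    ∫⁻ x, ‖quadOn c lam h {z | r < ‖z‖} g₁ x - gOuter c lam r g₂ x‖ₑ
      ≤ ‖c‖ₑ * ∫⁻ z in {z | r < ‖z‖}, ‖kernel d lam z‖ₑ
          * ((∫⁻ x, ‖g₁ (x + gridRound h z) - g₂ (x + z)‖ₑ) + ∫⁻ x, ‖g₁ x - g₂ x‖ₑ) := by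
  simp_rw [quadOn_sub_gOuter_eq hlam hr hg₁ hg₂ hM₁ hM₂, enorm_mul]
  rw [lintegral_const_mul' _ _ enorm_ne_top]
  refine mul_le_mul_right ?_ _
  calc _ ≤ ∫⁻ x, ∫⁻ z in {z | r < ‖z‖}, ‖kernel d lam z‖ₑ
          * (‖g₁ (x + gridRound h z) - g₂ (x + z)‖ₑ + ‖g₁ x - g₂ x‖ₑ) := by
        refine lintegral_mono fun x => (enorm_integral_le_lintegral_enorm _).trans ?_
        simp_rw [enorm_mul]
        exact lintegral_mono fun z => mul_le_mul_right (enorm_sub_le) _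
    _ = ∫⁻ z in {z | r < ‖z‖}, ∫⁻ x, ‖kernel d lam z‖ₑ
          * (‖g₁ (x + gridRound h z) - g₂ (x + z)‖ₑ + ‖g₁ x - g₂ x‖ₑ) :=
        lintegral_lintegral_swap (Measurable.aemeasurable (by fun_prop))
    _ = _ := by
        simp_rw [lintegral_const_mul' _ _ enorm_ne_top]
        refine lintegral_congr fun z => congrArg _ (lintegral_add_left ?_ _)
        fun_prop

lemma lintegral_enorm_translate_sub_translate_le (hg₁ : Measurable g₁) (hg₂ : Measurable g₂)
    (y z : Space d) :
    ∫⁻ x, ‖g₁ (x + y) - g₂ (x + z)‖ₑ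
      ≤ (∫⁻ x, ‖g₁ x - g₂ x‖ₑ) + ((∫⁻ x, ‖g₂ x‖ₑ) + ∫⁻ x, ‖g₂ x‖ₑ) :=
  calc _ ≤ ∫⁻ x, (‖g₁ (x + y) - g₂ (x + y)‖ₑ + (‖g₂ (x + y)‖ₑ + ‖g₂ (x + z)‖ₑ)) := by
        refine lintegral_mono fun x => ?_
        rw [← sub_add_sub_cancel _ (g₂ (x + y))]
        exact (enorm_add_le _ _).trans (add_le_add_right enorm_sub_le _)
    _ = _ := by
        rw [lintegral_add_left (by fun_prop), lintegral_add_left (by fun_prop),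
          lintegral_add_right_eq_self (fun x => ‖g₁ x - g₂ x‖ₑ),
          lintegral_add_right_eq_self (fun x => ‖g₂ x‖ₑ),
          lintegral_add_right_eq_self (fun x => ‖g₂ x‖ₑ)]

theorem tendsto_lintegral_quadOn_sub_gOuter (hlam : 0 < lam) (hr : 0 < r)
    (hh : Tendsto h atTop (𝓝[>] 0)) (hv : ∀ m, Measurable (v m)) (hu : Measurable u)
    (hvM : ∀ m x, |v m x| ≤ M) (huM : ∀ x, |u x| ≤ M) (hui : Integrable u)
    (hvu : Tendsto (fun m => ∫⁻ x, ‖v m x - u x‖ₑ) atTop (𝓝 0)) :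
    Tendsto (fun m => ∫⁻ x, ‖quadOn c lam (h m) {z | r < ‖z‖} (v m) x - gOuter c lam r u x‖ₑ)
      atTop (𝓝 0) := by
  set b : ℕ → Space d → ℝ≥0∞ := fun m z =>
    (∫⁻ x, ‖v m (x + gridRound (h m) z) - u (x + z)‖ₑ) + ∫⁻ x, ‖v m x - u x‖ₑ
  set C : ℝ≥0∞ := 1 + ((∫⁻ x, ‖u x‖ₑ) + ∫⁻ x, ‖u x‖ₑ) + 1
  have hbC : ∀ᶠ m in atTop, ∀ z, b m z ≤ C := by
    filter_upwards [hvu.eventually_le_const one_pos] with m hm z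
    refine add_le_add ?_ hm
    exact (lintegral_enorm_translate_sub_translate_le (hv m) hu _ z).trans (add_le_add_left hm _)
  have hblim : ∀ z, Tendsto (fun m => b m z) atTop (𝓝 0) := fun z => by
    rw [← add_zero 0]
    exact (tendsto_lintegral_enorm_translate_sub_of_tendsto
      (fun m => (hv m).aestronglyMeasurable) hui hvu ((tendsto_gridRound z).comp hh)).add hvu
  have hlim : Tendsto (fun m => ∫⁻ z in {z | r < ‖z‖}, ‖kernel d lam z‖ₑ * b m z) atTop
      (𝓝 (∫⁻ _ in {z : Space d | r < ‖z‖}, 0)) := by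
    refine tendsto_lintegral_filter_of_dominated_convergence (fun z => ‖kernel d lam z‖ₑ * C)
      (Eventually.of_forall fun m => by have := hv m; fun_prop)
      (hbC.mono fun m hm => ae_of_all _ fun z => mul_le_mul_right (hm z) _) ?_
      (ae_of_all _ fun z => ?_)
    · rw [lintegral_mul_const _ measurable_kernel.enorm]
      have hC : C ≠ ⊤ := by have := hui.2.ne; finiteness
      exact ENNReal.mul_ne_top (integrableOn_kernel_of_lt_norm hlam hr).2.ne hC
    · simpa only [mul_zero] using ENNReal.Tendsto.const_mul (hblim z) (Or.inr enorm_ne_top)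
  rw [lintegral_zero] at hlim
  have hbound := ENNReal.Tendsto.const_mul (a := ‖c‖ₑ) hlim (Or.inr enorm_ne_top)
  rw [mul_zero] at hbound
  exact tendsto_of_tendsto_of_tendsto_of_le_of_le tendsto_const_nhds hbound (fun _ => zero_le)
    fun m => lintegral_enorm_quadOn_sub_gOuter_le hlam hr (hv m) hu (hvM m) huM

end OuterQuadrature

lemma measurable_gOuter {g : SpaceTime d → ℝ} (hg : Measurable g) :
    Measurable fun p : SpaceTime d => gOuter c lam r (fun y => g (y, p.2)) p.1 := by
  have hint : StronglyMeasurable fun q : SpaceTime d × Space d =>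
      (g (q.1.1 + q.2, q.1.2) - g (q.1.1, q.1.2)) * kernel d lam q.2 :=
    Measurable.stronglyMeasurable (by fun_prop)
  exact (hint.integral_prod_right (ν := volume.restrict {z | r < ‖z‖})).measurable.const_mul _

lemma abs_quadOn_le {h B : ℝ} {g : Space d → ℝ} (hlam : 0 < lam) (hr : 0 < r)
    (hB : ∀ x, |g x| ≤ B) (x : Space d) :
    |quadOn c lam h {z | r < ‖z‖} g x| ≤ |c| * ∫ z in {z | r < ‖z‖}, kernel d lam z * (B + B) :=
  abs_mul_integral_le (integrableOn_kernel_of_lt_norm hlam hr) kernel_nonneg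
    (fun _ => (abs_sub _ _).trans (add_le_add (hB _) (hB _))) c

lemma abs_gOuter_le {B : ℝ} {g : Space d → ℝ} (hlam : 0 < lam) (hr : 0 < r)
    (hB : ∀ x, |g x| ≤ B) (x : Space d) :
    |gOuter c lam r g x| ≤ |c| * ∫ z in {z | r < ‖z‖}, kernel d lam z * (B + B) := by
  simp_rw [gOuter, mul_comm _ (kernel d lam _)]
  exact abs_mul_integral_le (integrableOn_kernel_of_lt_norm hlam hr) kernel_nonneg
    (fun _ => (abs_sub _ _).trans (add_le_add (hB _) (hB _))) c

lemma tendsto_lintegral_comp_quadOn_sub_gOuter {v : ℕ → Space d → ℝ} {u : Space d → ℝ}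
    (hlam : 0 < lam) (hr : 0 < r) (hA : LipschitzWith LA A) (hh : Tendsto h atTop (𝓝[>] 0))
    (hv : ∀ m, Measurable (v m)) (hu : Measurable u) (hvM : ∀ m x, |v m x| ≤ M)
    (huM : ∀ x, |u x| ≤ M) (hui : Integrable u)
    (hvu : Tendsto (fun m => ∫⁻ x, ‖v m x - u x‖ₑ) atTop (𝓝 0)) :
    Tendsto (fun m => ∫⁻ x, ‖quadOn c lam (h m) {z | r < ‖z‖} (fun y => A (v m y)) x
      - gOuter c lam r (fun y => A (u y)) x‖ₑ) atTop (𝓝 0) := by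
  have hAm := hA.continuous.measurable
  have hbound : ∀ a, |a| ≤ M → |A a - A 0| ≤ LA * M := fun a ha => by
    simpa only [Real.norm_eq_abs, sub_zero] using hA.norm_sub_le_of_le
      (by simpa only [sub_zero, Real.norm_eq_abs] using ha : ‖a - 0‖ ≤ M)
  have hint : Integrable fun x => A (u x) - A 0 := by
    refine (hui.norm.const_mul (LA : ℝ)).mono'
      ((hAm.comp hu).sub_const _).aestronglyMeasurable (ae_of_all _ fun x => ?_)
    simpa only [sub_zero] using hA.norm_sub_le (u x) 0
  have hcomp : Tendsto (fun m => ∫⁻ x, ‖(A (v m x) - A 0) - (A (u x) - A 0)‖ₑ) atTop (𝓝 0) := by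
    have hLA := ENNReal.Tendsto.const_mul (a := (LA : ℝ≥0∞)) hvu (Or.inr ENNReal.coe_ne_top)
    rw [mul_zero] at hLA
    refine tendsto_of_tendsto_of_tendsto_of_le_of_le tendsto_const_nhds hLA (fun _ => zero_le)
      fun m => ?_
    beta_reduce
    rw [← lintegral_const_mul' _ _ ENNReal.coe_ne_top]
    refine lintegral_mono fun x => ?_
    rw [sub_sub_sub_cancel_right]
    exact enorm_comp_sub_le hA _ _
  have hlim := tendsto_lintegral_quadOn_sub_gOuter (c := c) hlam hr hh
    (v := fun m x => A (v m x) - A 0) (fun m => (hAm.comp (hv m)).sub_const _)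
    ((hAm.comp hu).sub_const _) (fun m x => hbound _ (hvM m x)) (fun x => hbound _ (huM x)) hint
    hcomp
  simpa only [quadOn, gOuter, Function.comp_apply, sub_sub_sub_cancel_right] using hlim

/-- Convergence of `v m` to `u` in `L¹(ℝ^d)` at almost all times, also after a time shift `τ m`. -/
structure ConvergesSlicewise (T : ℝ) (τ : ℕ → ℝ) (v : ℕ → SpaceTime d → ℝ)
    (u : SpaceTime d → ℝ) : Prop where
  integrable : ∀ᵐ t ∂(volume.restrict (Ioo 0 T)), Integrable fun x => u (x, t)
  tendsto : ∀ᵐ t ∂(volume.restrict (Ioo 0 T)),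
    Tendsto (fun m => ∫⁻ x, ‖v m (x, t) - u (x, t)‖ₑ) atTop (𝓝 0)
  tendsto_shift : ∀ᵐ t ∂(volume.restrict (Ioo 0 T)),
    Tendsto (fun m => ∫⁻ x, ‖v m (x, t + τ m) - u (x, t)‖ₑ) atTop (𝓝 0)

/-- Convergence at the point `p` of all the values of the approximations `v m` which enter the
discrete entropy inequality, with mesh sizes `h m` and `τ m`. -/
structure DataConvergesAt (c lam r : ℝ) (A : ℝ → ℝ) (h τ : ℕ → ℝ) (v : ℕ → SpaceTime d → ℝ)
    (u : SpaceTime d → ℝ) (p : SpaceTime d) : Prop where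
  value : Tendsto (fun m => v m p) atTop (𝓝 (u p))
  space_shift : ∀ l,
    Tendsto (fun m => v m (p + (EuclideanSpace.single l (h m), 0))) atTop (𝓝 (u p))
  time_shift : Tendsto (fun m => v m (p + (0, τ m))) atTop (𝓝 (u p))
  outer : Tendsto (fun m => quadOn c lam (h m) {z | r < ‖z‖} (fun y => A (v m (y, p.2))) p.1)
    atTop (𝓝 (gOuter c lam r (fun y => A (u (y, p.2))) p.1))

variable {v : ℕ → SpaceTime d → ℝ} {u : SpaceTime d → ℝ}

lemma ConvergesSlicewise.tendsto_space_shift (hconv : ConvergesSlicewise T τ v u)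
    (hh : Tendsto h atTop (𝓝 0)) (hv : ∀ m, Measurable (v m)) (l : Fin d) :
    ∀ᵐ t ∂(volume.restrict (Ioo 0 T)), Tendsto (fun m =>
      ∫⁻ x, ‖v m (x + EuclideanSpace.single l (h m), t) - u (x, t)‖ₑ) atTop (𝓝 0) := by
  have hshift : Tendsto (fun m => (EuclideanSpace.single l (h m) : Space d)) atTop (𝓝 0) := by
    rw [tendsto_zero_iff_norm_tendsto_zero]
    simpa only [PiLp.norm_single, norm_zero] using hh.norm
  filter_upwards [hconv.tendsto, hconv.integrable] with t ht hint
  simpa only [Function.comp_apply, add_zero] using tendsto_lintegral_enorm_translate_sub_of_tendsto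
    (fun m => ((hv m).comp measurable_prodMk_right).aestronglyMeasurable) hint ht hshift

/-- The deviations from the limit of the quantities in `DataConvergesAt`, as one finite family: the
value, its shifts in space and in time, and the outer quadrature. -/
def dataError (c lam r : ℝ) (A : ℝ → ℝ) (h τ : ℝ) (v u : SpaceTime d → ℝ) :
    (Unit ⊕ Fin d) ⊕ (Unit ⊕ Unit) → SpaceTime d → ℝ
  | .inl (.inl _), p => v p - u p
  | .inl (.inr l), p => v (p + (EuclideanSpace.single l h, 0)) - u p
  | .inr (.inl _), p => v (p + (0, τ)) - u p
  | .inr (.inr _), p => quadOn c lam h {z | r < ‖z‖} (fun y => A (v (y, p.2))) p.1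
      - gOuter c lam r (fun y => A (u (y, p.2))) p.1

lemma DataConvergesAt.of_dataError {p : SpaceTime d}
    (hp : ∀ i, Tendsto (fun m => dataError c lam r A (h m) (τ m) (v m) u i p) atTop (𝓝 0)) :
    DataConvergesAt c lam r A h τ v u p where
  value := tendsto_sub_nhds_zero_iff.1 (hp (.inl (.inl ())))
  space_shift l := tendsto_sub_nhds_zero_iff.1 (hp (.inl (.inr l)))
  time_shift := tendsto_sub_nhds_zero_iff.1 (hp (.inr (.inl ())))
  outer := tendsto_sub_nhds_zero_iff.1 (hp (.inr (.inr ())))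

lemma measurable_dataError {h τ : ℝ} {v : SpaceTime d → ℝ} (hA : Measurable A)
    (hv : Measurable v) (hu : Measurable u) :
    ∀ i, Measurable (dataError c lam r A h τ v u i)
  | .inl (.inl _) => hv.sub hu
  | .inl (.inr _) => (hv.comp (measurable_add_const _)).sub hu
  | .inr (.inl _) => (hv.comp (measurable_add_const _)).sub hu
  | .inr (.inr _) => (measurable_quadOn (hA.comp hv)).sub (measurable_gOuter (hA.comp hu))

lemma exists_abs_dataError_le (c : ℝ) (hlam : 0 < lam) (hr : 0 < r) (hA : LipschitzWith LA A)
    (hvM : ∀ m p, |v m p| ≤ M) (huM : ∀ p, |u p| ≤ M) (i : (Unit ⊕ Fin d) ⊕ (Unit ⊕ Unit)) :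
    ∃ C, ∀ m p, |dataError c lam r A (h m) (τ m) (v m) u i p| ≤ C := by
  have hdiff : ∀ m p q, |v m q - u p| ≤ M + M := fun m p q =>
    (abs_sub _ _).trans (add_le_add (hvM m q) (huM p))
  obtain (_ | l) | (_ | _) := i
  · exact ⟨_, fun m p => hdiff m p _⟩
  · exact ⟨_, fun m p => hdiff m p _⟩
  · exact ⟨_, fun m p => hdiff m p _⟩
  · exact ⟨_, fun m p => (abs_sub _ _).trans
      (add_le_add (abs_quadOn_le hlam hr (fun _ => abs_le_of_lipschitzWith hA (hvM m _)) _)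
        (abs_gOuter_le hlam hr (fun _ => abs_le_of_lipschitzWith hA (huM _)) _))⟩

lemma ConvergesSlicewise.tendsto_dataError (hconv : ConvergesSlicewise T τ v u)
    (hlam : 0 < lam) (hr : 0 < r) (hA : LipschitzWith LA A) (hh : Tendsto h atTop (𝓝[>] 0))
    (hv : ∀ m, Measurable (v m)) (hu : Measurable u) (hvM : ∀ m p, |v m p| ≤ M)
    (huM : ∀ p, |u p| ≤ M) (i : (Unit ⊕ Fin d) ⊕ (Unit ⊕ Unit)) :
    ∀ᵐ t ∂(volume.restrict (Ioo 0 T)), Tendsto (fun m =>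
      ∫⁻ x, ‖dataError c lam r A (h m) (τ m) (v m) u i (x, t)‖ₑ) atTop (𝓝 0) := by
  obtain (_ | l) | (_ | _) := i
  · exact hconv.tendsto
  · simpa only [dataError, Prod.mk_add_mk, add_zero] using
      hconv.tendsto_space_shift (hh.mono_right nhdsWithin_le_nhds) hv l
  · simpa only [dataError, Prod.mk_add_mk, add_zero] using hconv.tendsto_shift
  · filter_upwards [hconv.tendsto, hconv.integrable] with t ht hint
    exact tendsto_lintegral_comp_quadOn_sub_gOuter (v := fun m x => v m (x, t))
      (u := fun x => u (x, t)) hlam hr hA hh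
      (fun m => (hv m).comp measurable_prodMk_right) (hu.comp measurable_prodMk_right)
      (fun m _ => hvM m _) (fun _ => huM _) hint ht

theorem ConvergesSlicewise.exists_subseq_dataConvergesAt (hconv : ConvergesSlicewise T τ v u)
    (c : ℝ) (hlam : 0 < lam) (hr : 0 < r) (hA : LipschitzWith LA A)
    (hh : Tendsto h atTop (𝓝[>] 0)) (hv : ∀ m, Measurable (v m)) (hu : Measurable u)
    (hvM : ∀ m p, |v m p| ≤ M) (huM : ∀ p, |u p| ≤ M) (R : ℝ) :
    ∃ ns : ℕ → ℕ, StrictMono ns ∧ ∀ᵐ p : SpaceTime d, p ∈ Metric.closedBall 0 R ×ˢ Ioo 0 T →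
      DataConvergesAt c lam r A (h ∘ ns) (τ ∘ ns) (v ∘ ns) u p := by
  have : IsFiniteMeasure (volume.restrict (Metric.closedBall (0 : Space d) R)) :=
    isFiniteMeasure_restrict.2 (isCompact_closedBall _ _).measure_lt_top.ne
  have hmeas : ∀ m i, Measurable (dataError c lam r A (h m) (τ m) (v m) u i) := fun m =>
    measurable_dataError hA.continuous.measurable (hv m) hu
  obtain ⟨ns, hns, hae⟩ := exists_subseq_forall_tendsto_ae
    (μ := (volume.restrict (Metric.closedBall 0 R)).prod (volume.restrict (Ioo 0 T))) hmeas
    fun i => by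
      obtain ⟨C, hC⟩ := exists_abs_dataError_le c hlam hr hA hvM huM i
      refine tendsto_lintegral_prod_of_slices (fun m => hmeas m i) hC ?_
      filter_upwards [hconv.tendsto_dataError hlam hr hA hh hv hu hvM huM i] with t ht
      exact tendsto_of_tendsto_of_tendsto_of_le_of_le tendsto_const_nhds ht (fun _ => zero_le)
        fun _ => setLIntegral_le_lintegral _ _
  rw [Measure.prod_restrict] at hae
  exact ⟨ns, hns, (ae_imp_of_ae_restrict hae).mono fun p hp hmem =>
    .of_dataError (hp hmem)⟩

end Convergence
/-! ### The limit of the discrete entropy inequality -/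

section Integrand

variable {d : ℕ} {c lam r T k : ℝ} {f : ℝ → Space d} {A : ℝ → ℝ} {u φ : SpaceTime d → ℝ}

lemma deriv_snd_eq_fderiv {p : SpaceTime d} (hφ : DifferentiableAt ℝ φ p) :
    deriv (fun s => φ (p.1, s)) p.2 = fderiv ℝ φ p (0, 1) := by
  have hcomp := HasFDerivAt.comp p.2 (f := fun s => (p.1, s)) hφ.hasFDerivAt
    (hasFDerivAt_prodMk_right p.1 p.2)
  exact hcomp.hasDerivAt.deriv.trans (by simp)

lemma inner_gradient_fst_eq_sum {p : SpaceTime d} (hφ : DifferentiableAt ℝ φ p) (q : Space d) :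
    inner ℝ q (gradient (fun y => φ (y, p.2)) p.1)
      = ∑ l, q l * fderiv ℝ φ p (EuclideanSpace.single l 1, 0) := by
  have hcomp := HasFDerivAt.comp p.1 (f := fun y => (y, p.2)) hφ.hasFDerivAt
    (hasFDerivAt_prodMk_left p.1 p.2)
  have hq : q = ∑ l, q l • (EuclideanSpace.single l (1 : ℝ) : Space d) := by
    ext j; simp [Finset.sum_apply, Pi.single_apply]
  rw [real_inner_comm, gradient, InnerProductSpace.toDual_symm_apply]
  conv_lhs => rw [hq, map_sum]
  refine Finset.sum_congr rfl fun l _ => ?_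
  rw [map_smul, smul_eq_mul]
  exact congrArg (q l * ·) (DFunLike.congr_fun hcomp.fderiv _)

theorem entropyIntegrand_eq (hlam : 0 < lam) (hlam2 : lam < 2) (hr : 0 < r)
    (hφ : ContDiff ℝ 2 φ) (hφc : HasCompactSupport φ) (p : SpaceTime d) :
    entropyIntegrand c lam f A k r u φ p =
      |u p - k| * fderiv ℝ φ p (0, 1)
      + ∑ l, Real.sign (u p - k) * (f (u p) l - f k l)
          * fderiv ℝ φ p (EuclideanSpace.single l 1, 0)
      + |A (u p) - A k| * innerOp c lam r φ p
      + Real.sign (u p - k) * gOuter c lam r (fun y => A (u (y, p.2))) p.1 * φ p := by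
  have hdiff : DifferentiableAt ℝ φ p := hφ.differentiable two_ne_zero p
  rw [entropyIntegrand, deriv_snd_eq_fderiv hdiff, inner_gradient_fst_eq_sum hdiff,
    gInner_eq_innerOp hlam hlam2 hr hφ hφc]
  simp only [entropy, entropyFlux, entropySign, PiLp.smul_apply, PiLp.sub_apply, smul_eq_mul]

lemma innerOp_eq_zero {p : SpaceTime d} (h : ∀ x, φ (x, p.2) = 0) : innerOp c lam r φ p = 0 := by
  simp [innerOp, secondDiff, add_mk_zero, sub_mk_zero, h]

lemma mem_tsupport_of_fderiv_ne_zero {p w : SpaceTime d} (h : fderiv ℝ φ p w ≠ 0) :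
    p ∈ tsupport φ :=
  support_fderiv_subset ℝ (f := φ) fun h0 => h (by rw [h0]; rfl)

namespace IsTestFunction

variable (hφ : IsTestFunction T φ)

include hφ

lemma contDiff_two : ContDiff ℝ 2 φ := hφ.smooth.of_le ENat.LEInfty.out

lemma differentiable : Differentiable ℝ φ := hφ.contDiff_two.differentiable two_ne_zero

lemma eq_zero_of_time_notMem {p : SpaceTime d} (hp : p.2 ∉ Ioo 0 T) : φ p = 0 :=
  image_eq_zero_of_notMem_tsupport fun h => hp (hφ.support h).2

lemma mem_of_innerOp_ne_zero (hlam : 0 < lam) (hlam2 : lam < 2) {p : SpaceTime d}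
    (h : innerOp c lam r φ p ≠ 0) :
    p ∈ Metric.cthickening (2 * r) (tsupport φ) ∧ p.2 ∈ Ioo 0 T := by
  constructor <;> by_contra hp
  · obtain ⟨C, hC⟩ := exists_abs_innerOp_le c r hlam hlam2 hφ.contDiff_two hφ.compact
    have hle := hC p
    rw [indicator_of_notMem hp] at hle
    exact h (abs_nonpos_iff.1 hle)
  · exact h (innerOp_eq_zero fun x => hφ.eq_zero_of_time_notMem hp)

lemma eventually_time_add_lt :
    ∀ᶠ s in 𝓝[>] (0 : ℝ), ∀ p, φ p ≠ 0 → 0 ≤ p.2 ∧ p.2 + s < T := by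
  have hK : IsCompact (Prod.snd '' tsupport φ) := hφ.compact.isCompact.image continuous_snd
  have hsub : Prod.snd '' tsupport φ ⊆ Ioo 0 T := image_subset_iff.2 fun p hp => (hφ.support hp).2
  have hmem : ∀ p, φ p ≠ 0 → p.2 ∈ Prod.snd '' tsupport φ := fun p hp =>
    mem_image_of_mem _ (subset_tsupport φ hp)
  rcases (Prod.snd '' tsupport φ).eq_empty_or_nonempty with hempty | hne
  · exact Eventually.of_forall fun s p hp => absurd (hmem p hp) (hempty ▸ notMem_empty _)
  obtain ⟨b, hb, hmax⟩ := hK.exists_isMaxOn hne continuousOn_id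
  filter_upwards [nhdsWithin_le_nhds (Iio_mem_nhds (sub_pos.2 (hsub hb).2))] with s hs p hp
  have hle : p.2 ≤ b := hmax (hmem p hp)
  exact ⟨(hsub (hmem p hp)).1.le, by linarith [mem_Iio.1 hs]⟩

lemma entropyIntegrand_eq_zero (hlam : 0 < lam) (hlam2 : lam < 2) (hr : 0 < r) {p : SpaceTime d}
    (hp : p.2 ∉ Ioo 0 T) : entropyIntegrand c lam f A k r u φ p = 0 := by
  have hD : ∀ w, fderiv ℝ φ p w = 0 := fun w => by
    by_contra h
    exact hp (hφ.support (mem_tsupport_of_fderiv_ne_zero h)).2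
  rw [entropyIntegrand_eq hlam hlam2 hr hφ.contDiff_two hφ.compact, hφ.eq_zero_of_time_notMem hp,
    innerOp_eq_zero fun x => hφ.eq_zero_of_time_notMem hp]
  simp [hD]

end IsTestFunction

end Integrand

section Limit

variable {d : ℕ} {c lam r T k M : ℝ} {LF LA : ℝ≥0} {f : ℝ → Space d} {A : ℝ → ℝ}
  {F : ℕ → Fin d → ℝ → ℝ → ℝ} {h τ : ℕ → ℝ} {v : ℕ → SpaceTime d → ℝ} {u φ : SpaceTime d → ℝ}
  {p : SpaceTime d}

lemma tendsto_diffQuot {E : Type*} [NormedAddCommGroup E] [NormedSpace ℝ E] {φ : E → ℝ} {p : E}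
    (hφ : DifferentiableAt ℝ φ p) (w : E) :
    Tendsto (fun s : ℝ => (φ (p + s • w) - φ p) / s) (𝓝[≠] 0) (𝓝 (fderiv ℝ φ p w)) := by
  simpa only [smul_eq_mul, div_eq_inv_mul] using
    (hφ.hasFDerivAt.hasLineDerivAt w).tendsto_slope_zero

lemma tendsto_timeDiffQuot (hφ : DifferentiableAt ℝ φ p) :
    Tendsto (fun s : ℝ => (φ p - φ (p - (0, s))) / s) (𝓝[>] 0) (𝓝 (fderiv ℝ φ p (0, 1))) := by
  have hneg : Tendsto (fun s : ℝ => -s) (𝓝[>] 0) (𝓝[≠] 0) := by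
    refine tendsto_nhdsWithin_iff.2 ⟨?_, ?_⟩
    · exact tendsto_nhdsWithin_of_tendsto_nhds (by simpa using tendsto_neg (0 : ℝ))
    · filter_upwards [self_mem_nhdsWithin] with s hs using neg_ne_zero.2 (ne_of_gt hs)
  refine ((tendsto_diffQuot hφ (0, 1)).comp hneg).congr fun s => ?_
  have hshift : p + -s • ((0, 1) : SpaceTime d) = p - (0, s) := by ext <;> simp [sub_eq_add_neg]
  rw [Function.comp_apply, hshift, ← neg_sub (φ p), neg_div_neg_eq]

lemma tendsto_spaceDiffQuot (hφ : DifferentiableAt ℝ φ p) (l : Fin d) :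
    Tendsto (fun s : ℝ => (φ (p + (EuclideanSpace.single l s, 0)) - φ p) / s) (𝓝[>] 0)
      (𝓝 (fderiv ℝ φ p (EuclideanSpace.single l 1, 0))) := by
  refine ((tendsto_diffQuot hφ (EuclideanSpace.single l 1, 0)).mono_left
    (nhdsWithin_mono 0 fun s hs => ne_of_gt hs)).congr fun s => ?_
  rw [Prod.smul_mk, smul_zero]
  congr 6
  ext j; simp

/-- The factor `a` need not converge where its limit is multiplied by zero: this is what allows the
convergence of the data to be known on the support of the test function only. -/
lemma tendsto_mul_of_abs_le {ι : Type*} {𝓕 : Filter ι} {a ψ : ι → ℝ} {a₀ ψ₀ C : ℝ}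
    (ha : ∀ m, |a m| ≤ C) (hψ : Tendsto ψ 𝓕 (𝓝 ψ₀)) (h : ψ₀ ≠ 0 → Tendsto a 𝓕 (𝓝 a₀)) :
    Tendsto (fun m => a m * ψ m) 𝓕 (𝓝 (a₀ * ψ₀)) := by
  by_cases hψ₀ : ψ₀ = 0
  · rw [hψ₀, mul_zero]
    rw [hψ₀] at hψ
    refine squeeze_zero_norm (fun m => ?_) (by simpa using hψ.abs.const_mul C)
    rw [norm_mul]
    exact mul_le_mul_of_nonneg_right (ha m) (norm_nonneg _)
  · exact (h hψ₀).mul hψ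

lemma tendsto_sign {ι : Type*} {𝓕 : Filter ι} {a : ι → ℝ} {a₀ : ℝ} (ha : Tendsto a 𝓕 (𝓝 a₀))
    (h0 : a₀ ≠ 0) : Tendsto (fun m => Real.sign (a m)) 𝓕 (𝓝 (Real.sign a₀)) := by
  refine tendsto_const_nhds.congr' ?_
  rcases lt_or_gt_of_ne h0 with h | h
  · filter_upwards [ha.eventually_lt_const h] with m hm
    rw [Real.sign_of_neg h, Real.sign_of_neg hm]
  · filter_upwards [ha.eventually_const_lt h] with m hm
    rw [Real.sign_of_pos h, Real.sign_of_pos hm]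

lemma tendsto_numEntropyFlux {ι : Type*} {𝓕 : Filter ι} {f : ℝ → ℝ} {F : ι → ℝ → ℝ → ℝ}
    (hF : ∀ m, IsNumericalFlux LF f (F m)) (k : ℝ) {a b : ι → ℝ} {u : ℝ} (ha : Tendsto a 𝓕 (𝓝 u))
    (hb : Tendsto b 𝓕 (𝓝 u)) : Tendsto (fun m => numEntropyFlux (F m) k (a m) (b m)) 𝓕
      (𝓝 (Real.sign (u - k) * (f u - f k))) := by
  have herror : Tendsto (fun m => 2 * (LF : ℝ) * (|a m - u| + |b m - u|)) 𝓕 (𝓝 0) := by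
    simpa using ((tendsto_iff_norm_sub_tendsto_zero.1 ha).add
      (tendsto_iff_norm_sub_tendsto_zero.1 hb)).const_mul (2 * (LF : ℝ))
  rw [tendsto_iff_norm_sub_tendsto_zero]
  exact squeeze_zero (fun _ => norm_nonneg _)
    (fun m => (hF m).abs_numEntropyFlux_sub_le k (a m) (b m) u) herror

theorem tendsto_discIntegrand (hlam : 0 < lam) (hlam2 : lam < 2) (hr : 0 < r)
    (hA : LipschitzWith LA A) (hF : ∀ m l, IsNumericalFlux LF (fun v => f v l) (F m l))
    (hh : Tendsto h atTop (𝓝[>] 0)) (hτ : Tendsto τ atTop (𝓝[>] 0))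
    (hvM : ∀ m p, |v m p| ≤ M) (hφ : IsTestFunction T φ)
    (hp : p ∈ Metric.cthickening (2 * r) (tsupport φ) → p.2 ∈ Ioo 0 T →
      u p ≠ k ∧ DataConvergesAt c lam r A h τ v u p) :
    Tendsto (fun m => discIntegrand c lam A (F m) (h m) (τ m) k r (v m) φ p) atTop
      (𝓝 (entropyIntegrand c lam f A k r u φ p)) := by
  have hsupp : p ∈ tsupport φ → u p ≠ k ∧ DataConvergesAt c lam r A h τ v u p := fun h =>
    hp (Metric.self_subset_cthickening _ h) (hφ.support h).2
  have hdiff := hφ.differentiable p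
  have hvk : ∀ m p, |v m p - k| ≤ M + |k| := fun m p =>
    (abs_sub _ _).trans (add_le_add_left (hvM m p) _)
  have hAv : ∀ m q, |A (v m q)| ≤ |A 0| + LA * M := fun m q => abs_le_of_lipschitzWith hA (hvM m q)
  rw [entropyIntegrand_eq hlam hlam2 hr hφ.contDiff_two hφ.compact]
  refine ((Tendsto.add ?time (tendsto_finsetSum _ fun l _ => ?flux)).add ?inner).add ?outer
  case time =>
    exact tendsto_mul_of_abs_le (fun m => (abs_abs _).trans_le (hvk m p))
      ((tendsto_timeDiffQuot hdiff).comp hτ) fun h0 =>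
        ((hsupp (mem_tsupport_of_fderiv_ne_zero h0)).2.value.sub_const k).abs
  case flux =>
    refine tendsto_mul_of_abs_le (fun m => (hF m l).abs_numEntropyFlux_le k (hvM m _) (hvM m _))
      ((tendsto_spaceDiffQuot hdiff l).comp hh) fun h0 => ?_
    have hdata := (hsupp (mem_tsupport_of_fderiv_ne_zero h0)).2
    exact tendsto_numEntropyFlux (fun m => hF m l) k hdata.value (hdata.space_shift l)
  case inner =>
    refine tendsto_mul_of_abs_le
      (fun m => (abs_abs _).trans_le ((abs_sub _ _).trans (add_le_add_left (hAv m p) |A k|)))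
      ((tendsto_discInner hlam hlam2 hφ.contDiff_two hφ.compact p).comp hh) fun h0 => ?_
    obtain ⟨hmem, htime⟩ := hφ.mem_of_innerOp_ne_zero hlam hlam2 h0
    exact (((hA.continuous.tendsto _).comp (hp hmem htime).2.value).sub_const (A k)).abs
  case outer =>
    refine tendsto_mul_of_abs_le (fun m => (abs_mul _ _).trans_le (mul_le_mul (abs_sign_le_one _)
      (abs_quadOn_le hlam hr (fun y => hAv m _) _) (abs_nonneg _) zero_le_one))
      tendsto_const_nhds fun h0 => ?_
    obtain ⟨hne, hdata⟩ := hsupp (subset_tsupport φ h0)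
    exact (tendsto_sign (hdata.time_shift.sub_const k) (sub_ne_zero.2 hne)).mul hdata.outer

end Limit
section Domination

variable {d : ℕ} {c lam r h τ k κ M : ℝ} {Lf LF LA : ℝ≥0} {f : ℝ → Space d} {A : ℝ → ℝ}
  {F : Fin d → ℝ → ℝ → ℝ} {u v φ : SpaceTime d → ℝ}

lemma abs_mul_le_mul {a b C D : ℝ} (ha : |a| ≤ C) (hb : |b| ≤ D) : |a * b| ≤ C * D := by
  simpa only [Real.norm_eq_abs] using norm_mul_le_of_le (a₁ := a) ha hb

/-- The shape of both `discIntegrand` and `entropyIntegrand`: the factors `aᵢ` come from the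
approximate solution, the factors `bᵢ` from the test function. -/
lemma abs_add_sum_add_add_le_indicator {E : Type*} {K : Set E} {p : E} {a₁ a₃ a₄ b₁ b₃ b₄ : ℝ}
    {a₂ b₂ : Fin d → ℝ} {A₁ A₂ A₃ A₄ B₁ B₂ B₃ B₄ : ℝ}
    (ha₁ : |a₁| ≤ A₁) (ha₂ : ∀ l, |a₂ l| ≤ A₂) (ha₃ : |a₃| ≤ A₃) (ha₄ : |a₄| ≤ A₄)
    (hb₁ : |b₁| ≤ K.indicator (fun _ => B₁) p) (hb₂ : ∀ l, |b₂ l| ≤ K.indicator (fun _ => B₂) p)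
    (hb₃ : |b₃| ≤ K.indicator (fun _ => B₃) p) (hb₄ : |b₄| ≤ K.indicator (fun _ => B₄) p) :
    |a₁ * b₁ + ∑ l, a₂ l * b₂ l + a₃ * b₃ + a₄ * b₄| ≤
      K.indicator (fun _ => A₁ * B₁ + d * (A₂ * B₂) + A₃ * B₃ + A₄ * B₄) p := by
  have hsum : |∑ l, a₂ l * b₂ l| ≤ d * (A₂ * K.indicator (fun _ => B₂) p) := by
    refine (Finset.abs_sum_le_sum_abs _ _).trans
      ((Finset.sum_le_sum fun l _ => abs_mul_le_mul (ha₂ l) (hb₂ l)).trans_eq ?_)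
    rw [Finset.sum_const, Finset.card_univ, Fintype.card_fin, nsmul_eq_mul]
  refine (abs_add_le _ _).trans ((add_le_add ((abs_add_le _ _).trans (add_le_add
    ((abs_add_le _ _).trans (add_le_add (abs_mul_le_mul ha₁ hb₁) hsum))
    (abs_mul_le_mul ha₃ hb₃))) (abs_mul_le_mul ha₄ hb₄)).trans_eq ?_)
  by_cases hp : p ∈ K
  · simp only [indicator_of_mem hp]
  · simp only [indicator_of_notMem hp, mul_zero, add_zero]

lemma exists_norm_le_indicator {E G : Type*} [TopologicalSpace E] [NormedAddCommGroup G]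
    {g : E → G} {K : Set E} (hg : Continuous g) (hgc : HasCompactSupport g) (hK : tsupport g ⊆ K) :
    ∃ C, ∀ p, ‖g p‖ ≤ K.indicator (fun _ => C) p := by
  obtain ⟨C, hC⟩ := hgc.exists_bound_of_continuous hg
  refine ⟨C, fun p => ?_⟩
  by_cases hp : p ∈ K
  · rw [indicator_of_mem hp]
    exact hC p
  · rw [indicator_of_notMem hp, image_eq_zero_of_notMem_tsupport fun h => hp (hK h), norm_zero]

lemma abs_diffQuot_le_indicator {E : Type*} [NormedAddCommGroup E] {φ : E → ℝ} {L : ℝ≥0}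
    (hL : LipschitzWith L φ) {δ s : ℝ} (hs : 0 < s) (hsδ : s ≤ δ) (p : E) {w : E} (hw : ‖w‖ = s) :
    |(φ (p + w) - φ p) / s|
      ≤ (Metric.cthickening δ (tsupport φ)).indicator (fun _ => (L : ℝ)) p := by
  by_cases hp : p ∈ Metric.cthickening δ (tsupport φ)
  · rw [indicator_of_mem hp, abs_div, abs_of_pos hs, div_le_iff₀ hs, ← hw]
    simpa [Real.dist_eq, dist_eq_norm] using hL.dist_le_mul (p + w) p
  · have hzero : ∀ q, dist p q ≤ δ → φ q = 0 := fun q hq =>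
      image_eq_zero_of_notMem_tsupport fun h => hp (Metric.mem_cthickening_of_dist_le p q δ _ h hq)
    rw [indicator_of_notMem hp, hzero p (by simpa using hs.le.trans hsδ),
      hzero (p + w) (by simpa [hw] using hsδ), sub_self, zero_div, abs_zero]

lemma exists_abs_discIntegrand_le (c k M : ℝ) (LF : ℝ≥0) (f : ℝ → Space d) (hlam : 0 < lam)
    (hlam2 : lam < 2) (hr : 0 < r) (hA : LipschitzWith LA A) (hφ : ContDiff ℝ 2 φ)
    (hφc : HasCompactSupport φ) :
    ∃ C, ∀ {F h τ v}, (∀ l, IsNumericalFlux LF (fun a => f a l) (F l)) → h ∈ Ioc 0 (2 * r) →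
      τ ∈ Ioc 0 (2 * r) → (∀ p, |v p| ≤ M) → ∀ p, |discIntegrand c lam A F h τ k r v φ p| ≤
        (Metric.cthickening (2 * r) (tsupport φ)).indicator (fun _ => C) p := by
  obtain ⟨L, hL⟩ := ContDiff.lipschitzWith_of_hasCompactSupport hφc hφ two_ne_zero
  obtain ⟨C₃, hC₃⟩ := exists_abs_discInner_le c r hlam hlam2 hφ hφc
  obtain ⟨C₄, hC₄⟩ := exists_norm_le_indicator hφ.continuous hφc
    (Metric.self_subset_cthickening (δ := 2 * r) (tsupport φ))
  set B := |c| * ∫ z in {z : Space d | r < ‖z‖}, kernel d lam z *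
    (|A 0| + LA * M + (|A 0| + LA * M))
  refine ⟨(M + |k|) * L + d * (2 * LF * (2 * (M + |k|)) * L)
    + (|A 0| + LA * M + |A k|) * C₃ + 1 * B * C₄, fun {F h τ v} hF hh hτ hv p => ?_⟩
  have hAv : ∀ q, |A (v q)| ≤ |A 0| + LA * M := fun q => abs_le_of_lipschitzWith hA (hv q)
  have hback := abs_diffQuot_le_indicator hL hτ.1 hτ.2 p (w := -(0, τ))
    (by simp [Prod.norm_def, abs_of_pos hτ.1, hτ.1.le])
  rw [← sub_eq_add_neg, ← abs_neg, ← neg_div, neg_sub] at hback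
  exact abs_add_sum_add_add_le_indicator
    ((abs_abs _).trans_le ((abs_sub _ _).trans (add_le_add_left (hv p) _)))
    (fun l => (hF l).abs_numEntropyFlux_le k (hv _) (hv _))
    ((abs_abs _).trans_le ((abs_sub _ _).trans (add_le_add_left (hAv p) _)))
    (abs_mul_le_mul (abs_sign_le_one _) (abs_quadOn_le hlam hr (fun y => hAv _) _)) hback
    (fun l => abs_diffQuot_le_indicator hL hh.1 hh.2 p
      (by rw [norm_mk_zero, PiLp.norm_single, Real.norm_of_nonneg hh.1.le])) (hC₃ h hh.1 p) (hC₄ p)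

lemma abs_coord_sub_le (hf : LipschitzWith Lf f) (a k : ℝ) (l : Fin d) :
    |f a l - f k l| ≤ Lf * |a - k| :=
  (PiLp.norm_apply_le (f a - f k) l).trans (hf.norm_sub_le a k)

lemma exists_abs_entropyIntegrand_le (c κ : ℝ) (hlam : 0 < lam) (hlam2 : lam < 2) (hr : 0 < r)
    (hf : LipschitzWith Lf f) (hA : LipschitzWith LA A) (huM : ∀ p, |u p| ≤ M)
    (hφ : ContDiff ℝ 2 φ) (hφc : HasCompactSupport φ) :
    ∃ C, ∀ k, |k| ≤ κ → ∀ p, |entropyIntegrand c lam f A k r u φ p| ≤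
      (Metric.cthickening (2 * r) (tsupport φ)).indicator (fun _ => C) p := by
  have hsupp := Metric.self_subset_cthickening (δ := 2 * r) (tsupport φ)
  obtain ⟨L, hL⟩ := exists_norm_le_indicator (hφ.continuous_fderiv two_ne_zero) (hφc.fderiv ℝ)
    ((tsupport_fderiv_subset ℝ).trans hsupp)
  obtain ⟨C₃, hC₃⟩ := exists_abs_innerOp_le c r hlam hlam2 hφ hφc
  obtain ⟨C₄, hC₄⟩ := exists_norm_le_indicator hφ.continuous hφc hsupp
  have hAu : ∀ q, |A (u q)| ≤ |A 0| + LA * M := fun q => abs_le_of_lipschitzWith hA (huM q)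
  set B := |c| * ∫ z in {z : Space d | r < ‖z‖}, kernel d lam z *
    (|A 0| + LA * M + (|A 0| + LA * M))
  refine ⟨(M + κ) * L + d * (1 * (Lf * (M + κ)) * L)
    + (|A 0| + LA * M + (|A 0| + LA * κ)) * C₃ + 1 * B * C₄, fun k hk p => ?_⟩
  have huk : |u p - k| ≤ M + κ := (abs_sub _ _).trans (add_le_add (huM p) hk)
  have hfderiv : ∀ w : SpaceTime d, ‖w‖ = 1 → |fderiv ℝ φ p w| ≤
      (Metric.cthickening (2 * r) (tsupport φ)).indicator (fun _ => L) p := fun w hw =>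
    ((fderiv ℝ φ p).le_opNorm w).trans (by rw [hw, mul_one]; exact hL p)
  rw [entropyIntegrand_eq hlam hlam2 hr hφ hφc]
  refine abs_add_sum_add_add_le_indicator ((abs_abs _).trans_le huk) (fun l => ?_) ?_
    (abs_mul_le_mul (abs_sign_le_one _) (abs_gOuter_le hlam hr (fun y => hAu _) _))
    (hfderiv _ (by simp)) (fun l => hfderiv _ (by rw [norm_mk_zero]; simp)) (hC₃ p) (hC₄ p)
  · exact abs_mul_le_mul (abs_sign_le_one _)
      ((abs_coord_sub_le hf _ _ l).trans (mul_le_mul_of_nonneg_left huk Lf.coe_nonneg))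
  · exact (abs_abs _).trans_le
      ((abs_sub _ _).trans (add_le_add (hAu p) (abs_le_of_lipschitzWith hA hk)))

lemma integrable_indicator_cthickening (hφc : HasCompactSupport φ) (δ C : ℝ) :
    Integrable ((Metric.cthickening δ (tsupport φ)).indicator fun _ => C) := by
  have hK := hφc.isCompact.cthickening (r := δ)
  exact (integrable_indicator_iff hK.measurableSet).2 (integrableOn_const hK.measure_lt_top.ne)

lemma measurable_discIntegrand (hA : Measurable A)
    (hF : ∀ l, IsNumericalFlux LF (fun a => f a l) (F l)) (hv : Measurable v)
    (hφ : Continuous φ) : Measurable (discIntegrand c lam A F h τ k r v φ) := by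
  have hφm := hφ.measurable
  have hAv := hA.comp hv
  have hflux : ∀ l, Measurable fun p : SpaceTime d =>
      numEntropyFlux (F l) k (v p) (v (p + (EuclideanSpace.single l h, 0))) := fun l =>
    (hF l).measurable_numEntropyFlux k hv (by fun_prop)
  have hinner := measurable_discInner (c := c) (lam := lam) (r := r) (h := h) hφ
  have houter := measurable_quadOn (c := c) (lam := lam) (h := h) (S := {z | r < ‖z‖}) hAv
  unfold discIntegrand
  refine ((Measurable.add (by fun_prop) ?_).add ?_).add
    ((Measurable.mul (by fun_prop) houter).mul hφm)
  · exact Finset.measurable_fun_sum _ fun l _ => (hflux l).mul (by fun_prop)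
  · exact (hAv.sub_const _).abs.mul hinner

lemma measurable_entropyIntegrand (hlam : 0 < lam) (hlam2 : lam < 2) (hr : 0 < r)
    (hf : Continuous f) (hA : Measurable A) (hu : Measurable u) (hφ : ContDiff ℝ 2 φ)
    (hφc : HasCompactSupport φ) : Measurable (entropyIntegrand c lam f A k r u φ) := by
  have hAu := hA.comp hu
  have hfu : ∀ l, Measurable fun p => f (u p) l := fun l =>
    (by fun_prop : Continuous fun a => f a l).measurable.comp hu
  have hfderiv : ∀ w, Measurable fun p => fderiv ℝ φ p w := fun w =>
    ((hφ.continuous_fderiv two_ne_zero).clm_apply continuous_const).measurable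
  have hsign : Measurable fun p => Real.sign (u p - k) := by fun_prop
  rw [funext (entropyIntegrand_eq hlam hlam2 hr hφ hφc)]
  refine ((Measurable.add ?_ ?_).add ?_).add
    ((hsign.mul (measurable_gOuter hAu)).mul hφ.continuous.measurable)
  · exact (hu.sub_const k).abs.mul (hfderiv _)
  · exact Finset.measurable_fun_sum _ fun l _ =>
      (hsign.mul ((hfu l).sub_const _)).mul (hfderiv _)
  · exact (hAu.sub_const _).abs.mul (measurable_innerOp hφ.continuous)

lemma integrable_entropyIntegrand (hlam : 0 < lam) (hlam2 : lam < 2) (hr : 0 < r)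
    (hf : LipschitzWith Lf f) (hA : LipschitzWith LA A) (hu : Measurable u)
    (huM : ∀ p, |u p| ≤ M) (hφ : ContDiff ℝ 2 φ) (hφc : HasCompactSupport φ) :
    Integrable (entropyIntegrand c lam f A k r u φ) := by
  obtain ⟨C, hC⟩ := exists_abs_entropyIntegrand_le c |k| hlam hlam2 hr hf hA huM hφ hφc
  exact (integrable_indicator_cthickening hφc _ C).mono'
    (measurable_entropyIntegrand hlam hlam2 hr hf.continuous hA.continuous.measurable hu hφ
      hφc).aestronglyMeasurable (ae_of_all _ (hC k le_rfl))

end Domination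
/-! ### Levels with negligible level sets -/

section LevelNull

variable {d : ℕ} {c lam r T k M : ℝ} {LF LA : ℝ≥0} {f : ℝ → Space d} {A : ℝ → ℝ}
  {F : ℕ → Fin d → ℝ → ℝ → ℝ} {h τ : ℕ → ℝ} {v : ℕ → SpaceTime d → ℝ} {u φ : SpaceTime d → ℝ}

lemma tendsto_integral_discIntegrand (hlam : 0 < lam) (hlam2 : lam < 2) (hr : 0 < r)
    (hA : LipschitzWith LA A) (hF : ∀ m l, IsNumericalFlux LF (fun v => f v l) (F m l))
    (hh : Tendsto h atTop (𝓝[>] 0)) (hτ : Tendsto τ atTop (𝓝[>] 0)) (hv : ∀ m, Measurable (v m))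
    (hvM : ∀ m p, |v m p| ≤ M) (hφ : IsTestFunction T φ)
    (hdata : ∀ᵐ p, p ∈ Metric.cthickening (2 * r) (tsupport φ) → p.2 ∈ Ioo 0 T →
      u p ≠ k ∧ DataConvergesAt c lam r A h τ v u p) :
    Tendsto (fun m => ∫ p, discIntegrand c lam A (F m) (h m) (τ m) k r (v m) φ p) atTop
      (𝓝 (∫ p, entropyIntegrand c lam f A k r u φ p)) := by
  obtain ⟨C, hC⟩ :=
    exists_abs_discIntegrand_le c k M LF f hlam hlam2 hr hA hφ.contDiff_two hφ.compact
  have hsmall : Ioc (0 : ℝ) (2 * r) ∈ 𝓝[>] 0 := Ioc_mem_nhdsGT (by positivity)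
  refine tendsto_integral_filter_of_dominated_convergence _
    (Eventually.of_forall fun m => (measurable_discIntegrand hA.continuous.measurable (hF m) (hv m)
      hφ.contDiff_two.continuous).aestronglyMeasurable) ?_
    (integrable_indicator_cthickening hφ.compact (2 * r) C) ?_
  · filter_upwards [hh hsmall, hτ hsmall] with m hhm hτm
    exact ae_of_all _ (hC (hF m) hhm hτm (hvM m))
  · filter_upwards [hdata] with p hp
    exact tendsto_discIntegrand hlam hlam2 hr hA hF hh hτ hvM hφ hp

theorem entropy_inequality_of_level_null (hc : 0 ≤ c) (hlam : 0 < lam) (hlam2 : lam < 2)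
    (hr : 0 < r) (hA : LipschitzWith LA A) (hAmono : Monotone A)
    (hF : ∀ m l, IsNumericalFlux LF (fun v => f v l) (F m l))
    (hh : Tendsto h atTop (𝓝[>] 0)) (hτ : Tendsto τ atTop (𝓝[>] 0))
    (hcfl : ∀ m, CFL d c lam LF LA (h m) (τ m))
    (hv : ∀ m, IsSchemeFun c lam A (F m) (h m) (τ m) T M (v m))
    (hu : Measurable u) (huM : ∀ p, |u p| ≤ M) (hconv : ConvergesSlicewise T τ v u)
    (hk : ∀ᵐ p ∂(volume.restrict (cylinder d T)), u p ≠ k) (hφ : IsTestFunction T φ) :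
    0 ≤ ∫ p in cylinder d T, entropyIntegrand c lam f A k r u φ p := by
  obtain ⟨R, hR⟩ := (hφ.compact.isCompact.cthickening (r := 2 * r)).isBounded.subset_closedBall 0
  obtain ⟨ns, hns, hae⟩ := hconv.exists_subseq_dataConvergesAt c hlam hr hA hh
    (fun m => (hv m).measurable) hu (fun m => (hv m).bound) huM R
  have hh' := hh.comp hns.tendsto_atTop
  have hτ' := hτ.comp hns.tendsto_atTop
  have hlim := tendsto_integral_discIntegrand (k := k) hlam hlam2 hr hA (fun i => hF (ns i)) hh' hτ'
    (fun i => (hv (ns i)).measurable) (fun i => (hv (ns i)).bound) hφ (by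
      filter_upwards [hae, ae_imp_of_ae_restrict hk] with p hp hpk hpK hpT
      refine ⟨hpk ⟨mem_univ _, hpT⟩, hp ⟨?_, hpT⟩⟩
      rw [mem_closedBall_zero_iff]
      exact (norm_fst_le p).trans (mem_closedBall_zero_iff.1 (hR hpK)))
  have hcont := hφ.contDiff_two.continuous
  have hnonneg := ge_of_tendsto hlim (by
    filter_upwards [hh' self_mem_nhdsWithin, hτ' self_mem_nhdsWithin,
      hτ'.eventually hφ.eventually_time_add_lt] with i hhi hτi hφi
    exact integral_discIntegrand_nonneg hc hlam hA hAmono (hF _) hhi hτi (hcfl _) (hv _)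
      hcont.measurable (hcont.integrable_of_hasCompactSupport hφ.compact) hφ.nonneg hφi k r)
  have hzero : ∀ p ∉ cylinder d T, entropyIntegrand c lam f A k r u φ p = 0 := fun p hp =>
    hφ.entropyIntegrand_eq_zero hlam hlam2 hr fun hpT => hp ⟨mem_univ _, hpT⟩
  rwa [setIntegral_eq_integral_of_forall_compl_eq_zero hzero]

end LevelNull

/-! ### Arbitrary levels -/

section AllLevels

variable {d : ℕ} {c lam r T k M : ℝ} {Lf LA : ℝ≥0} {f : ℝ → Space d} {A : ℝ → ℝ}
  {u φ : SpaceTime d → ℝ}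

lemma exists_seq_tendsto_forall_level_null {E : Type*} [MeasurableSpace E] {μ : Measure E}
    [SFinite μ] {u : E → ℝ} (hu : Measurable u) (k : ℝ) :
    ∃ k₁ k₂ : ℕ → ℝ, Tendsto k₁ atTop (𝓝[>] k) ∧ Tendsto k₂ atTop (𝓝[<] k) ∧
      ∀ n, (∀ᵐ p ∂μ, u p ≠ k₁ n) ∧ ∀ᵐ p ∂μ, u p ≠ k₂ n := by
  have hdense : Dense {t : ℝ | 0 < μ {p | u p = t}}ᶜ :=
    (Measure.countable_meas_level_set_pos hu).dense_compl ℝ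
  have hgood : ∀ t ∈ {t : ℝ | 0 < μ {p | u p = t}}ᶜ, ∀ᵐ p ∂μ, u p ≠ t := fun t ht =>
    measure_eq_zero_iff_ae_notMem.1 (nonpos_iff_eq_zero.1 (not_lt.1 ht))
  obtain ⟨k₁, -, hk₁, hlim₁⟩ := hdense.exists_seq_strictAnti_tendsto k
  obtain ⟨k₂, -, hk₂, hlim₂⟩ := hdense.exists_seq_strictMono_tendsto k
  exact ⟨k₁, k₂,
    tendsto_nhdsWithin_iff.2 ⟨hlim₁, Eventually.of_forall fun n => (hk₁ n).1⟩,
    tendsto_nhdsWithin_iff.2 ⟨hlim₂, Eventually.of_forall fun n => (hk₂ n).1⟩,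
    fun n => ⟨hgood _ (hk₁ n).2, hgood _ (hk₂ n).2⟩⟩

lemma tendsto_sign_sub_add_sign_sub {ι : Type*} {𝓕 : Filter ι} {a : ℝ} {k₁ k₂ : ι → ℝ}
    (h₁ : Tendsto k₁ 𝓕 (𝓝[>] k)) (h₂ : Tendsto k₂ 𝓕 (𝓝[<] k)) :
    Tendsto (fun n => Real.sign (a - k₁ n) + Real.sign (a - k₂ n)) 𝓕
      (𝓝 (Real.sign (a - k) + Real.sign (a - k))) := by
  obtain ⟨hlim₁, hlt₁⟩ := tendsto_nhdsWithin_iff.1 h₁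
  obtain ⟨hlim₂, hlt₂⟩ := tendsto_nhdsWithin_iff.1 h₂
  rcases eq_or_ne a k with rfl | hak
  · refine tendsto_const_nhds.congr' ?_
    filter_upwards [hlt₁, hlt₂] with n hn₁ hn₂
    rw [Real.sign_of_neg (sub_neg.2 hn₁), Real.sign_of_pos (sub_pos.2 hn₂)]
    simp
  · exact (tendsto_sign (hlim₁.const_sub a) (sub_ne_zero.2 hak)).add
      (tendsto_sign (hlim₂.const_sub a) (sub_ne_zero.2 hak))

lemma tendsto_sign_sub_mul_sub {ι : Type*} {𝓕 : Filter ι} {g : ℝ → ℝ} (hg : Continuous g)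
    {a : ℝ} {k' : ι → ℝ} (hk' : Tendsto k' 𝓕 (𝓝 k)) :
    Tendsto (fun n => Real.sign (a - k' n) * (g a - g (k' n))) 𝓕
      (𝓝 (Real.sign (a - k) * (g a - g k))) := by
  refine tendsto_mul_of_abs_le (fun n => abs_sign_le_one _)
    (((hg.tendsto k).comp hk').const_sub _) fun h0 => ?_
  refine tendsto_sign (hk'.const_sub a) (sub_ne_zero.2 fun hak => h0 ?_)
  rw [hak, sub_self]

/-- Averaging over levels above and below `k` produces the convention `sgn 0 = 0` on `{u = k}`. -/
lemma tendsto_entropyIntegrand_add {ι : Type*} {𝓕 : Filter ι} (hlam : 0 < lam) (hlam2 : lam < 2)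
    (hr : 0 < r) (hf : Continuous f) (hA : Continuous A) (hφ : ContDiff ℝ 2 φ)
    (hφc : HasCompactSupport φ) {k₁ k₂ : ι → ℝ} (h₁ : Tendsto k₁ 𝓕 (𝓝[>] k))
    (h₂ : Tendsto k₂ 𝓕 (𝓝[<] k)) (p : SpaceTime d) :
    Tendsto (fun n => entropyIntegrand c lam f A (k₁ n) r u φ p
        + entropyIntegrand c lam f A (k₂ n) r u φ p) 𝓕
      (𝓝 (entropyIntegrand c lam f A k r u φ p + entropyIntegrand c lam f A k r u φ p)) := by
  simp only [entropyIntegrand_eq hlam hlam2 hr hφ hφc]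
  have hcontinuous : ∀ {k' : ι → ℝ}, Tendsto k' 𝓕 (𝓝 k) → Tendsto (fun n =>
      |u p - k' n| * fderiv ℝ φ p (0, 1)
        + ∑ l, Real.sign (u p - k' n) * (f (u p) l - f (k' n) l)
          * fderiv ℝ φ p (EuclideanSpace.single l 1, 0)
        + |A (u p) - A (k' n)| * innerOp c lam r φ p) 𝓕
      (𝓝 (|u p - k| * fderiv ℝ φ p (0, 1)
        + ∑ l, Real.sign (u p - k) * (f (u p) l - f k l)
          * fderiv ℝ φ p (EuclideanSpace.single l 1, 0)
        + |A (u p) - A k| * innerOp c lam r φ p)) := fun {k'} hk' =>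
    (((hk'.const_sub (u p)).abs.mul_const _).add (tendsto_finsetSum _ fun l _ =>
      (tendsto_sign_sub_mul_sub (g := fun a => f a l) (by fun_prop) hk').mul_const _)).add
      ((((hA.tendsto k).comp hk').const_sub _).abs.mul_const _)
  have hsign := ((tendsto_sign_sub_add_sign_sub (a := u p) h₁ h₂).mul_const
    (gOuter c lam r (fun y => A (u (y, p.2))) p.1)).mul_const (φ p)
  convert ((hcontinuous (tendsto_nhdsWithin_iff.1 h₁).1).add
    (hcontinuous (tendsto_nhdsWithin_iff.1 h₂).1)).add hsign using 2 <;> ring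

theorem entropy_inequality_of_forall_level_null (hlam : 0 < lam) (hlam2 : lam < 2) (hr : 0 < r)
    (hf : LipschitzWith Lf f) (hA : LipschitzWith LA A) (hu : Measurable u)
    (huM : ∀ p, |u p| ≤ M) (hφ : ContDiff ℝ 2 φ) (hφc : HasCompactSupport φ)
    {μ : Measure (SpaceTime d)} [SFinite μ] (hμ : μ ≤ volume)
    (H : ∀ k, (∀ᵐ p ∂μ, u p ≠ k) → 0 ≤ ∫ p, entropyIntegrand c lam f A k r u φ p ∂μ) (k : ℝ) :
    0 ≤ ∫ p, entropyIntegrand c lam f A k r u φ p ∂μ := by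
  obtain ⟨k₁, k₂, h₁, h₂, hnull⟩ := exists_seq_tendsto_forall_level_null (μ := μ) hu k
  obtain ⟨C, hC⟩ :=
    exists_abs_entropyIntegrand_le c (|k| + 1) hlam hlam2 hr hf hA huM hφ hφc
  have hint : ∀ k, Integrable (entropyIntegrand c lam f A k r u φ) μ := fun k =>
    (integrable_entropyIntegrand hlam hlam2 hr hf hA hu huM hφ hφc).mono_measure hμ
  have hbound := (integrable_indicator_cthickening hφc (2 * r) C).mono_measure hμ
  have hnear : ∀ᶠ t in 𝓝 k, |t| ≤ |k| + 1 :=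
    (continuous_abs.tendsto k).eventually_le_const (lt_add_one _)
  have hlim : Tendsto (fun n => ∫ p, (entropyIntegrand c lam f A (k₁ n) r u φ p
      + entropyIntegrand c lam f A (k₂ n) r u φ p) ∂μ) atTop (𝓝 (∫ p,
        (entropyIntegrand c lam f A k r u φ p + entropyIntegrand c lam f A k r u φ p) ∂μ)) := by
    refine tendsto_integral_filter_of_dominated_convergence _
      (Eventually.of_forall fun n => ((hint _).add (hint _)).aestronglyMeasurable) ?_
      (hbound.add hbound) (ae_of_all _ fun p => tendsto_entropyIntegrand_add hlam hlam2 hr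
        hf.continuous hA.continuous hφ hφc h₁ h₂ p)
    filter_upwards [(tendsto_nhdsWithin_iff.1 h₁).1 hnear, (tendsto_nhdsWithin_iff.1 h₂).1 hnear]
      with n hn₁ hn₂
    exact ae_of_all _ fun p => (norm_add_le _ _).trans (add_le_add (hC _ hn₁ p) (hC _ hn₂ p))
  have hnonneg := ge_of_tendsto' hlim fun n => by
    rw [integral_add (hint _) (hint _)]
    exact add_nonneg (H _ (hnull n).1) (H _ (hnull n).2)
  rw [integral_add (hint _) (hint _)] at hnonneg
  exact nonneg_add_self_iff.1 hnonneg

end AllLevels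

/-! ### Measurable representatives -/

section Representatives

variable {d : ℕ} {c lam r T k : ℝ} {f : ℝ → Space d} {A : ℝ → ℝ} {u w φ : SpaceTime d → ℝ}

lemma volume_restrict_cylinder : (volume : Measure (SpaceTime d)).restrict (cylinder d T) =
    (volume : Measure (Space d)).prod (volume.restrict (Ioo 0 T)) := by
  rw [cylinder, Measure.volume_eq_prod, ← Measure.prod_restrict, Measure.restrict_univ]

lemma ae_ae_slice_of_ae_cylinder {P : SpaceTime d → Prop}
    (h : ∀ᵐ p ∂(volume.restrict (cylinder d T)), P p) :
    ∀ᵐ t ∂(volume.restrict (Ioo 0 T)), ∀ᵐ x : Space d, P (x, t) := by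
  rw [volume_restrict_cylinder] at h
  exact Measure.ae_ae_of_ae_prod (Measure.measurePreserving_swap.quasiMeasurePreserving.ae h)

lemma exists_measurable_forall_abs_le_ae_eq {E : Type*} [MeasurableSpace E] {μ : Measure E}
    {u : E → ℝ} (hu : MemLp u ⊤ μ) :
    ∃ (w : E → ℝ) (M : ℝ), Measurable w ∧ (∀ p, |w p| ≤ M) ∧ w =ᵐ[μ] u := by
  have hM : 0 ≤ lpNorm u ⊤ μ := lpNorm_nonneg
  refine ⟨fun p => max (-lpNorm u ⊤ μ) (min (lpNorm u ⊤ μ) (hu.1.mk u p)), lpNorm u ⊤ μ,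
    measurable_const.max (measurable_const.min hu.1.stronglyMeasurable_mk.measurable),
    fun p => abs_le.2 ⟨le_max_left _ _, max_le (by linarith) (min_le_left _ _)⟩, ?_⟩
  filter_upwards [hu.1.ae_eq_mk, ae_le_lpNorm_exponent_top hu] with p hp hle
  obtain ⟨hlo, hhi⟩ := abs_le.1 hle
  rw [← hp, min_eq_right hhi, max_eq_right hlo]

lemma gOuter_congr_ae {g₁ g₂ : Space d → ℝ} (h : g₁ =ᵐ[volume] g₂) {x : Space d}
    (hx : g₁ x = g₂ x) : gOuter c lam r g₁ x = gOuter c lam r g₂ x := by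
  have htrans := (measurePreserving_add_left volume x).quasiMeasurePreserving.ae h
  unfold gOuter
  congr 1
  refine integral_congr_ae (ae_restrict_of_ae ?_)
  filter_upwards [htrans] with z hz
  rw [hz, hx]

lemma entropyIntegrand_congr_ae (h : w =ᵐ[volume.restrict (cylinder d T)] u) :
    entropyIntegrand c lam f A k r w φ =ᵐ[volume.restrict (cylinder d T)]
      entropyIntegrand c lam f A k r u φ := by
  have hslice : ∀ᵐ p ∂((volume : Measure (SpaceTime d)).restrict (cylinder d T)),
      ∀ᵐ x : Space d, w (x, p.2) = u (x, p.2) := by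
    rw [volume_restrict_cylinder]
    exact Measure.quasiMeasurePreserving_snd.ae (ae_ae_slice_of_ae_cylinder h)
  filter_upwards [h, hslice] with p hp hpslice
  have houter : gOuter c lam r (fun y => A (w (y, p.2))) p.1
      = gOuter c lam r (fun y => A (u (y, p.2))) p.1 :=
    gOuter_congr_ae (hpslice.mono fun x hx => congrArg A hx) (congrArg A hp)
  simp only [entropyIntegrand, hp, houter]

end Representatives

/-! ### The interpolated scheme -/

section Interpolation

variable {d : ℕ} {c lam h τ T M : ℝ} {N : ℕ} {LF LA : ℝ≥0} {f : ℝ → Space d} {A : ℝ → ℝ}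
  {F : Fin d → ℝ → ℝ → ℝ} {u₀ : Space d → ℝ} {U : ℕ → (Fin d → ℤ) → ℝ}

lemma measurableSet_centredCell (hh : 0 < h) (β : Fin d → ℤ) :
    MeasurableSet (centredCell h β) := by
  rw [show centredCell h β = gridIndex h ⁻¹' {β} from ext fun z => mem_centredCell_iff hh z β]
  exact measurable_gridIndex h (measurableSet_singleton β)

lemma gridRound_eq_zero_iff (hh : 0 < h) (z : Space d) :
    gridRound h z = 0 ↔ gridIndex h z = 0 := by
  simp only [PiLp.ext_iff, funext_iff, gridRound_apply, gridIndex, PiLp.zero_apply, Pi.zero_apply,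
    mul_eq_zero, hh.ne', false_or, Int.cast_eq_zero]

lemma tsum_weight_mul (hlam : 0 < lam) (hh : 0 < h) {b : (Fin d → ℤ) → ℝ} {B : ℝ}
    (hB : ∀ β, |b β| ≤ B) (hb : b 0 = 0) :
    ∑' β : {β : Fin d → ℤ // β ≠ 0}, weight c lam h β.1 * b β.1 =
      c * ∫ z, kernel d lam z * b (gridIndex h z) := by
  have hint : Integrable fun z : Space d => kernel d lam z * b (gridIndex h z) :=
    integrable_kernel_mul hlam hh
      ((measurable_of_countable b).comp (measurable_gridIndex h)).aestronglyMeasurable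
      (fun z => hB _) fun z hz => by rw [(gridRound_eq_zero_iff hh z).1 hz, hb]
  have hcover : ⋃ β, centredCell h β = (univ : Set (Space d)) :=
    eq_univ_of_forall fun z => mem_iUnion.2 ⟨gridIndex h z, (mem_centredCell_iff hh z _).2 rfl⟩
  have hdisjoint : Pairwise fun β γ : Fin d → ℤ => Disjoint (centredCell h β) (centredCell h γ) :=
    fun β γ hβγ => Set.disjoint_left.2 fun z hzβ hzγ => hβγ <| by
      rw [← (mem_centredCell_iff hh z _).1 hzβ, ← (mem_centredCell_iff hh z _).1 hzγ]
  have hcell : ∀ β, c * ∫ z in centredCell h β, kernel d lam z * b (gridIndex h z)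
      = weight c lam h β * b β := by
    intro β
    rw [weight, mul_assoc, ← integral_mul_const]
    congr 1
    refine setIntegral_congr_fun (measurableSet_centredCell hh β) fun z hz => ?_
    simp only [(mem_centredCell_iff hh z β).1 hz]
  have hsum := (hasSum_integral_iUnion (measurableSet_centredCell hh) hdisjoint
    hint.integrableOn).mul_left c
  rw [hcover, setIntegral_univ] at hsum
  simp only [hcell] at hsum
  rw [← hsum.tsum_eq]
  refine tsum_subtype_eq_of_support_subset (f := fun β => weight c lam h β * b β)
    (s := {β | β ≠ 0}) fun β hβ h0 => hβ ?_
  simp only [h0, hb, mul_zero]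

/-- The index of the cell containing `x`. -/
def cellIndex (h : ℝ) (x : Space d) : Fin d → ℤ := fun l => ⌊x l / h⌋

@[fun_prop]
lemma measurable_cellIndex (h : ℝ) : Measurable (cellIndex h : Space d → Fin d → ℤ) :=
  measurable_pi_lambda _ fun l =>
    Int.measurable_floor.comp (by fun_prop : Measurable fun z : Space d => z l / h)

lemma mem_cell_iff (hh : 0 < h) (x : Space d) (α : Fin d → ℤ) :
    x ∈ cell h α ↔ cellIndex h x = α := by
  simp only [cell, mem_ofPred_eq, cellIndex, funext_iff, Int.floor_eq_iff]
  refine forall_congr' fun l => ?_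
  rw [le_div_iff₀ hh, div_lt_iff₀ hh]
  constructor <;> rintro ⟨hlo, hhi⟩ <;> constructor <;> linarith

lemma measurableSet_cell (hh : 0 < h) (α : Fin d → ℤ) : MeasurableSet (cell h α) := by
  rw [show cell h α = cellIndex h ⁻¹' {α} from ext fun x => mem_cell_iff hh x α]
  exact measurable_cellIndex h (measurableSet_singleton α)

lemma volume_cell (hh : 0 < h) (α : Fin d → ℤ) : volume (cell h α) = ENNReal.ofReal (h ^ d) := by
  rw [← (EuclideanSpace.volume_preserving_symm_measurableEquiv_toLp (Fin d)).symm.measure_preimage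
    (measurableSet_cell hh α).nullMeasurableSet]
  have hbox : (MeasurableEquiv.toLp 2 (Fin d → ℝ)).symm.symm ⁻¹' cell h α =
      univ.pi fun l => Ico (h * α l) (h * α l + h) := by
    ext x; simp [cell]
  rw [hbox, Real.volume_pi_Ico]
  simp [ENNReal.ofReal_pow hh.le]

lemma cellIndex_add_gridPoint (hh : 0 < h) (x : Space d) (β : Fin d → ℤ) :
    cellIndex h (x + gridPoint h β) = cellIndex h x + β := by
  funext l
  rw [cellIndex, PiLp.add_apply, gridPoint_apply, add_div, mul_div_cancel_left₀ _ hh.ne',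
    Int.floor_add_intCast]
  rfl

lemma gridPoint_single (h : ℝ) (l : Fin d) :
    gridPoint h (Pi.single l 1) = EuclideanSpace.single l h := by
  ext j
  by_cases hj : j = l
  · subst hj; simp
  · simp [hj]

lemma gridPoint_neg (h : ℝ) (β : Fin d → ℤ) : (gridPoint h (-β) : Space d) = -gridPoint h β := by
  ext j; simp

lemma measurable_interp (h τ : ℝ) (U : ℕ → (Fin d → ℤ) → ℝ) : Measurable (interp h τ U) := by
  have hindex : Measurable fun p : SpaceTime d => (⌊p.2 / τ⌋₊, cellIndex h p.1) :=
    (Nat.measurable_floor.comp (by fun_prop)).prodMk (by fun_prop)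
  exact (measurable_of_countable fun q : ℕ × (Fin d → ℤ) => U q.1 q.2).comp hindex

lemma floor_div_lt {t : ℝ} (hτ : 0 < τ) (hT : 0 < T) (hN : N * τ = T) (ht : t < T) :
    ⌊t / τ⌋₊ < N := by
  have hN0 : N ≠ 0 := by rintro rfl; simp at hN; linarith
  rwa [Nat.floor_lt' hN0, div_lt_iff₀ hτ, hN]

lemma IsSchemeSolution.interp_add_time (hS : IsSchemeSolution c lam A F u₀ h τ N U)
    (hlam : 0 < lam) (hA : LipschitzWith LA A) (hh : 0 < h) (hτ : 0 < τ)
    (hU : ∀ n < N, ∀ α, |U n α| ≤ M) (x : Space d) {t : ℝ} (ht : 0 ≤ t) (htN : ⌊t / τ⌋₊ < N) :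
    interp h τ U (x, t + τ) = schemeStep c lam A F h τ univ (fun y => interp h τ U (y, t)) x := by
  set n := ⌊t / τ⌋₊
  set α := cellIndex h x
  have hvalue : ∀ y, interp h τ U (y, t) = U n (cellIndex h y) := fun _ => rfl
  have hnext : interp h τ U (x, t + τ) = U (n + 1) α := by
    have hfloor : ⌊(t + τ) / τ⌋₊ = n + 1 := by
      rw [add_div, div_self hτ.ne', Nat.floor_add_one (by positivity)]
    rw [interp, hfloor]; rfl
  have hright : ∀ l, cellIndex h (x + EuclideanSpace.single l h) = α + Pi.single l 1 := fun l => by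
    rw [← gridPoint_single, cellIndex_add_gridPoint hh]
  have hleft : ∀ l, cellIndex h (x - EuclideanSpace.single l h) = α - Pi.single l 1 := fun l => by
    rw [sub_eq_add_neg, ← gridPoint_single, ← gridPoint_neg, cellIndex_add_gridPoint hh,
      ← sub_eq_add_neg]
  have hround : ∀ z, cellIndex h (x + gridRound h z) = α + gridIndex h z := fun z =>
    cellIndex_add_gridPoint hh x _
  have hAU : ∀ γ, |A (U n γ)| ≤ |A 0| + LA * M := fun γ => abs_le_of_lipschitzWith hA (hU n htN γ)
  have hquad := tsum_weight_mul (c := c) hlam hh (b := fun β => A (U n (α + β)) - A (U n α))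
    (fun β => (abs_sub _ _).trans (add_le_add (hAU _) (hAU _))) (by simp)
  rw [hnext, hS.step n htN α, hquad]
  simp only [schemeStep, fluxDiff, quadOn, setIntegral_univ, hvalue, hright, hleft, hround, α]

/-- The interpolation of the scheme, set to `0` from the time `T` on, where `U` need neither solve
the scheme nor be bounded. -/
def cutInterp (h τ T : ℝ) (U : ℕ → (Fin d → ℤ) → ℝ) (p : SpaceTime d) : ℝ :=
  if p.2 < T then interp h τ U p else 0

lemma cutInterp_of_lt {x : Space d} {t : ℝ} (ht : t < T) :
    cutInterp h τ T U (x, t) = interp h τ U (x, t) := if_pos ht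

lemma measurable_cutInterp (h τ T : ℝ) (U : ℕ → (Fin d → ℤ) → ℝ) :
    Measurable (cutInterp h τ T U) :=
  Measurable.ite (measurableSet_lt measurable_snd measurable_const) (measurable_interp h τ U)
    measurable_const

lemma abs_cutInterp_le (hτ : 0 < τ) (hT : 0 < T) (hN : N * τ = T)
    (hU : ∀ n < N, ∀ α, |U n α| ≤ M) (p : SpaceTime d) : |cutInterp h τ T U p| ≤ M := by
  unfold cutInterp
  split_ifs with hp
  · exact hU _ (floor_div_lt hτ hT hN hp) _
  · exact abs_zero.trans_le ((abs_nonneg _).trans (hU _ (floor_div_lt hτ hT hN hT) 0))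

lemma IsSchemeSolution.isSchemeFun (hS : IsSchemeSolution c lam A F u₀ h τ N U)
    (hlam : 0 < lam) (hA : LipschitzWith LA A) (hh : 0 < h) (hτ : 0 < τ) (hT : 0 < T)
    (hN : N * τ = T) (hU : ∀ n < N, ∀ α, |U n α| ≤ M) :
    IsSchemeFun c lam A F h τ T M (cutInterp h τ T U) where
  measurable := measurable_cutInterp h τ T U
  bound := abs_cutInterp_le hτ hT hN hU
  step x t ht htT := by
    have htT' : t < T := by linarith
    simp only [cutInterp_of_lt htT, cutInterp_of_lt htT']
    exact hS.interp_add_time hlam hA hh hτ hU x ht (floor_div_lt hτ hT hN htT')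

lemma sub_eq_zero_of_lipschitzWith_zero (hA : LipschitzWith 0 A) (a b : ℝ) : A a - A b = 0 := by
  simpa [sub_eq_zero] using hA.dist_le_mul a b

lemma IsNumericalFlux.sub_eq_zero {f : ℝ → ℝ} {F : ℝ → ℝ → ℝ} (hF : IsNumericalFlux 0 f F)
    (a b a' b' : ℝ) : F a b - F a' b' = 0 :=
  abs_nonpos_iff.1 (by simpa using hF.lipschitz a b a' b')

lemma IsSchemeSolution.eq_init_of_lipschitz_zero (hS : IsSchemeSolution c lam A F u₀ h τ N U)
    (hA : LipschitzWith 0 A) (hF : ∀ l, IsNumericalFlux 0 (fun v => f v l) (F l)) :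
    ∀ n ≤ N, U n = U 0
  | 0, _ => rfl
  | n + 1, hn => by
    rw [← hS.eq_init_of_lipschitz_zero hA hF n (by omega)]
    funext α
    rw [hS.step n hn α]
    simp [sub_eq_zero_of_lipschitzWith_zero hA, fun l => (hF l).sub_eq_zero]

lemma IsSchemeSolution.isSchemeFun_of_lipschitz_zero
    (hS : IsSchemeSolution c lam A F u₀ h τ N U) (hA : LipschitzWith 0 A)
    (hF : ∀ l, IsNumericalFlux 0 (fun v => f v l) (F l)) (hτ : 0 < τ) (hT : 0 < T)
    (hN : N * τ = T) (hU : ∀ n < N, ∀ α, |U n α| ≤ M) {τ' : ℝ} (hτ' : 0 ≤ τ') :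
    IsSchemeFun c lam A F h τ' T M (cutInterp h τ T U) where
  measurable := measurable_cutInterp h τ T U
  bound := abs_cutInterp_le hτ hT hN hU
  step x t _ htT := by
    have hinit : ∀ s < T, cutInterp h τ T U (x, s) = U 0 (cellIndex h x) := fun s hs => by
      rw [cutInterp_of_lt hs, interp,
        hS.eq_init_of_lipschitz_zero hA hF _ (floor_div_lt hτ hT hN hs).le]
      rfl
    rw [schemeStep, hinit _ htT, hinit t (by linarith)]
    simp [fluxDiff, quadOn, sub_eq_zero_of_lipschitzWith_zero hA, fun l => (hF l).sub_eq_zero]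

end Interpolation

/-! ### Convergence of the interpolated scheme -/

section SchemeConvergence

variable {d : ℕ} {c lam T M : ℝ} {LF LA : ℝ≥0}

lemma abs_le_of_ae_interp_le {h τ : ℝ} {N : ℕ} {U : ℕ → (Fin d → ℤ) → ℝ} (hh : 0 < h)
    (hτ : 0 < τ) (hN : N * τ = T)
    (hM : ∀ᵐ p ∂(volume.restrict (cylinder d T)), |interp h τ U p| ≤ M) {n : ℕ} (hn : n < N)
    (α : Fin d → ℤ) : |U n α| ≤ M := by
  set box : Set (SpaceTime d) := cell h α ×ˢ Ioo ((n : ℝ) * τ) ((n + 1) * τ)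
  have hsub : box ⊆ cylinder d T := by
    refine prod_mono (subset_univ _) (Ioo_subset_Ioo (by positivity) ?_)
    rw [← hN]
    exact mul_le_mul_of_nonneg_right (by exact_mod_cast hn) hτ.le
  have hpos : volume box ≠ 0 := by
    rw [Measure.volume_eq_prod, Measure.prod_prod, volume_cell hh, Real.volume_Ioo]
    have hcell : 0 < h ^ d := by positivity
    exact mul_ne_zero (by simpa using hcell) (by simpa using by linarith)
  have hmeas : MeasurableSet box := (measurableSet_cell hh α).prod measurableSet_Ioo
  have : (ae (volume.restrict box)).NeBot := by
    rwa [ae_neBot, ne_eq, Measure.restrict_eq_zero]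
  obtain ⟨p, hp, hpmem⟩ :=
    ((ae_restrict_of_ae_restrict_of_subset hsub hM).and (ae_restrict_mem hmeas)).exists
  rwa [← Prod.mk.eta (p := p), interp_eq hh hτ U hpmem.1 (Ioo_subset_Ico_self hpmem.2)] at hp

lemma tendsto_lintegral_enorm_sub_of_iSup {v : ℕ → SpaceTime d → ℝ} {u : SpaceTime d → ℝ}
    {S : Set ℝ} (hconv : Tendsto (fun m => ⨆ t ∈ S,
      eLpNorm (fun x : Space d => v m (x, t) - u (x, t)) 1 volume) atTop (𝓝 0))
    {s : ℕ → ℝ} (hs : ∀ᶠ m in atTop, s m ∈ S) :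
    Tendsto (fun m => ∫⁻ x, ‖v m (x, s m) - u (x, s m)‖ₑ) atTop (𝓝 0) := by
  refine tendsto_of_tendsto_of_tendsto_of_le_of_le' tendsto_const_nhds hconv
    (Eventually.of_forall fun _ => zero_le) ?_
  filter_upwards [hs] with m hm
  rw [← eLpNorm_one_eq_lintegral_enorm]
  exact le_iSup₂ (f := fun t (_ : t ∈ S) =>
    eLpNorm (fun x : Space d => v m (x, t) - u (x, t)) 1 volume) (s m) hm

lemma IsBoundedContL1.tendsto_lintegral_enorm_sub_shift {v : ℕ → SpaceTime d → ℝ}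
    {u : SpaceTime d → ℝ} (hu : IsBoundedContL1 T u) (hv : ∀ m, Measurable (v m))
    (hconv : Tendsto (fun m => ⨆ t ∈ Ioo (0 : ℝ) T,
      eLpNorm (fun x : Space d => v m (x, t) - u (x, t)) 1 volume) atTop (𝓝 0))
    {τ : ℕ → ℝ} (hτ : Tendsto τ atTop (𝓝 0)) {t : ℝ} (ht : t ∈ Ioo 0 T) :
    Tendsto (fun m => ∫⁻ x, ‖v m (x, t + τ m) - u (x, t)‖ₑ) atTop (𝓝 0) := by
  have hlim : Tendsto (fun m => t + τ m) atTop (𝓝 t) := by simpa using hτ.const_add t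
  have hmem : ∀ᶠ m in atTop, t + τ m ∈ Ioo 0 T := hlim.eventually (Ioo_mem_nhds ht.1 ht.2)
  have hwithin : Tendsto (fun m => t + τ m) atTop (𝓝[Icc 0 T] t) :=
    tendsto_nhdsWithin_iff.2 ⟨hlim, hmem.mono fun _ hm => Ioo_subset_Icc_self hm⟩
  have hsum := (tendsto_lintegral_enorm_sub_of_iSup hconv hmem).add
    ((hu.continuous t (Ioo_subset_Icc_self ht)).comp hwithin)
  rw [add_zero] at hsum
  refine tendsto_of_tendsto_of_tendsto_of_le_of_le' tendsto_const_nhds hsum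
    (Eventually.of_forall fun _ => zero_le) ?_
  filter_upwards [hmem] with m hm
  have hmeas : AEMeasurable fun x => ‖v m (x, t + τ m) - u (x, t + τ m)‖ₑ :=
    (((hv m).comp measurable_prodMk_right).aemeasurable.sub
      (hu.integrable _ (Ioo_subset_Icc_self hm)).1.aemeasurable).enorm
  rw [Function.comp_apply, eLpNorm_one_eq_lintegral_enorm, ← lintegral_add_left' hmeas]
  refine lintegral_mono fun x => le_of_eq_of_le ?_ (enorm_add_le _ _)
  rw [sub_add_sub_cancel]

lemma IsBoundedContL1.convergesSlicewise {v : ℕ → SpaceTime d → ℝ} {u w : SpaceTime d → ℝ}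
    (hu : IsBoundedContL1 T u) (hw : w =ᵐ[volume.restrict (cylinder d T)] u)
    (hv : ∀ m, Measurable (v m))
    (hconv : Tendsto (fun m => ⨆ t ∈ Ioo (0 : ℝ) T,
      eLpNorm (fun x : Space d => v m (x, t) - u (x, t)) 1 volume) atTop (𝓝 0))
    {τ : ℕ → ℝ} (hτ : Tendsto τ atTop (𝓝 0)) : ConvergesSlicewise T τ v w := by
  have hslice := ae_ae_slice_of_ae_cylinder hw
  have hreplace : ∀ {t : ℝ}, (∀ᵐ x : Space d, w (x, t) = u (x, t)) → ∀ s m,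
      ∫⁻ x, ‖v m (x, s) - w (x, t)‖ₑ = ∫⁻ x, ‖v m (x, s) - u (x, t)‖ₑ := fun ht s m =>
    lintegral_congr_ae (ht.mono fun x hx => by simp only [hx])
  constructor
  · filter_upwards [hslice, ae_restrict_mem measurableSet_Ioo] with t ht htT
    exact (hu.integrable t (Ioo_subset_Icc_self htT)).congr (ht.mono fun x hx => hx.symm)
  · filter_upwards [hslice, ae_restrict_mem measurableSet_Ioo] with t ht htT
    simp only [hreplace ht]
    exact tendsto_lintegral_enorm_sub_of_iSup hconv (Eventually.of_forall fun _ => htT)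
  · filter_upwards [hslice, ae_restrict_mem measurableSet_Ioo] with t ht htT
    simp only [hreplace ht]
    exact hu.tendsto_lintegral_enorm_sub_shift hv hconv hτ htT

lemma tendsto_iSup_cutInterp_sub {h τ : ℕ → ℝ} {U : ℕ → ℕ → (Fin d → ℤ) → ℝ}
    {u : SpaceTime d → ℝ} (hconv : Tendsto (fun m => ⨆ t ∈ Icc (0 : ℝ) T,
      eLpNorm (fun x : Space d => interp (h m) (τ m) (U m) (x, t) - u (x, t)) 1 volume)
      atTop (𝓝 0)) :
    Tendsto (fun m => ⨆ t ∈ Ioo (0 : ℝ) T,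
      eLpNorm (fun x : Space d => cutInterp (h m) (τ m) T (U m) (x, t) - u (x, t)) 1 volume)
      atTop (𝓝 0) := by
  refine tendsto_of_tendsto_of_tendsto_of_le_of_le tendsto_const_nhds hconv (fun _ => zero_le)
    fun m => iSup₂_mono' fun t ht => ⟨t, Ioo_subset_Icc_self ht, ?_⟩
  simp only [cutInterp_of_lt ht.2, le_refl]

lemma CFL.timeStep_le_of_flux [NeZero d] {h τ : ℝ} (hc : 0 ≤ c) (hh : 0 < h) (hτ : 0 ≤ τ)
    (hcfl : CFL d c lam LF LA h τ) (hLF : LF ≠ 0) : τ ≤ h / (2 * d * LF) := by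
  have hd : (0 : ℝ) < d := by exact_mod_cast Nat.pos_of_neZero d
  have : (0 : ℝ) < LF := by positivity
  have hI : 0 ≤ ∫ z in {z : Space d | 1 < ‖z‖}, kernel d lam z :=
    integral_nonneg fun _ => kernel_nonneg _
  have hquad : 0 ≤ (c * 2 ^ lam * LA * ∫ z in {z : Space d | 1 < ‖z‖}, kernel d lam z)
      * (τ / h ^ lam) := by positivity
  have hflux : 2 * d * LF * (τ / h) ≤ 1 := by unfold CFL at hcfl; linarith
  rw [le_div_iff₀ (by positivity)]
  rw [← mul_div_assoc, div_le_one hh] at hflux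
  linarith

lemma CFL.timeStep_le_of_diffusion [NeZero d] {h τ : ℝ} (hc : 0 < c) (hlam : 0 < lam) (hh : 0 < h)
    (hτ : 0 ≤ τ) (hcfl : CFL d c lam LF LA h τ) (hLA : LA ≠ 0) :
    τ ≤ h ^ lam / (c * 2 ^ lam * LA * ∫ z in {z : Space d | 1 < ‖z‖}, kernel d lam z) := by
  have : (0 : ℝ) < LA := by positivity
  have hI := setIntegral_kernel_pos (d := d) hlam
  have hflux : 0 ≤ 2 * d * LF * (τ / h) := by positivity
  have hquad : (c * 2 ^ lam * LA * ∫ z in {z : Space d | 1 < ‖z‖}, kernel d lam z)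
      * (τ / h ^ lam) ≤ 1 := by unfold CFL at hcfl; linarith
  rw [le_div_iff₀ (by positivity)]
  rw [← mul_div_assoc, div_le_one (Real.rpow_pos_of_pos hh lam)] at hquad
  linarith

lemma tendsto_timeStep [NeZero d] (hc : 0 < c) (hlam : 0 < lam) {h τ : ℕ → ℝ}
    (hh : ∀ m, 0 < h m) (hh0 : Tendsto h atTop (𝓝 0)) (hτ : ∀ m, 0 ≤ τ m)
    (hcfl : ∀ m, CFL d c lam LF LA (h m) (τ m)) (hL : LF ≠ 0 ∨ LA ≠ 0) :
    Tendsto τ atTop (𝓝 0) := by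
  rcases hL with hLF | hLA
  · exact squeeze_zero hτ (fun m => (hcfl m).timeStep_le_of_flux hc.le (hh m) (hτ m) hLF)
      (by simpa using hh0.div_const (2 * d * LF : ℝ))
  · have hpow : Tendsto (fun m => h m ^ lam) atTop (𝓝 0) := by
      simpa [Real.zero_rpow hlam.ne'] using hh0.rpow_const (p := lam) (Or.inr hlam.le)
    exact squeeze_zero hτ (fun m => (hcfl m).timeStep_le_of_diffusion hc hlam (hh m) (hτ m) hLA)
      (by simpa only [zero_div] using hpow.div_const _)

/-- When `LF = LA = 0` the CFL condition does not force the time steps to tend to `0`, but then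
the scheme is stationary, so that its interpolation solves it with any other time steps. -/
lemma exists_timeStep_isSchemeFun [NeZero d] (hc : 0 < c) (hlam : 0 < lam) (hT : 0 < T)
    {f : ℝ → Space d} {A : ℝ → ℝ} (hA : LipschitzWith LA A) {F : ℕ → Fin d → ℝ → ℝ → ℝ}
    (hF : ∀ m l, IsNumericalFlux LF (fun v => f v l) (F m l)) {u₀ : Space d → ℝ}
    {h τ : ℕ → ℝ} {N : ℕ → ℕ} (hh : ∀ m, 0 < h m) (hh0 : Tendsto h atTop (𝓝 0))
    (hτ : ∀ m, 0 < τ m) (hN : ∀ m, N m * τ m = T) (hcfl : ∀ m, CFL d c lam LF LA (h m) (τ m))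
    {U : ℕ → ℕ → (Fin d → ℤ) → ℝ}
    (hS : ∀ m, IsSchemeSolution c lam A (F m) u₀ (h m) (τ m) (N m) (U m))
    (hU : ∀ m, ∀ n < N m, ∀ α, |U m n α| ≤ M) :
    ∃ σ : ℕ → ℝ, Tendsto σ atTop (𝓝[>] 0) ∧ (∀ m, CFL d c lam LF LA (h m) (σ m)) ∧
      ∀ m, IsSchemeFun c lam A (F m) (h m) (σ m) T M (cutInterp (h m) (τ m) T (U m)) := by
  by_cases hL : LF ≠ 0 ∨ LA ≠ 0
  · have hτ0 : Tendsto τ atTop (𝓝 0) :=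
      tendsto_timeStep hc hlam hh hh0 (fun m => (hτ m).le) hcfl hL
    exact ⟨τ, tendsto_nhdsWithin_iff.2 ⟨hτ0, Eventually.of_forall hτ⟩, hcfl,
      fun m => (hS m).isSchemeFun hlam hA (hh m) (hτ m) hT (hN m) (hU m)⟩
  · obtain ⟨rfl, rfl⟩ : LF = 0 ∧ LA = 0 := by simpa [not_or] using hL
    exact ⟨fun m => 1 / ((m : ℝ) + 1),
      tendsto_nhdsWithin_iff.2 ⟨tendsto_one_div_add_atTop_nhds_zero_nat,
        Eventually.of_forall fun m => mem_Ioi.2 (by positivity)⟩, fun m => by simp [CFL],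
      fun m => (hS m).isSchemeFun_of_lipschitz_zero hA (hF m) (hτ m) hT (hN m) (hU m)
        (by positivity)⟩

end SchemeConvergence

/-! ### The initial datum -/

section InitialDatum

variable {d : ℕ} {h T : ℝ} {f g ψ : Space d → ℝ}

/-- The average of `g` over the cell with index `α`. -/
def cellAverage (h : ℝ) (g : Space d → ℝ) (α : Fin d → ℤ) : ℝ :=
  1 / h ^ d * ∫ x in cell h α, g x

lemma norm_sub_le_of_cellIndex_eq (hh : 0 < h) {x y : Space d}
    (hxy : cellIndex h x = cellIndex h y) : ‖x - y‖ ≤ d * h := by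
  have hx := (mem_cell_iff hh x _).2 hxy
  have hy := (mem_cell_iff hh y _).2 rfl
  have hcoord : ∀ l, |x l - y l| ≤ h := fun l =>
    abs_le.2 ⟨by linarith [(hx l).1, (hy l).2], by linarith [(hx l).2, (hy l).1]⟩
  calc ‖x - y‖ = √(∑ l, (x l - y l) ^ 2) := by
        simp only [EuclideanSpace.norm_eq, PiLp.sub_apply, Real.norm_eq_abs, sq_abs]
    _ ≤ ∑ l, |x l - y l| := by
        refine Real.sqrt_le_iff.2 ⟨Finset.sum_nonneg fun l _ => abs_nonneg _, ?_⟩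
        simpa only [sq_abs] using Finset.sum_sq_le_sq_sum_of_nonneg
          (s := Finset.univ) (f := fun l => |x l - y l|) fun l _ => abs_nonneg _
    _ ≤ d * h := by simpa using Finset.sum_le_card_nsmul Finset.univ _ h fun l _ => hcoord l

lemma cellAverage_congr (hh : 0 < h) {α : Fin d → ℤ} (hfg : ∀ x ∈ cell h α, f x = g x) :
    cellAverage h f α = cellAverage h g α :=
  congrArg _ (setIntegral_congr_fun (measurableSet_cell hh α) hfg)

lemma integrable_and_integral_mul_cellAverage (hh : 0 < h) (hf : Integrable f) (hg : Integrable g) :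
    Integrable (fun y => cellAverage h f (cellIndex h y) * g y) ∧
      ∫ x, f x * cellAverage h g (cellIndex h x) =
        ∫ y, cellAverage h f (cellIndex h y) * g y := by
  set diag : Set (Space d × Space d) := {q | cellIndex h q.1 = cellIndex h q.2}
  have hdiag : MeasurableSet diag :=
    measurableSet_eq_fun ((measurable_cellIndex h).comp measurable_fst)
      ((measurable_cellIndex h).comp measurable_snd)
  set G : Space d × Space d → ℝ := diag.indicator fun q => 1 / h ^ d * (f q.1 * g q.2)
  have hG : Integrable G (volume.prod volume) :=
    ((hf.mul_prod hg).const_mul (1 / h ^ d)).indicator hdiag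
  have hfst : ∀ x, ∫ y, G (x, y) = f x * cellAverage h g (cellIndex h x) := by
    intro x
    have : (fun y => G (x, y)) =
        (cell h (cellIndex h x)).indicator fun y => 1 / h ^ d * f x * g y := by
      funext y
      simp only [G, diag, indicator, mem_ofPred_eq, mem_cell_iff hh, eq_comm, mul_assoc]
    rw [this, integral_indicator (measurableSet_cell hh _), integral_const_mul, cellAverage]
    ring
  have hsnd : ∀ y, ∫ x, G (x, y) = cellAverage h f (cellIndex h y) * g y := by
    intro y
    have : (fun x => G (x, y)) =
        (cell h (cellIndex h y)).indicator fun x => g y * (1 / h ^ d) * f x := by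
      funext x
      simp only [G, diag, indicator, mem_ofPred_eq, mem_cell_iff hh]
      split_ifs <;> ring
    rw [this, integral_indicator (measurableSet_cell hh _), integral_const_mul, cellAverage]
    ring
  refine ⟨by simpa only [hsnd] using hG.integral_prod_right, ?_⟩
  simpa only [hfst, hsnd] using integral_integral_swap (f := fun x y => G (x, y)) hG

lemma abs_cellAverage_sub_le (hh : 0 < h) {L : ℝ≥0} (hψ : LipschitzWith L ψ) (y : Space d) :
    |cellAverage h ψ (cellIndex h y) - ψ y| ≤ L * (d * h) := by
  set C := cell h (cellIndex h y)
  have hvol : volume.real C = h ^ d := by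
    rw [Measure.real, volume_cell hh, ENNReal.toReal_ofReal (by positivity)]
  have hfin : volume C < ⊤ := by simp [C, volume_cell hh]
  have hpos : 0 < h ^ d := by positivity
  have hosc : ∀ x ∈ C, ‖ψ x - ψ y‖ ≤ L * (d * h) := fun x hx =>
    (hψ.norm_sub_le x y).trans (mul_le_mul_of_nonneg_left
      (norm_sub_le_of_cellIndex_eq hh ((mem_cell_iff hh x _).1 hx)) L.2)
  have hint : IntegrableOn (fun x => ψ x - ψ y) C :=
    Measure.integrableOn_of_bounded hfin.ne
      (hψ.continuous.sub continuous_const).aestronglyMeasurable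
      ((ae_restrict_mem (measurableSet_cell hh _)).mono hosc)
  have hψC : IntegrableOn ψ C := by
    simpa [Pi.add_def] using hint.add (integrableOn_const hfin.ne (C := ψ y))
  have hsub : cellAverage h ψ (cellIndex h y) - ψ y = 1 / h ^ d * ∫ x in C, (ψ x - ψ y) := by
    change 1 / h ^ d * (∫ x in C, ψ x) - ψ y = _
    rw [integral_sub hψC (integrableOn_const hfin.ne), setIntegral_const, hvol, smul_eq_mul]
    field_simp
  have hle := norm_setIntegral_le_of_norm_le_const hfin hosc
  rw [hvol, Real.norm_eq_abs] at hle
  rwa [hsub, abs_mul, abs_of_pos (by positivity), one_div_mul_eq_div, div_le_iff₀ hpos]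

lemma abs_integral_mul_cellAverage_sub_le_of_integrable (hh : 0 < h) (hg : Integrable g)
    {L : ℝ≥0} (hL : LipschitzWith L ψ) (hψ : HasCompactSupport ψ) :
    |(∫ x, ψ x * cellAverage h g (cellIndex h x)) - ∫ x, ψ x * g x| ≤
      (∫ x, |g x|) * (L * (d * h)) := by
  obtain ⟨B, hB⟩ := hψ.exists_bound_of_continuous hL.continuous
  obtain ⟨hint, hswap⟩ :=
    integrable_and_integral_mul_cellAverage hh (hL.continuous.integrable_of_hasCompactSupport hψ) hg
  have hψg : Integrable fun x => ψ x * g x :=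
    hg.bdd_mul hL.continuous.aestronglyMeasurable (ae_of_all _ hB)
  rw [hswap, ← integral_sub hint hψg, ← Real.norm_eq_abs, ← integral_mul_const]
  refine norm_integral_le_of_norm_le (hg.abs.mul_const _) (ae_of_all _ fun y => ?_)
  rw [← sub_mul, norm_mul, mul_comm, Real.norm_eq_abs, Real.norm_eq_abs]
  exact mul_le_mul_of_nonneg_left (abs_cellAverage_sub_le hh hL y) (abs_nonneg _)

lemma abs_integral_mul_cellAverage_sub_le (hh : 0 < h) (hh1 : h ≤ 1) (hg : LocallyIntegrable g)
    {L : ℝ≥0} (hL : LipschitzWith L ψ) (hψ : HasCompactSupport ψ) :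
    |(∫ x, ψ x * cellAverage h g (cellIndex h x)) - ∫ x, ψ x * g x| ≤
      (∫ x in Metric.cthickening d (tsupport ψ), |g x|) * (L * (d * h)) := by
  set K := Metric.cthickening (d : ℝ) (tsupport ψ)
  have hK : IsCompact K := hψ.isCompact.cthickening
  have hmemK : ∀ x y, ψ x ≠ 0 → cellIndex h y = cellIndex h x → y ∈ K := fun x y hx hyx => by
    refine Metric.mem_cthickening_of_dist_le y x _ _ (subset_tsupport ψ hx) ?_
    rw [dist_eq_norm]
    exact (norm_sub_le_of_cellIndex_eq hh hyx).trans
      (mul_le_of_le_one_right (Nat.cast_nonneg d) hh1)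
  have haverage : ∀ x, ψ x * cellAverage h g (cellIndex h x) =
      ψ x * cellAverage h (K.indicator g) (cellIndex h x) := by
    intro x
    by_cases hx : ψ x = 0
    · rw [hx, zero_mul, zero_mul]
    · rw [cellAverage_congr hh fun y hy => (indicator_of_mem
        (hmemK x y hx ((mem_cell_iff hh y _).1 hy)) g).symm]
  have hvalue : ∀ x, ψ x * g x = ψ x * K.indicator g x := by
    intro x
    by_cases hx : ψ x = 0
    · rw [hx, zero_mul, zero_mul]
    · rw [indicator_of_mem (hmemK x x hx rfl)]
  have hbound := abs_integral_mul_cellAverage_sub_le_of_integrable hh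
    ((integrable_indicator_iff hK.measurableSet).2 (hg.integrableOn_isCompact hK)) hL hψ
  simpa only [haverage, hvalue, ← Real.norm_eq_abs, norm_indicator_eq_indicator_norm,
    integral_indicator hK.measurableSet] using hbound

lemma tendsto_integral_mul_of_tendsto_lintegral_enorm_sub {E : Type*} [MeasurableSpace E]
    {μ : Measure E} {ψ w : E → ℝ} {v : ℕ → E → ℝ} {B : ℝ} (hψ : AEStronglyMeasurable ψ μ)
    (hB : ∀ x, ‖ψ x‖ ≤ B) (hv : ∀ m, AEStronglyMeasurable (v m) μ) (hw : Integrable w μ)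
    (hconv : Tendsto (fun m => ∫⁻ x, ‖v m x - w x‖ₑ ∂μ) atTop (𝓝 0)) :
    Tendsto (fun m => ∫ x, ψ x * v m x ∂μ) atTop (𝓝 (∫ x, ψ x * w x ∂μ)) := by
  have hmul : ∀ {g : E → ℝ}, Integrable g μ → Integrable (fun x => ψ x * g x) μ := fun hg =>
    hg.bdd_mul hψ (ae_of_all _ hB)
  have hvint : ∀ᶠ m in atTop, Integrable (v m) μ := by
    filter_upwards [hconv.eventually_lt_const ENNReal.zero_lt_top] with m hm
    have hdiff : Integrable (fun x => v m x - w x) μ := ⟨(hv m).sub hw.1, hm⟩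
    simpa [Pi.add_def] using hdiff.add hw
  refine tendsto_integral_of_L1 _ (hmul hw).1 (hvint.mono fun m hm => hmul hm) ?_
  have hlim := ENNReal.Tendsto.const_mul (a := ENNReal.ofReal B) hconv
    (Or.inr ENNReal.ofReal_ne_top)
  rw [mul_zero] at hlim
  refine tendsto_of_tendsto_of_tendsto_of_le_of_le tendsto_const_nhds hlim (fun _ => zero_le)
    fun m => ?_
  rw [← lintegral_const_mul' _ _ ENNReal.ofReal_ne_top]
  refine lintegral_mono fun x => ?_
  rw [← mul_sub, enorm_mul, ← ofReal_norm]
  gcongr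
  exact hB x

theorem initial_ae_eq (hT : 0 ≤ T) {u₀ : Space d → ℝ} (hu₀ : LocallyIntegrable u₀)
    {h τ : ℕ → ℝ} (hh : ∀ m, 0 < h m) (hh0 : Tendsto h atTop (𝓝 0))
    {U : ℕ → ℕ → (Fin d → ℤ) → ℝ} (hU : ∀ m α, U m 0 α = cellAverage (h m) u₀ α)
    {u : SpaceTime d → ℝ} (hu : IsBoundedContL1 T u)
    (hconv : Tendsto (fun m => ⨆ t ∈ Icc (0 : ℝ) T,
      eLpNorm (fun x : Space d => interp (h m) (τ m) (U m) (x, t) - u (x, t)) 1 volume)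
      atTop (𝓝 0)) :
    (fun x => u (x, 0)) =ᵐ[volume] u₀ := by
  have h0T : (0 : ℝ) ∈ Icc 0 T := ⟨le_rfl, hT⟩
  refine ae_eq_of_integral_contDiff_smul_eq (hu.integrable 0 h0T).locallyIntegrable hu₀
    fun ψ hψ hψc => ?_
  simp only [smul_eq_mul]
  obtain ⟨L, hL⟩ := ContDiff.lipschitzWith_of_hasCompactSupport hψc hψ (by simp)
  obtain ⟨B, hB⟩ := hψc.exists_bound_of_continuous hψ.continuous
  have hinterp : ∀ m x, interp (h m) (τ m) (U m) (x, 0) =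
      cellAverage (h m) u₀ (cellIndex (h m) x) := fun m x => by
    rw [← hU, interp, zero_div, Nat.floor_zero]; rfl
  have htou := tendsto_integral_mul_of_tendsto_lintegral_enorm_sub
    hψ.continuous.aestronglyMeasurable hB
    (fun m => ((measurable_interp (h m) (τ m) (U m)).comp
      measurable_prodMk_right).aestronglyMeasurable)
    (hu.integrable 0 h0T)
    (tendsto_lintegral_enorm_sub_of_iSup hconv (Eventually.of_forall fun _ => h0T))
  simp only [Function.comp_apply, hinterp] at htou
  have htou₀ : Tendsto (fun m => ∫ x, ψ x * cellAverage (h m) u₀ (cellIndex (h m) x)) atTop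
      (𝓝 (∫ x, ψ x * u₀ x)) := by
    rw [tendsto_iff_norm_sub_tendsto_zero]
    refine squeeze_zero' (Eventually.of_forall fun _ => norm_nonneg _)
      (g := fun m => (∫ x in Metric.cthickening d (tsupport ψ), |u₀ x|) * (L * (d * h m))) ?_ ?_
    · filter_upwards [hh0.eventually_le_const one_pos] with m hm
      exact abs_integral_mul_cellAverage_sub_le (hh m) hm hu₀ hL hψc
    · simpa using ((hh0.const_mul (d : ℝ)).const_mul (L : ℝ)).const_mul
        (∫ x in Metric.cthickening d (tsupport ψ), |u₀ x|)
  exact tendsto_nhds_unique htou htou₀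

end InitialDatum

end FracConvDiff

end

open FracConvDiff in
theorem mainTheorem3
    (d : ℕ) (hd : 1 ≤ d)
    (c lam T : ℝ) (hc : 0 < c) (hlam0 : 0 < lam) (hlam2 : lam < 2) (hT : 0 < T)
    (f : ℝ → Space d) (Lf : ℝ≥0) (hf : LipschitzWith Lf f)
    (A : ℝ → ℝ) (LA : ℝ≥0) (hA : LipschitzWith LA A) (hAmono : Monotone A) (hA0 : A 0 = 0)
    (u₀ : Space d → ℝ) (hu₀ : LocallyIntegrable u₀)
    -- numerical fluxes, with a Lipschitz constant common to the whole sequence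
    (F : ℕ → Fin d → ℝ → ℝ → ℝ) (LF : ℝ≥0)
    (hF : ∀ m l, IsNumericalFlux LF (fun v => f v l) (F m l))
    -- grids with `N Δt = T`, `Δx → 0` and the CFL condition
    (Δx Δt : ℕ → ℝ) (N : ℕ → ℕ) (hΔx : ∀ m, 0 < Δx m) (hΔt : ∀ m, 0 < Δt m)
    (hN : ∀ m, N m * Δt m = T) (hΔx0 : Tendsto Δx atTop (𝓝 0))
    (hCFL : ∀ m, CFL d c lam LF LA (Δx m) (Δt m))
    -- solutions of the scheme, uniformly bounded on `Q_T`
    (U : ℕ → ℕ → (Fin d → ℤ) → ℝ)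
    (hU : ∀ m, IsSchemeSolution c lam A (F m) u₀ (Δx m) (Δt m) (N m) (U m))
    (hbdd : ∃ M : ℝ, ∀ m, ∀ᵐ p ∂(volume.restrict (cylinder d T)),
      |interp (Δx m) (Δt m) (U m) p| ≤ M)
    -- convergence in `C([0,T]; L^1)`
    (u : Space d × ℝ → ℝ) (hu : IsBoundedContL1 T u)
    (hconv : Tendsto (fun m => ⨆ t ∈ Icc (0 : ℝ) T,
        eLpNorm (fun x : Space d => interp (Δx m) (Δt m) (U m) (x, t) - u (x, t)) 1 volume)
      atTop (𝓝 0)) :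
    IsEntropySolution c lam T f A u₀ u := by
  have : NeZero d := ⟨by omega⟩
  obtain ⟨M₀, hM₀⟩ := hbdd
  obtain ⟨w, M₁, hw, hwM₁, hwu⟩ := exists_measurable_forall_abs_le_ae_eq hu.memLp_top
  have hwM : ∀ p, |w p| ≤ max M₀ M₁ := fun p => (hwM₁ p).trans (le_max_right _ _)
  have hUM : ∀ m, ∀ n < N m, ∀ α, |U m n α| ≤ max M₀ M₁ := fun m _ hn α =>
    (abs_le_of_ae_interp_le (hΔx m) (hΔt m) (hN m) (hM₀ m) hn α).trans (le_max_left _ _)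
  obtain ⟨τ, hτ, hcfl, hscheme⟩ :=
    exists_timeStep_isSchemeFun hc hlam0 hT hA hF hΔx hΔx0 hΔt hN hCFL hU hUM
  have hlim : ConvergesSlicewise T τ (fun m => cutInterp (Δx m) (Δt m) T (U m)) w :=
    hu.convergesSlicewise hwu (fun m => measurable_cutInterp _ _ _ _)
      (tendsto_iSup_cutInterp_sub hconv) (tendsto_nhdsWithin_iff.1 hτ).1
  have hΔx' : Tendsto Δx atTop (𝓝[>] 0) :=
    tendsto_nhdsWithin_iff.2 ⟨hΔx0, Eventually.of_forall hΔx⟩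
  refine ⟨hu, fun k r hr φ hφ => ⟨?_, ?_⟩,
    initial_ae_eq hT.le hu₀ hΔx hΔx0 (fun m => (hU m).init) hu hconv⟩
  · exact (integrable_entropyIntegrand hlam0 hlam2 hr hf hA hw hwM hφ.contDiff_two
      hφ.compact).integrableOn.congr (entropyIntegrand_congr_ae hwu)
  · rw [← integral_congr_ae (entropyIntegrand_congr_ae hwu)]
    exact entropy_inequality_of_forall_level_null hlam0 hlam2 hr hf hA hw hwM hφ.contDiff_two
      hφ.compact Measure.restrict_le_self (fun k hk => entropy_inequality_of_level_null hc.le hlam0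
        hlam2 hr hA hAmono hF hΔx' hτ hcfl hscheme hw hwM hlim hk hφ) k
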